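/- Let $n\ge 1$, $a>0$ and $t>a-\frac12$. Write $x=(x',x_n)\in\mathbb R^n$, $\mathbb R^n_+=\{x_n>0\}$, $\langle\xi'\rangle=(1+|\xi'|^2)^{1/2}$. Let $H^s(\mathbb R^d)$ be the $L_2$ Bessel-potential space, let $\overline H^s(\mathbb R^n_+)=r^+H^s(\mathbb R^n)$ be the space of restrictions to $\mathbb R^n_+$ with the quotient norm, let $e^+$ denote extension by zero from $\mathbb R^n_+$ to $\mathbb R^n$ (for $-\frac12<s<0$, $e^+f$ is the unique element of $H^s(\mathbb R^n)$ with support in $\overline{\mathbb R}^n_+$ that restricts to $f\in\overline H^s(\mathbb R^n_+)$), and let $\Xi_+^\mu=\mathcal F^{-1}(\langle\xi'\rangle+i\xi_n)^\mu\mathcal F$, where $\mathcal Fu(\xi)=\int e^{-ix\cdot\xi}u(x)\,dx$. For $\mu\in\mathbb R$ and $t>\mu-\frac12$ the $\mu$-transmission space is $$H^{\mu(t)}(\overline{\mathbb R}^n_+)=\Xi_+^{-\mu}e^+\overline H^{t-\mu}(\mathbb R^n_+),$$ with the topology for which $\Xi_+^{-\mu}e^+$ is a homeomorphism from $\overline H^{t-\mu}(\mathbb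 R^n_+)$ onto it. Let $\mathcal S(\overline{\mathbb R}^n_+)=r^+\mathcal S(\mathbb R^n)$, and $\gamma_0v=v(\cdot,0)$ for $v\in\mathcal S(\overline{\mathbb R}^n_+)$. **Theorem 2.1.** The space $e^+x_n^{a-1}\mathcal S(\overline{\mathbb R}^n_+)$ is a dense subspace of $H^{(a-1)(t)}(\overline{\mathbb R}^n_+)$, and the mapping $\gamma_0^{a-1}\colon u\mapsto\gamma_0(u/x_n^{a-1})$ extends from it to a continuous linear surjective mapping $$\gamma_0^{a-1}\colon H^{(a-1)(t)}(\overline{\mathbb R}^n_+)\to H^{t-a+\frac12}(\mathbb R^{n-1}).$$ Here $H^{a(t)}(\overline{\mathbb R}^n_+)$ is a closed subspace of $H^{(a-1)(t)}(\overline{\mathbb R}^n_+)$ (the inclusion being a homeomorphism onto its image), equal to the set where $\gamma_0^{a-1}u=0$. -/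

import Mathlib

open MeasureTheory TemperedDistribution Distribution
open scoped SchwartzMap ENNReal

noncomputable section

namespace HalfSpace

/-! ### Bessel potential spaces -/

section Sobolev

variable (E : Type) [NormedAddCommGroup E] [InnerProductSpace ℝ E] [FiniteDimensional ℝ E]
  [MeasurableSpace E] [BorelSpace E]

/-- `H^s(E)`, based on `L²`, as a space of tempered distributions. -/
def sobolevSubmodule (s : ℝ) : Submodule ℂ 𝓢'(E, ℂ) where
  carrier := {u | MemSobolev s 2 u}
  add_mem' hu hv := hu.add hv
  zero_mem' := memSobolev_fun_zero E ℂ s 2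
  smul_mem' c _ hu := hu.smul c

/-- `H^s(E)` as a type of its own. It carries the Sobolev norm, not the topology induced from the
tempered distributions. -/
def SobolevSpace (s : ℝ) : Type := sobolevSubmodule E s

variable {E} {s : ℝ}

instance : AddCommGroup (SobolevSpace E s) := inferInstanceAs (AddCommGroup (sobolevSubmodule E s))

instance : Module ℂ (SobolevSpace E s) := inferInstanceAs (Module ℂ (sobolevSubmodule E s))

/-- The inclusion of `H^s(E)` into the tempered distributions. -/
def SobolevSpace.toDist : SobolevSpace E s →ₗ[ℂ] 𝓢'(E, ℂ) := (sobolevSubmodule E s).subtype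

theorem lp_toDist_injective (f g : Lp ℂ 2 (volume : Measure E))
    (h : (f : 𝓢'(E, ℂ)) = (g : 𝓢'(E, ℂ))) : f = g :=
  LinearMap.ker_eq_bot.mp (Lp.ker_toTemperedDistributionCLM_eq_bot (F := ℂ)
    (μ := (volume : Measure E)) (p := 2)) h

/-- The `L²` function `(1 - (2π)⁻²Δ)^{s/2} u` attached to `u ∈ H^s(E)`. -/
def SobolevSpace.toL2 : SobolevSpace E s →ₗ[ℂ] Lp ℂ 2 (volume : Measure E) where
  toFun u := (show MemSobolev s 2 u.toDist from u.2).choose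
  map_add' u v := by
    apply lp_toDist_injective
    have hu := (show MemSobolev s 2 u.toDist from u.2).choose_spec
    have hv := (show MemSobolev s 2 v.toDist from v.2).choose_spec
    have huv := (show MemSobolev s 2 (u + v).toDist from (u + v).2).choose_spec
    rw [← huv, ← Lp.toTemperedDistributionCLM_apply, map_add, map_add, map_add]
    simp only [Lp.toTemperedDistributionCLM_apply, ← hu, ← hv]
  map_smul' c u := by
    apply lp_toDist_injective
    have hu := (show MemSobolev s 2 u.toDist from u.2).choose_spec
    have hcu := (show MemSobolev s 2 (c • u).toDist from (c • u).2).choose_spec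
    rw [← hcu, ← Lp.toTemperedDistributionCLM_apply, map_smul, map_smul, map_smul]
    simp only [Lp.toTemperedDistributionCLM_apply, ← hu, RingHom.id_apply]

theorem SobolevSpace.besselPotential_toDist (u : SobolevSpace E s) :
    besselPotential E ℂ s u.toDist = (u.toL2 : 𝓢'(E, ℂ)) :=
  (show MemSobolev s 2 u.toDist from u.2).choose_spec

theorem SobolevSpace.toL2_injective :
    Function.Injective (SobolevSpace.toL2 : SobolevSpace E s →ₗ[ℂ] _) := by
  intro u v h
  have h1 : besselPotential E ℂ s u.toDist = besselPotential E ℂ s v.toDist := by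
    rw [u.besselPotential_toDist, v.besselPotential_toDist, h]
  have h2 := congrArg (besselPotential E ℂ (-s)) h1
  simp only [besselPotential_besselPotential_apply, add_neg_cancel, besselPotential_zero] at h2
  exact Subtype.ext h2

/-- The norm `‖u‖ = ‖⟨D⟩^s u‖_{L²}` of `H^s(E)`. Mathlib's Fourier transform has the kernel
`e^{-2πi x·ξ}`, and in its variable the weight of the norm is `(1 + |ξ|²)^{s/2}` instead of
`(1 + |2πξ|²)^{s/2}`; the two norms are equivalent. -/
instance : NormedAddCommGroup (SobolevSpace E s) :=
  NormedAddCommGroup.induced _ _ (SobolevSpace.toL2 : SobolevSpace E s →ₗ[ℂ] _)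
    SobolevSpace.toL2_injective

instance : NormedSpace ℂ (SobolevSpace E s) :=
  NormedSpace.induced ℂ _ _ (SobolevSpace.toL2 : SobolevSpace E s →ₗ[ℂ] _)

end Sobolev

/-! ### The half-space

`ℝⁿ` with `n = m + 1` is `EuclideanSpace ℝ (Fin (m + 1))`; the normal variable `x_n` is the last
coordinate, and `x' ∈ ℝ^m` are the others. -/

/-- `ℝ^d`. -/
abbrev Rd (d : ℕ) : Type := EuclideanSpace ℝ (Fin d)

/-- The normal coordinate `x_n`. -/
def normal (m : ℕ) : Rd (m + 1) →L[ℝ] ℝ := EuclideanSpace.proj (Fin.last m)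

/-- The tangential coordinates `x'`. -/
def tangential (m : ℕ) : Rd (m + 1) →L[ℝ] Rd m :=
  LinearMap.toContinuousLinearMap
    { toFun := fun x => WithLp.toLp 2 (fun i => x i.castSucc)
      map_add' := fun _ _ => rfl
      map_smul' := fun _ _ => rfl }

/-- The embedding `x' ↦ (x', 0)` of the boundary. -/
def boundary (m : ℕ) : Rd m →L[ℝ] Rd (m + 1) :=
  LinearMap.toContinuousLinearMap
    { toFun := fun y => WithLp.toLp 2 (Fin.snoc (α := fun _ => ℝ) y 0)
      map_add' := fun x y => by
        ext i
        refine Fin.lastCases ?_ (fun j => ?_) i <;> simp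
      map_smul' := fun c y => by
        ext i
        refine Fin.lastCases ?_ (fun j => ?_) i <;> simp }

theorem antilipschitz_boundary (m : ℕ) : AntilipschitzWith 1 (boundary m) := by
  refine (AddMonoidHomClass.isometry_of_norm (boundary m) fun y => ?_).antilipschitz
  rw [EuclideanSpace.norm_eq, EuclideanSpace.norm_eq, Fin.sum_univ_castSucc]
  simp [boundary]

/-- The trace `γ₀φ(x') = φ(x', 0)` of a Schwartz function. -/
def schwartzTrace (m : ℕ) : 𝓢(Rd (m + 1), ℂ) →L[ℂ] 𝓢(Rd m, ℂ) :=
  SchwartzMap.compCLMOfAntilipschitz ℂ (boundary m).hasTemperateGrowth (antilipschitz_boundary m)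

/-- The open upper half-space `ℝⁿ₊ = {x_n > 0}`. -/
def upper (m : ℕ) : Set (Rd (m + 1)) := {x | 0 < normal m x}

/-- The open lower half-space `ℝⁿ₋ = {x_n < 0}`. -/
def lower (m : ℕ) : Set (Rd (m + 1)) := {x | normal m x < 0}

/-! ### The order-reducing operators `Ξ₊^t` -/

/-- `⟨ξ'⟩ + i ξ_n`, where `2πξ` stands for `ξ` because Mathlib's Fourier transform has the kernel
`e^{-2πi x·ξ}`. -/
def xiBase (m : ℕ) (ξ : Rd (m + 1)) : ℂ :=
  (((1 + ‖(2 * Real.pi) • tangential m ξ‖ ^ 2) ^ (1 / 2 : ℝ) : ℝ) : ℂ) +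
    Complex.I * ((2 * Real.pi * normal m ξ : ℝ) : ℂ)

/-- The symbol `(⟨ξ'⟩ + i ξ_n)^t`, with the principal branch of the power. -/
def xiSymbol (m : ℕ) (t : ℝ) (ξ : Rd (m + 1)) : ℂ := xiBase m ξ ^ (t : ℂ)

/-- `Ξ₊^t = Op((⟨ξ'⟩ + i ξ_n)^t)`. -/
def Xi (m : ℕ) (t : ℝ) : 𝓢'(Rd (m + 1), ℂ) →L[ℂ] 𝓢'(Rd (m + 1), ℂ) :=
  fourierMultiplierCLM ℂ (xiSymbol m t)

theorem one_le_re_xiBase (m : ℕ) (ξ : Rd (m + 1)) : 1 ≤ (xiBase m ξ).re := by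
  simp only [xiBase, Complex.add_re, Complex.ofReal_re, Complex.mul_re, Complex.I_re,
    Complex.I_im, Complex.ofReal_im, zero_mul, one_mul, sub_zero, add_zero]
  exact Real.one_le_rpow (le_add_of_nonneg_right (by positivity)) (by norm_num)

theorem hasTemperateGrowth_xiBase (m : ℕ) : (xiBase m).HasTemperateGrowth := by
  have h1 : (fun ξ : Rd (m + 1) =>
      (1 + ‖(2 * Real.pi) • tangential m ξ‖ ^ 2) ^ (1 / 2 : ℝ)).HasTemperateGrowth := by
    have h := (Function.hasTemperateGrowth_one_add_norm_sq_rpow (Rd m) (1 / 2)).comp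
      (((2 * Real.pi) • tangential m).hasTemperateGrowth)
    exact h
  have h2 : (fun ξ : Rd (m + 1) => 2 * Real.pi * normal m ξ).HasTemperateGrowth :=
    ((2 * Real.pi) • normal m).hasTemperateGrowth
  have h3 := Function.Complex.hasTemperateGrowth_ofReal.comp h1
  have h4 := Function.Complex.hasTemperateGrowth_ofReal.comp h2
  exact h3.add ((Function.HasTemperateGrowth.const Complex.I).mul h4)

theorem hasTemperateGrowth_cpow {E : Type} [NormedAddCommGroup E] [NormedSpace ℝ E] {f : E → ℂ}
    (hf : f.HasTemperateGrowth) (hre : ∀ x, 1 ≤ (f x).re) (t : ℝ) :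
    (fun x => f x ^ (t : ℂ)).HasTemperateGrowth := by
  have hslit : ∀ x, f x ∈ Complex.slitPlane := fun x => Or.inl (by linarith [hre x])
  have hsmooth : ∀ r : ℝ, ContDiff ℝ (⊤ : ℕ∞) (fun x => f x ^ (r : ℂ)) := by
    intro r
    rw [contDiff_iff_contDiffAt]
    intro x
    have h1 : ContDiffAt ℂ (⊤ : ℕ∞) (fun z : ℂ => z ^ (r : ℂ)) (f x) := by
      have : AnalyticAt ℂ (fun z : ℂ => z ^ (r : ℂ)) (f x) :=
        analyticAt_id.cpow analyticAt_const (hslit x)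
      exact this.contDiffAt
    exact (h1.restrict_scalars ℝ).comp x hf.1.contDiffAt
  have hfd : ∀ (r : ℝ) (x : E), fderiv ℝ (fun x => f x ^ (r : ℂ)) x =
      ((r : ℂ) * f x ^ ((r - 1 : ℝ) : ℂ)) • fderiv ℝ f x := by
    intro r x
    have h1 : HasDerivAt (fun z : ℂ => z ^ (r : ℂ)) ((r : ℂ) * f x ^ ((r : ℂ) - 1)) (f x) := by
      simpa using (hasDerivAt_id (f x)).cpow_const (c := (r : ℂ)) (hslit x)
    have h2 : HasFDerivAt f (fderiv ℝ f x) x :=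
      (hf.1.differentiable (by simp)).differentiableAt.hasFDerivAt
    have h3 := (h1.comp_hasFDerivAt x h2).fderiv
    rw [show (((r - 1 : ℝ)) : ℂ) = (r : ℂ) - 1 by push_cast; ring]
    exact h3
  have hbound : ∀ n : ℕ, ∀ r : ℝ, ∃ (k : ℕ) (C : ℝ), 0 ≤ C ∧ ∀ x,
      ‖iteratedFDeriv ℝ n (fun x => f x ^ (r : ℂ)) x‖ ≤ C * (1 + ‖x‖) ^ k := by
    intro n
    induction n using Nat.strong_induction_on with
    | _ n ih =>
    intro r
    rcases n with _ | n
    · obtain ⟨k, C, hC⟩ := hf.2 0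
      simp only [norm_iteratedFDeriv_zero] at hC ⊢
      obtain ⟨N, hN⟩ := exists_nat_ge r
      have hC0 : 0 ≤ C := by simpa using (norm_nonneg _).trans (hC 0)
      refine ⟨k * N, C ^ N, by positivity, fun x => ?_⟩
      have h1 : 1 ≤ ‖f x‖ := (hre x).trans (Complex.re_le_norm _)
      rw [Complex.norm_cpow_of_ne_zero (Complex.slitPlane_ne_zero (hslit x))]
      simp only [Complex.ofReal_re, Complex.ofReal_im, mul_zero, Real.exp_zero, div_one]
      calc ‖f x‖ ^ r ≤ ‖f x‖ ^ (N : ℝ) := Real.rpow_le_rpow_of_exponent_le h1 hN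
        _ = ‖f x‖ ^ N := Real.rpow_natCast _ _
        _ ≤ (C * (1 + ‖x‖) ^ k) ^ N := by gcongr; exact hC x
        _ = _ := by rw [mul_pow, pow_mul]
    · choose k C hC0 hC using fun i : Fin (n + 1) => ih i i.2 (r - 1)
      obtain ⟨l, D, hD0, hD⟩ := hf.norm_iteratedFDeriv_le_uniform (n + 1)
      refine ⟨(∑ i, k i) + l, |r| * ∑ i : Fin (n + 1), (n.choose i : ℝ) * C i * D,
        mul_nonneg (abs_nonneg r) (Finset.sum_nonneg fun i _ =>
          mul_nonneg (mul_nonneg (Nat.cast_nonneg _) (hC0 i)) hD0), fun x => ?_⟩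
      have e1 : fderiv ℝ (fun x => f x ^ (r : ℂ)) =
          (r : ℝ) • fun x => (f x ^ ((r - 1 : ℝ) : ℂ)) • fderiv ℝ f x := by
        ext1 x
        rw [hfd, Pi.smul_apply, mul_smul]
        ext v
        simp
      have s1 : ContDiff ℝ (⊤ : ℕ∞) (fderiv ℝ f) := hf.1.fderiv_right (by simp)
      have s2 : ContDiff ℝ (⊤ : ℕ∞) (fun x => (f x ^ ((r - 1 : ℝ) : ℂ)) • fderiv ℝ f x) :=
        (hsmooth (r - 1)).smul s1
      rw [← norm_iteratedFDeriv_fderiv, e1,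
        iteratedFDeriv_const_smul_apply (s2.contDiffAt.of_le (by exact_mod_cast le_top)),
        norm_smul, Real.norm_eq_abs, mul_assoc]
      refine mul_le_mul_of_nonneg_left ?_ (abs_nonneg r)
      refine (norm_iteratedFDeriv_smul_le (hsmooth (r - 1)) s1 x
        (n := n) (by exact_mod_cast le_top)).trans ?_
      rw [Finset.sum_range, Finset.sum_mul]
      refine Finset.sum_le_sum fun i _ => ?_
      rw [norm_iteratedFDeriv_fderiv]
      have h1 : (1 : ℝ) ≤ 1 + ‖x‖ := by simp
      calc _ ≤ (n.choose i : ℝ) * (C i * (1 + ‖x‖) ^ (∑ i, k i)) * (D * (1 + ‖x‖) ^ l) := by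
            have h2 : ‖iteratedFDeriv ℝ i (fun x => f x ^ ((r - 1 : ℝ) : ℂ)) x‖ ≤
                C i * (1 + ‖x‖) ^ (∑ i, k i) :=
              (hC i x).trans (mul_le_mul_of_nonneg_left (pow_le_pow_right₀ h1
                (Finset.single_le_sum (f := k) (fun _ _ => Nat.zero_le _) (Finset.mem_univ i)))
                (hC0 i))
            have h3 := hD (n - i + 1) (by omega) x
            have h4 : 0 ≤ C i * (1 + ‖x‖) ^ (∑ i, k i) := (norm_nonneg _).trans h2
            gcongr
        _ = _ := by rw [pow_add]; ring
  exact ⟨hsmooth t, fun n => let ⟨k, C, _, h⟩ := hbound n t; ⟨k, C, h⟩⟩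

theorem hasTemperateGrowth_xiSymbol (m : ℕ) (t : ℝ) : (xiSymbol m t).HasTemperateGrowth :=
  hasTemperateGrowth_cpow (hasTemperateGrowth_xiBase m) (one_le_re_xiBase m) t

theorem Xi_Xi_neg (m : ℕ) (t : ℝ) (u : 𝓢'(Rd (m + 1), ℂ)) : Xi m t (Xi m (-t) u) = u := by
  rw [Xi, Xi, fourierMultiplierCLM_fourierMultiplierCLM_apply (hasTemperateGrowth_xiSymbol m _)
    (hasTemperateGrowth_xiSymbol m _)]
  have h : xiSymbol m (-t) * xiSymbol m t = fun _ => 1 := by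
    ext ξ
    have h0 : xiBase m ξ ≠ 0 := by
      intro h
      have := one_le_re_xiBase m ξ
      rw [h] at this
      norm_num at this
    simp [xiSymbol, ← Complex.cpow_add _ _ h0]
  rw [h]
  simp

/-! ### Restricted spaces, extension by zero, transmission spaces -/

/-- The elements of `H^s(ℝⁿ)` whose restriction to `ℝⁿ₊` is zero. -/
def restrictionKer (m : ℕ) (s : ℝ) : Submodule ℂ (SobolevSpace (Rd (m + 1)) s) where
  carrier := {u | IsVanishingOn u.toDist (upper m)}
  add_mem' {u v} hu hv g hg := by simp [hu g hg, hv g hg]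
  zero_mem' g _ := by simp
  smul_mem' c u hu g hg := by simp [hu g hg]

/-- The restricted space `r⁺H^s(ℝⁿ)` on `ℝⁿ₊`, with the quotient norm
`‖f‖ = inf {‖F‖_{H^s(ℝⁿ)} : r⁺F = f}`: restrictions to `ℝⁿ₊` are classes modulo `restrictionKer`. -/
abbrev RestrictedSpace (m : ℕ) (s : ℝ) : Type :=
  SobolevSpace (Rd (m + 1)) s ⧸ restrictionKer m s

/-- `e⁺` applied to `r⁺H^s(ℝⁿ)`, for `s > -1/2`, as a space of tempered distributions on `ℝⁿ`.
Its elements `F` have support in the closed half-space, agree on `ℝⁿ₊` with some `G ∈ H^s(ℝⁿ)`,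
and lie in `L²(ℝⁿ)` if `s ≥ 0` and in `H^s(ℝⁿ)` if `s < 0`. For `s ≥ 0` this says that `F` is the
function `G` on `ℝⁿ₊` and `0` elsewhere; for `-1/2 < s < 0` it expresses the identification of
`r⁺H^s(ℝⁿ)` with the space of elements of `H^s(ℝⁿ)` supported in the closed half-space, which is
how extension by zero is understood there. -/
def zeroExtensions (m : ℕ) (s : ℝ) : Submodule ℂ 𝓢'(Rd (m + 1), ℂ) where
  carrier := {F | IsVanishingOn F (lower m) ∧ MemSobolev (min s 0) 2 F ∧
    ∃ G : SobolevSpace (Rd (m + 1)) s, IsVanishingOn (F - G.toDist) (upper m)}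
  add_mem' := by
    rintro F₁ F₂ ⟨h1, h2, G₁, h3⟩ ⟨k1, k2, G₂, k3⟩
    refine ⟨fun g hg => by simp [h1 g hg, k1 g hg], h2.add k2, G₁ + G₂, fun g hg => ?_⟩
    have e1 := h3 g hg
    have e2 := k3 g hg
    rw [map_add, add_sub_add_comm]
    simpa [e1] using e2
  zero_mem' := ⟨fun g _ => by simp, memSobolev_fun_zero _ _ _ _, 0, fun g _ => by simp⟩
  smul_mem' := by
    rintro c F ⟨h1, h2, G, h3⟩
    refine ⟨fun g hg => by simp [h1 g hg], h2.smul c, c • G, fun g hg => ?_⟩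
    have e1 := h3 g hg
    rw [map_smul, ← smul_sub]
    change c • ((F - G.toDist) g) = 0
    rw [e1, smul_zero]

/-- The restriction `r⁺F` of an element `F` of `e⁺r⁺H^s(ℝⁿ)`, in the restricted space. -/
def restrict (m : ℕ) (s : ℝ) : zeroExtensions m s →ₗ[ℂ] RestrictedSpace m s where
  toFun F := Submodule.Quotient.mk F.2.2.2.choose
  map_add' F₁ F₂ := by
    rw [← Submodule.Quotient.mk_add, Submodule.Quotient.eq]
    intro g hg
    have e := (F₁ + F₂).2.2.2.choose_spec g hg
    have e1 := F₁.2.2.2.choose_spec g hg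
    have e2 := F₂.2.2.2.choose_spec g hg
    generalize (F₁ + F₂).2.2.2.choose = G at *
    generalize F₁.2.2.2.choose = G₁ at *
    generalize F₂.2.2.2.choose = G₂ at *
    change (F₁ : 𝓢'(Rd (m + 1), ℂ)) g + (F₂ : 𝓢'(Rd (m + 1), ℂ)) g - G.toDist g = 0 at e
    change (F₁ : 𝓢'(Rd (m + 1), ℂ)) g - G₁.toDist g = 0 at e1
    change (F₂ : 𝓢'(Rd (m + 1), ℂ)) g - G₂.toDist g = 0 at e2
    change G.toDist g - (G₁.toDist g + G₂.toDist g) = 0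
    linear_combination e1 + e2 - e
  map_smul' c F := by
    rw [RingHom.id_apply, ← Submodule.Quotient.mk_smul, Submodule.Quotient.eq]
    intro g hg
    have e := (c • F).2.2.2.choose_spec g hg
    have e1 := F.2.2.2.choose_spec g hg
    generalize (c • F).2.2.2.choose = G at *
    generalize F.2.2.2.choose = G₁ at *
    change c * (F : 𝓢'(Rd (m + 1), ℂ)) g - G.toDist g = 0 at e
    change (F : 𝓢'(Rd (m + 1), ℂ)) g - G₁.toDist g = 0 at e1
    change G.toDist g - c * G₁.toDist g = 0
    linear_combination c * e1 - e

/-- The `μ`-transmission space `H^{μ(t)} = Ξ₊^{-μ} e⁺ r⁺H^{t-μ}(ℝⁿ)` (for `t > μ - 1/2`), as a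
space of tempered distributions. -/
def transmissionSubmodule (m : ℕ) (μ t : ℝ) : Submodule ℂ 𝓢'(Rd (m + 1), ℂ) :=
  (zeroExtensions m (t - μ)).map (Xi m (-μ)).toLinearMap

/-- The `μ`-transmission space `H^{μ(t)}` as a type of its own. It carries its own norm, not the
topology induced from the tempered distributions. -/
def TransmissionSpace (m : ℕ) (μ t : ℝ) : Type := transmissionSubmodule m μ t

variable {m : ℕ} {μ t : ℝ}

instance : AddCommGroup (TransmissionSpace m μ t) :=
  inferInstanceAs (AddCommGroup (transmissionSubmodule m μ t))

instance : Module ℂ (TransmissionSpace m μ t) :=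
  inferInstanceAs (Module ℂ (transmissionSubmodule m μ t))

/-- The inclusion of `H^{μ(t)}` into the tempered distributions. -/
def TransmissionSpace.toDist : TransmissionSpace m μ t →ₗ[ℂ] 𝓢'(Rd (m + 1), ℂ) :=
  (transmissionSubmodule m μ t).subtype

theorem Xi_mem_zeroExtensions (u : TransmissionSpace m μ t) :
    Xi m μ u.toDist ∈ zeroExtensions m (t - μ) := by
  obtain ⟨F, hF, h⟩ := u.2
  have : u.toDist = Xi m (-μ) F := h.symm
  rw [this, Xi_Xi_neg]
  exact hF

/-- `u ↦ r⁺Ξ₊^μ u`, from `H^{μ(t)}` to the restricted space of order `t - μ`. -/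
def TransmissionSpace.toRestricted : TransmissionSpace m μ t →ₗ[ℂ] RestrictedSpace m (t - μ) :=
  restrict m (t - μ) ∘ₗ
    ((Xi m μ).toLinearMap ∘ₗ TransmissionSpace.toDist).codRestrict _ Xi_mem_zeroExtensions

/-- The norm `‖u‖ = ‖r⁺Ξ₊^μ u‖` of `H^{μ(t)}`, for which `Ξ₊^{-μ}e⁺` is an isometry of the
restricted space of order `t - μ` onto `H^{μ(t)}`. -/
instance : SeminormedAddCommGroup (TransmissionSpace m μ t) :=
  SeminormedAddCommGroup.induced _ _
    (TransmissionSpace.toRestricted : TransmissionSpace m μ t →ₗ[ℂ] _)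

instance : NormedSpace ℂ (TransmissionSpace m μ t) :=
  NormedSpace.induced ℂ _ _ (TransmissionSpace.toRestricted : TransmissionSpace m μ t →ₗ[ℂ] _)

/-- `u = e⁺(x_n^μ r⁺φ)`: the distribution `u` is the integrable function that equals
`x_n^μ φ(x)` for `x_n > 0` and `0` elsewhere. -/
def IsPowerTimes (μ : ℝ) (φ : 𝓢(Rd (m + 1), ℂ)) (u : 𝓢'(Rd (m + 1), ℂ)) : Prop :=
  ∃ f : Lp ℂ 1 (volume : Measure (Rd (m + 1))),
    (f =ᵐ[volume] (upper m).indicator fun x => ((normal m x ^ μ : ℝ) : ℂ) * φ x) ∧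
      u = (f : 𝓢'(Rd (m + 1), ℂ))

end HalfSpace

end

noncomputable section

set_option linter.unusedSectionVars false

namespace HalfSpace

open MeasureTheory TemperedDistribution Distribution
open scoped SchwartzMap ENNReal
open FourierTransform Filter

/-! ### Fourier multipliers on `L²` and on Sobolev spaces; density of Schwartz functions. -/

section Sobolev

variable {E : Type} [NormedAddCommGroup E] [InnerProductSpace ℝ E] [FiniteDimensional ℝ E]
  [MeasurableSpace E] [BorelSpace E]

/-! Every u in H^{μ(t)} is Ξ₊^{-μ}e⁺r⁺G with G ∈ H^{t-μ}(ℝⁿ), and G is unique modulo distributions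
vanishing on ℝⁿ₊ (`ofSobolev_surjective`, `toRestricted_ofSobolev`). Continuous maps out of a
transmission space are therefore continuous maps out of a Sobolev space that ignore what happens off
ℝⁿ₊ (`descend`). For μ = a-1 the order σ = t-a+1 exceeds 1/2, so G has an ordinary trace, and the
weighted trace of u turns out to be Γ(a)⁻¹γ₀G.

The constant comes from Ξ₊^s acting on e⁺(x_n^b φ). A Laplace transform writes Ξ₊^{-c} as Γ(c)⁻¹∫
r^{c-1} e^{-r⟨D'⟩}T_r dr, where T_r translates by r in the x_n direction (`sgnOp_neg_apply`). This
is a fractional integral in x_n with a tangential damping, so it sends x_n^b φ to x_n^{b+c}φ' with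
φ' Schwartz, and on the boundary it leaves a beta integral (`sgnDOp_neg_powDist`,
`schwartzTrace_powShift`). The first order operator Ξ₊ = ⟨D'⟩ + ∂_n lowers the exponent again, so in
general Ξ₊^s(x_n^b φ) = x_n^{b-s}φ' with γ₀φ' = Γ(b+1)/Γ(b-s+1) γ₀φ (`exists_sgnDOp_powDist`). With
b = s = a-1 this puts x_n^{a-1}𝒮 into H^{(a-1)(t)} and gives the factor Γ(a); with b = 0, s = 1-a it
shows that Schwartz G yield elements of x_n^{a-1}𝒮, and density follows from that of 𝒮 in H^σ.

Because the translations go one way only, powers of Ξ₊ preserve supports in the closed upper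
half-space and powers of Ξ₋, with symbol (⟨ξ'⟩ - iξ_n)^t, those in the closed lower one
(`preservesZero_sgnOp`).

The hinge is the jump formula Ξ₊e⁺r⁺g = e⁺r⁺Ξ₊g + γ₀g ⊗ δ(x_n) for g ∈ H^σ, σ > 1/2
(`sgnDOp_one_truncation`): integration by parts for Schwartz g, then density. Since Ξ₊g may have
negative order above -1/2, this needs a continuous e⁺r⁺ on H^s for -1/2 < s ≤ 0. It is obtained by
inverting a Wiener–Hopf operator: the symbol ((⟨ξ'⟩ - iξ_n)/(⟨ξ'⟩ + iξ_n))^s is unimodular with real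
part at least cos(πs) > 0, so its compression to L²(ℝⁿ₊) is invertible by a Neumann series
(`exists_truncation`).

The jump formula yields the rest. The trace ignores values off ℝⁿ₊ (`traceMap_eq_zero`). A Poisson
operator, equal on ℝⁿ₊ to ψ ↦ Ξ₊⁻¹(ψ ⊗ δ) but corrected off it so as to land in H^σ, is a right
inverse of the trace (`traceMap_lift`), whence surjectivity. Finally, if γ₀g = 0 then Ξ₊^{1-a}e⁺r⁺g
= Ξ₊^{-a}e⁺r⁺Ξ₊g ∈ H^{a(t)}, and conversely each element of H^{a(t)} arises from a g of zero trace
(`toDist_ofSobolev_xiInvTraceless`). So H^{a(t)} is the kernel, and both passages are continuous. -/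

theorem lp_toDist_add (f g : Lp ℂ 2 (volume : Measure E)) :
    ((f + g : Lp ℂ 2 (volume : Measure E)) : 𝓢'(E, ℂ)) = (f : 𝓢'(E, ℂ)) + (g : 𝓢'(E, ℂ)) :=
  map_add (Lp.toTemperedDistributionCLM ℂ volume 2) f g

theorem lp_toDist_smul (c : ℂ) (f : Lp ℂ 2 (volume : Measure E)) :
    ((c • f : Lp ℂ 2 (volume : Measure E)) : 𝓢'(E, ℂ)) = c • (f : 𝓢'(E, ℂ)) :=
  map_smul (Lp.toTemperedDistributionCLM ℂ volume 2) c f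

/-- Multiplication by a bounded function in `L²`. -/
def l2Smul {p : E → ℂ} (hm : MemLp p ⊤ (volume : Measure E)) :
    Lp ℂ 2 (volume : Measure E) →ₗ[ℂ] Lp ℂ 2 (volume : Measure E) where
  toFun f := hm.toLp p • f
  map_add' f g := by
    refine Lp.ext ?_
    filter_upwards [Lp.coeFn_lpSMul (r := 2) (hm.toLp p) (f + g),
      Lp.coeFn_lpSMul (r := 2) (hm.toLp p) f, Lp.coeFn_lpSMul (r := 2) (hm.toLp p) g,
      Lp.coeFn_add f g, Lp.coeFn_add (hm.toLp p • f : Lp ℂ 2 (volume : Measure E))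
        (hm.toLp p • g : Lp ℂ 2 (volume : Measure E))] with x h1 h2 h3 h4 h5
    rw [h1, h5]
    simp only [Pi.smul_apply', Pi.add_apply, h2, h3, h4]
    exact smul_add _ _ _
  map_smul' c f := by
    refine Lp.ext ?_
    filter_upwards [Lp.coeFn_lpSMul (r := 2) (hm.toLp p) (c • f),
      Lp.coeFn_lpSMul (r := 2) (hm.toLp p) f, Lp.coeFn_smul c f,
      Lp.coeFn_smul c (hm.toLp p • f : Lp ℂ 2 (volume : Measure E))] with x h1 h2 h3 h4
    simp only [RingHom.id_apply]
    rw [h1, h4]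
    simp only [Pi.smul_apply', Pi.smul_apply, h2, h3]
    exact smul_comm _ _ _

theorem norm_l2Smul_le {p : E → ℂ} (hm : MemLp p ⊤ (volume : Measure E)) {C : ℝ}
    (hC : ∀ ξ, ‖p ξ‖ ≤ C) (f : Lp ℂ 2 (volume : Measure E)) : ‖l2Smul hm f‖ ≤ C * ‖f‖ := by
  have hC0 : 0 ≤ C := (norm_nonneg _).trans (hC 0)
  refine (Lp.norm_smul_le (hm.toLp p) f).trans ?_
  gcongr
  rw [Lp.norm_toLp]
  refine ENNReal.toReal_le_of_le_ofReal hC0 ?_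
  refine (eLpNorm_le_of_ae_bound (Filter.Eventually.of_forall hC)).trans ?_
  simp

/-- The Fourier multiplier with a bounded symbol, as an operator in `L²`. -/
def l2MultLM {p : E → ℂ} (hm : MemLp p ⊤ (volume : Measure E)) :
    Lp ℂ 2 (volume : Measure E) →ₗ[ℂ] Lp ℂ 2 (volume : Measure E) :=
  (Lp.fourierTransformₗᵢ E ℂ).symm.toLinearEquiv.toLinearMap ∘ₗ l2Smul hm ∘ₗ
    (Lp.fourierTransformₗᵢ E ℂ).toLinearEquiv.toLinearMap

theorem l2MultLM_toDist {p : E → ℂ} (hp : p.HasTemperateGrowth)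
    (hm : MemLp p ⊤ (volume : Measure E)) (f : Lp ℂ 2 (volume : Measure E)) :
    ((l2MultLM hm f : Lp ℂ 2 (volume : Measure E)) : 𝓢'(E, ℂ)) =
      fourierMultiplierCLM ℂ p (f : 𝓢'(E, ℂ)) := by
  change ((𝓕⁻ (hm.toLp p • 𝓕 f : Lp ℂ 2 (volume : Measure E)) : Lp ℂ 2 (volume : Measure E)) :
    𝓢'(E, ℂ)) = _
  rw [← Lp.fourierInv_toTemperedDistribution_eq, Lp.toTemperedDistribution_smul_eq hp,
    ← Lp.fourier_toTemperedDistribution_eq, fourierMultiplierCLM_apply]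

theorem norm_l2MultLM_le {p : E → ℂ} (hm : MemLp p ⊤ (volume : Measure E)) {C : ℝ}
    (hC : ∀ ξ, ‖p ξ‖ ≤ C) (f : Lp ℂ 2 (volume : Measure E)) : ‖l2MultLM hm f‖ ≤ C * ‖f‖ := by
  change ‖(Lp.fourierTransformₗᵢ E ℂ).symm (l2Smul hm (Lp.fourierTransformₗᵢ E ℂ f))‖ ≤ _
  rw [LinearIsometryEquiv.norm_map]
  refine (norm_l2Smul_le hm hC _).trans ?_
  rw [LinearIsometryEquiv.norm_map]

theorem memLp_top_symbol {p : E → ℂ} (hp : p.HasTemperateGrowth) {C : ℝ} (hC : ∀ ξ, ‖p ξ‖ ≤ C) :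
    MemLp p ⊤ (volume : Measure E) :=
  memLp_top_of_bound hp.1.continuous.aestronglyMeasurable C (Filter.Eventually.of_forall hC)

/-- The Fourier multiplier with a bounded symbol, as an operator in `L²`. -/
def l2Mult {p : E → ℂ} (hp : p.HasTemperateGrowth) {C : ℝ} (hC : ∀ ξ, ‖p ξ‖ ≤ C) :
    Lp ℂ 2 (volume : Measure E) →L[ℂ] Lp ℂ 2 (volume : Measure E) :=
  (l2MultLM (memLp_top_symbol hp hC)).mkContinuous C (norm_l2MultLM_le _ hC)

theorem norm_l2Mult_le {p : E → ℂ} (hp : p.HasTemperateGrowth) {C : ℝ} (hC : ∀ ξ, ‖p ξ‖ ≤ C) :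
    ‖l2Mult hp hC‖ ≤ C :=
  LinearMap.mkContinuous_norm_le _ ((norm_nonneg _).trans (hC 0)) _

theorem l2Mult_toDist {p : E → ℂ} (hp : p.HasTemperateGrowth) {C : ℝ} (hC : ∀ ξ, ‖p ξ‖ ≤ C)
    (f : Lp ℂ 2 (volume : Measure E)) :
    ((l2Mult hp hC f : Lp ℂ 2 (volume : Measure E)) : 𝓢'(E, ℂ)) =
      fourierMultiplierCLM ℂ p (f : 𝓢'(E, ℂ)) := l2MultLM_toDist hp _ f

theorem continuous_lp_apply (χ : 𝓢(E, ℂ)) :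
    Continuous fun f : Lp ℂ 2 (volume : Measure E) => (f : 𝓢'(E, ℂ)) χ :=
  (PointwiseConvergenceCLM.evalCLM (RingHom.id ℂ) ℂ χ).continuous.comp
    (Lp.toTemperedDistributionCLM ℂ volume 2).continuous

theorem hasTemperateGrowth_bessel (s : ℝ) :
    (fun x : E => (((1 + ‖x‖ ^ 2) ^ (s / 2) : ℝ) : ℂ)).HasTemperateGrowth := by fun_prop

/-- `H^s(E)` is isometric to `L²(E)`. -/
def SobolevSpace.equivL2 (s : ℝ) : SobolevSpace E s ≃ₗᵢ[ℂ] Lp ℂ 2 (volume : Measure E) :=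
  LinearIsometryEquiv.ofSurjective
    ({ SobolevSpace.toL2 with norm_map' := fun _ => rfl } : SobolevSpace E s →ₗᵢ[ℂ] _) fun f => by
      refine ⟨⟨besselPotential E ℂ (-s) (f : 𝓢'(E, ℂ)), f, by simp⟩, ?_⟩
      apply lp_toDist_injective
      refine (SobolevSpace.besselPotential_toDist _).symm.trans ?_
      change besselPotential E ℂ s (besselPotential E ℂ (-s) _) = _
      simp

theorem SobolevSpace.equivL2_toDist {s : ℝ} (u : SobolevSpace E s) :
    ((SobolevSpace.equivL2 s u : Lp ℂ 2 (volume : Measure E)) : 𝓢'(E, ℂ)) =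
      besselPotential E ℂ s u.toDist := u.besselPotential_toDist.symm

theorem SobolevSpace.toDist_equivL2_symm {s : ℝ} (f : Lp ℂ 2 (volume : Measure E)) :
    ((SobolevSpace.equivL2 s).symm f).toDist = besselPotential E ℂ (-s) (f : 𝓢'(E, ℂ)) := by
  have h := SobolevSpace.equivL2_toDist ((SobolevSpace.equivL2 s).symm f)
  rw [LinearIsometryEquiv.apply_symm_apply] at h
  rw [h]
  simp

theorem SobolevSpace.toDist_injective {s : ℝ} :
    Function.Injective (SobolevSpace.toDist : SobolevSpace E s →ₗ[ℂ] _) :=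
  Subtype.val_injective

/-- A member of `H^s(E)` from a tempered distribution. -/
def SobolevSpace.mk {s : ℝ} (u : 𝓢'(E, ℂ)) (hu : MemSobolev s 2 u) : SobolevSpace E s := ⟨u, hu⟩

@[simp]
theorem SobolevSpace.toDist_mk {s : ℝ} (u : 𝓢'(E, ℂ)) (hu : MemSobolev s 2 u) :
    (SobolevSpace.mk u hu).toDist = u := rfl

theorem SobolevSpace.memSobolev {s : ℝ} (u : SobolevSpace E s) : MemSobolev s 2 u.toDist := u.2

theorem SobolevSpace.continuous_apply {s : ℝ} (χ : 𝓢(E, ℂ)) :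
    Continuous fun u : SobolevSpace E s => u.toDist χ := by
  have h : (fun u : SobolevSpace E s => u.toDist χ) = fun u =>
      ((SobolevSpace.equivL2 s u : Lp ℂ 2 (volume : Measure E)) : 𝓢'(E, ℂ))
        (𝓕 (SchwartzMap.smulLeftCLM ℂ (fun x : E => (((1 + ‖x‖ ^ 2) ^ (-s / 2) : ℝ) : ℂ))
          (𝓕⁻ χ))) := by
    ext u
    have h1 : u.toDist = besselPotential E ℂ (-s)
        ((SobolevSpace.equivL2 s u : Lp ℂ 2 (volume : Measure E)) : 𝓢'(E, ℂ)) := by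
      rw [SobolevSpace.equivL2_toDist]; simp
    rw [h1]
    rfl
  rw [h]
  exact (continuous_lp_apply _).comp (SobolevSpace.equivL2 s).continuous

theorem bessel_mul_symbol {p : E → ℂ} (hp : p.HasTemperateGrowth) (s s' : ℝ) :
    (fun ξ => p ξ * (((1 + ‖ξ‖ ^ 2) ^ ((s' - s) / 2) : ℝ) : ℂ)).HasTemperateGrowth :=
  hp.mul (hasTemperateGrowth_bessel (s' - s))

theorem norm_bessel_mul_symbol {p : E → ℂ} {s s' C : ℝ}
    (hC : ∀ ξ, ‖p ξ‖ * (1 + ‖ξ‖ ^ 2) ^ ((s' - s) / 2) ≤ C) (ξ : E) :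
    ‖p ξ * (((1 + ‖ξ‖ ^ 2) ^ ((s' - s) / 2) : ℝ) : ℂ)‖ ≤ C := by
  rw [norm_mul, Complex.norm_real, Real.norm_of_nonneg (by positivity)]
  exact hC ξ

/-- A Fourier multiplier between Sobolev spaces. -/
def SobolevSpace.mult {p : E → ℂ} (hp : p.HasTemperateGrowth) {s s' C : ℝ}
    (hC : ∀ ξ, ‖p ξ‖ * (1 + ‖ξ‖ ^ 2) ^ ((s' - s) / 2) ≤ C) :
    SobolevSpace E s →L[ℂ] SobolevSpace E s' :=
  ((SobolevSpace.equivL2 (E := E) s').symm.toContinuousLinearEquiv :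
      Lp ℂ 2 (volume : Measure E) →L[ℂ] _) ∘L
    l2Mult (bessel_mul_symbol hp s s') (norm_bessel_mul_symbol hC) ∘L
    ((SobolevSpace.equivL2 (E := E) s).toContinuousLinearEquiv : SobolevSpace E s →L[ℂ] _)

theorem SobolevSpace.toDist_mult {p : E → ℂ} (hp : p.HasTemperateGrowth) {s s' C : ℝ}
    (hC : ∀ ξ, ‖p ξ‖ * (1 + ‖ξ‖ ^ 2) ^ ((s' - s) / 2) ≤ C) (u : SobolevSpace E s) :
    (SobolevSpace.mult hp hC u).toDist = fourierMultiplierCLM ℂ p u.toDist := by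
  change ((SobolevSpace.equivL2 s').symm (l2Mult (bessel_mul_symbol hp s s')
    (norm_bessel_mul_symbol hC) (SobolevSpace.equivL2 s u))).toDist = _
  rw [SobolevSpace.toDist_equivL2_symm, l2Mult_toDist, SobolevSpace.equivL2_toDist,
    besselPotential, besselPotential,
    fourierMultiplierCLM_fourierMultiplierCLM_apply (hasTemperateGrowth_bessel _)
      (bessel_mul_symbol hp s s'),
    fourierMultiplierCLM_fourierMultiplierCLM_apply
      ((hasTemperateGrowth_bessel _).mul (bessel_mul_symbol hp s s'))
      (hasTemperateGrowth_bessel _)]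
  congr 2
  ext ξ
  simp only [Pi.mul_apply]
  have h : (1 + ‖ξ‖ ^ 2) ^ (s / 2) * (1 + ‖ξ‖ ^ 2) ^ ((s' - s) / 2) *
      (1 + ‖ξ‖ ^ 2) ^ (-s' / 2) = 1 := by
    rw [← Real.rpow_add (by positivity), ← Real.rpow_add (by positivity)]
    ring_nf
    simp
  have h' := congrArg (fun x : ℝ => (x : ℂ)) h
  simp only [Complex.ofReal_mul, Complex.ofReal_one] at h'
  linear_combination (p ξ) * h'

/-- A Schwartz function as an element of `H^s(E)`. -/
def SobolevSpace.ofSchwartz (s : ℝ) (φ : 𝓢(E, ℂ)) : SobolevSpace E s :=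
  SobolevSpace.mk (φ : 𝓢'(E, ℂ)) φ.memSobolev

@[simp]
theorem SobolevSpace.toDist_ofSchwartz (s : ℝ) (φ : 𝓢(E, ℂ)) :
    (SobolevSpace.ofSchwartz s φ).toDist = (φ : 𝓢'(E, ℂ)) := rfl

theorem SobolevSpace.equivL2_symm_toLp (s : ℝ) (φ : 𝓢(E, ℂ)) :
    (SobolevSpace.equivL2 s).symm (φ.toLp 2) = SobolevSpace.ofSchwartz s
      (SchwartzMap.fourierMultiplierCLM ℂ
        (fun x : E => (((1 + ‖x‖ ^ 2) ^ (-s / 2) : ℝ) : ℂ)) φ) := by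
  apply SobolevSpace.toDist_injective
  rw [SobolevSpace.toDist_equivL2_symm, SobolevSpace.toDist_ofSchwartz,
    Lp.toTemperedDistribution_toLp_eq, besselPotential,
    fourierMultiplierCLM_toTemperedDistributionCLM_eq (hasTemperateGrowth_bessel _)]

/-- The Bessel potential is an isometry between H^s and L² that carries Schwartz functions to
Schwartz functions, so density is inherited from L². -/
theorem SobolevSpace.denseRange_ofSchwartz (s : ℝ) :
    DenseRange (SobolevSpace.ofSchwartz s : 𝓢(E, ℂ) → SobolevSpace E s) := by
  have h : DenseRange fun φ : 𝓢(E, ℂ) => (SobolevSpace.equivL2 s).symm (φ.toLp 2) :=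
    (SobolevSpace.equivL2 (E := E) s).symm.surjective.denseRange.comp
      (SchwartzMap.denseRange_toLpCLM (p := 2) ENNReal.ofNat_ne_top)
      (SobolevSpace.equivL2 s).symm.continuous
  refine h.mono ?_
  rintro _ ⟨φ, rfl⟩
  exact ⟨_, (SobolevSpace.equivL2_symm_toLp s φ).symm⟩

/-- The inclusion between Sobolev spaces. -/
def SobolevSpace.incl {s s' : ℝ} (h : s' ≤ s) : SobolevSpace E s →L[ℂ] SobolevSpace E s' :=
  SobolevSpace.mult (p := fun _ => 1) (C := 1) (Function.HasTemperateGrowth.const 1) fun ξ => by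
    rw [norm_one, one_mul]
    exact Real.rpow_le_one_of_one_le_of_nonpos (by simp) (by linarith)

@[simp]
theorem SobolevSpace.toDist_incl {s s' : ℝ} (h : s' ≤ s) (u : SobolevSpace E s) :
    (SobolevSpace.incl h u).toDist = u.toDist := by
  simp [SobolevSpace.incl, SobolevSpace.toDist_mult]

/-- The transpose of a Fourier multiplier is the multiplier with the reflected symbol. -/
theorem fourier_smul_fourierInv {p : E → ℂ} (hp : p.HasTemperateGrowth) (φ : 𝓢(E, ℂ)) :
    𝓕 (SchwartzMap.smulLeftCLM ℂ p (𝓕⁻ φ)) =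
      SchwartzMap.fourierMultiplierCLM ℂ (fun ξ => p (-ξ)) φ := by
  have hp' : (fun ξ => p (-ξ)).HasTemperateGrowth :=
    hp.comp (-ContinuousLinearMap.id ℝ E).hasTemperateGrowth
  ext x
  rw [SchwartzMap.fourierMultiplierCLM_apply, SchwartzMap.fourierInv_coe, SchwartzMap.fourier_coe,
    Real.fourier_eq', Real.fourierInv_eq', ← integral_neg_eq_self]
  congr 1
  ext ξ
  rw [SchwartzMap.smulLeftCLM_apply_apply hp, SchwartzMap.smulLeftCLM_apply_apply hp',
    SchwartzMap.fourierInv_coe, SchwartzMap.fourier_coe, Real.fourierInv_eq_fourier_neg, neg_neg]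
  congr 2
  simp

theorem fourierMultiplier_apply {p : E → ℂ} (hp : p.HasTemperateGrowth) (u : 𝓢'(E, ℂ))
    (φ : 𝓢(E, ℂ)) :
    fourierMultiplierCLM ℂ p u φ = u (SchwartzMap.fourierMultiplierCLM ℂ (fun ξ => p (-ξ)) φ) := by
  rw [fourierMultiplierCLM_apply_apply, fourier_smul_fourierInv hp]

end Sobolev

/-! ### Splitting off the normal variable -/

section Split

variable {m : ℕ}

/-- The unit vector in the normal direction. -/
def normalVec (m : ℕ) : Rd (m + 1) := EuclideanSpace.single (Fin.last m) 1

/-- The point `(x', y)`. -/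
def join (x : Rd m) (y : ℝ) : Rd (m + 1) := boundary m x + y • normalVec m

@[simp]
theorem join_castSucc (x : Rd m) (y : ℝ) (i : Fin m) : join x y i.castSucc = x i := by
  simp [join, boundary, normalVec, Fin.castSucc_ne_last]

@[simp]
theorem join_last (x : Rd m) (y : ℝ) : join x y (Fin.last m) = y := by
  simp [join, boundary, normalVec]

@[simp]
theorem normal_join (x : Rd m) (y : ℝ) : normal m (join x y) = y := join_last x y

@[simp]
theorem tangential_join (x : Rd m) (y : ℝ) : tangential m (join x y) = x := by
  ext i
  exact join_castSucc x y i

@[simp]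
theorem join_tangential_normal (x : Rd (m + 1)) : join (tangential m x) (normal m x) = x := by
  ext i
  refine Fin.lastCases ?_ (fun j => ?_) i
  · rw [join_last]; rfl
  · rw [join_castSucc]; rfl

theorem join_zero (x : Rd m) : join x 0 = boundary m x := by simp [join]

theorem inner_eq_split (x ξ : Rd (m + 1)) :
    inner ℝ x ξ = inner ℝ (tangential m x) (tangential m ξ) + normal m x * normal m ξ := by
  simp only [PiLp.inner_apply, Fin.sum_univ_castSucc]
  congr 1
  exact mul_comm _ _

theorem norm_sq_split (x : Rd (m + 1)) :
    ‖x‖ ^ 2 = ‖tangential m x‖ ^ 2 + normal m x ^ 2 := by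
  rw [← real_inner_self_eq_norm_sq, ← real_inner_self_eq_norm_sq, inner_eq_split, sq]

theorem norm_tangential_le (x : Rd (m + 1)) : ‖tangential m x‖ ≤ ‖x‖ := by
  refine abs_le_of_sq_le_sq' ?_ (norm_nonneg _) |>.2
  rw [norm_sq_split x]
  nlinarith [sq_nonneg (normal m x)]

theorem abs_normal_le (x : Rd (m + 1)) : |normal m x| ≤ ‖x‖ := by
  refine abs_le_of_sq_le_sq ?_ (norm_nonneg _)
  rw [norm_sq_split x]
  nlinarith [sq_nonneg ‖tangential m x‖]

theorem norm_le_split (x : Rd (m + 1)) : ‖x‖ ≤ ‖tangential m x‖ + |normal m x| := by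
  refine abs_le_of_sq_le_sq' ?_ (by positivity) |>.2
  rw [norm_sq_split x, add_sq, sq_abs]
  nlinarith [mul_nonneg (norm_nonneg (tangential m x)) (abs_nonneg (normal m x))]

/-- The splitting of `ℝ^(m+1)` as a measurable equivalence. -/
def splitEquiv (m : ℕ) : Rd (m + 1) ≃ᵐ ℝ × Rd m :=
  ((MeasurableEquiv.toLp 2 (Fin (m + 1) → ℝ)).symm.trans
    (MeasurableEquiv.piFinSuccAbove (fun _ => ℝ) (Fin.last m))).trans
    ((MeasurableEquiv.refl ℝ).prodCongr (MeasurableEquiv.toLp 2 (Fin m → ℝ)))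

theorem splitEquiv_apply (x : Rd (m + 1)) : splitEquiv m x = (normal m x, tangential m x) := by
  refine Prod.ext rfl ?_
  ext i
  simp [splitEquiv, MeasurableEquiv.piFinSuccAbove, MeasurableEquiv.prodCongr, Fin.init]
  rfl

theorem splitEquiv_symm_apply (p : ℝ × Rd m) : (splitEquiv m).symm p = join p.2 p.1 := by
  rw [MeasurableEquiv.symm_apply_eq, splitEquiv_apply]
  simp

theorem measurePreserving_splitEquiv : MeasurePreserving (splitEquiv m) := by
  have h1 := (EuclideanSpace.volume_preserving_symm_measurableEquiv_toLp (Fin (m + 1)))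
  have h2 := volume_preserving_piFinSuccAbove (fun _ : Fin (m + 1) => ℝ) (Fin.last m)
  have h3 : MeasurePreserving ((MeasurableEquiv.refl ℝ).prodCongr
      (MeasurableEquiv.toLp 2 (Fin m → ℝ))) volume volume :=
    (MeasurePreserving.id volume).prod (PiLp.volume_preserving_toLp (Fin m))
  exact h3.comp (h2.comp h1)

theorem measurePreserving_join :
    MeasurePreserving (fun p : ℝ × Rd m => join p.2 p.1) (volume.prod volume) volume := by
  have h := (measurePreserving_splitEquiv (m := m)).symm
  have e : ((splitEquiv m).symm : ℝ × Rd m → Rd (m + 1)) = fun p => join p.2 p.1 :=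
    funext splitEquiv_symm_apply
  rwa [e] at h

theorem measurableEmbedding_join :
    MeasurableEmbedding (fun p : ℝ × Rd m => join p.2 p.1) := by
  have h := (splitEquiv m).symm.measurableEmbedding
  have e : ((splitEquiv m).symm : ℝ × Rd m → Rd (m + 1)) = fun p => join p.2 p.1 :=
    funext splitEquiv_symm_apply
  rwa [e] at h

variable {F : Type*} [NormedAddCommGroup F] [NormedSpace ℝ F]

theorem integrable_join_iff {f : Rd (m + 1) → F} :
    Integrable (fun p : ℝ × Rd m => f (join p.2 p.1)) (volume.prod volume) ↔ Integrable f :=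
  measurePreserving_join.integrable_comp_emb measurableEmbedding_join

/-- Integration over the normal variable first on the outside. -/
theorem integral_split {f : Rd (m + 1) → F} (hf : Integrable f) :
    ∫ x, f x = ∫ y : ℝ, ∫ x : Rd m, f (join x y) := by
  rw [← measurePreserving_join.integral_comp measurableEmbedding_join]
  exact integral_prod _ (integrable_join_iff.mpr hf)

theorem integral_split' {f : Rd (m + 1) → F} (hf : Integrable f) :
    ∫ x, f x = ∫ x : Rd m, ∫ y : ℝ, f (join x y) := by
  rw [← measurePreserving_join.integral_comp measurableEmbedding_join]
  exact integral_prod_symm _ (integrable_join_iff.mpr hf)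

theorem setIntegral_upper {f : Rd (m + 1) → F} (hf : IntegrableOn f (upper m)) :
    ∫ x in upper m, f x = ∫ y in Set.Ioi (0 : ℝ), ∫ x : Rd m, f (join x y) := by
  have hm : MeasurableSet (upper m) := measurableSet_lt measurable_const (normal m).measurable
  rw [← integral_indicator hm, integral_split (hf.integrable_indicator hm),
    ← integral_indicator measurableSet_Ioi]
  congr 1
  ext y
  by_cases hy : 0 < y
  · simp [Set.indicator, upper, hy]
  · simp [Set.indicator, upper, hy]

/-- A bound in product form, so that the tangential and normal integrals in Fubini arguments are
dominated separately. -/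
theorem exists_decay (φ : 𝓢(Rd (m + 1), ℂ)) (k l : ℕ) : ∃ C, 0 ≤ C ∧ ∀ x,
    ‖φ x‖ ≤ C * (((1 + ‖tangential m x‖) ^ k)⁻¹ * ((1 + |normal m x|) ^ l)⁻¹) := by
  refine ⟨2 ^ (k + l) * (Finset.Iic (k + l, 0)).sup
    (fun m => SchwartzMap.seminorm ℝ m.1 m.2) φ, by positivity, fun x => ?_⟩
  have h := SchwartzMap.one_add_le_sup_seminorm_apply (𝕜 := ℝ) (m := (k + l, 0)) le_rfl le_rfl φ x
  simp only [norm_iteratedFDeriv_zero] at h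
  rw [← mul_inv, ← div_eq_mul_inv, le_div_iff₀ (by positivity)]
  refine le_trans ?_ h
  rw [mul_comm, pow_add]
  gcongr
  · exact norm_tangential_le x
  · exact abs_normal_le x

end Split

/-! ### Slices -/

section Slice

variable {m : ℕ}

/-- The slice `φ(·, y)`. -/
def slice (y : ℝ) : 𝓢(Rd (m + 1), ℂ) →L[ℂ] 𝓢(Rd m, ℂ) :=
  schwartzTrace m ∘L SchwartzMap.compSubConstCLM ℂ (-(y • normalVec m))

@[simp]
theorem slice_apply (y : ℝ) (φ : 𝓢(Rd (m + 1), ℂ)) (x : Rd m) : slice y φ x = φ (join x y) := by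
  change φ (boundary m x - -(y • normalVec m)) = _
  rw [sub_neg_eq_add]
  rfl

theorem slice_zero : (slice 0 : 𝓢(Rd (m + 1), ℂ) →L[ℂ] _) = schwartzTrace m := by
  ext φ x
  rw [slice_apply, join_zero]
  rfl

theorem schwartzTrace_apply (φ : 𝓢(Rd (m + 1), ℂ)) (x : Rd m) :
    schwartzTrace m φ x = φ (join x 0) := by
  rw [← slice_zero, slice_apply]

@[fun_prop]
theorem continuous_join {X : Type*} [TopologicalSpace X] {f : X → Rd m} {g : X → ℝ}
    (hf : Continuous f) (hg : Continuous g) : Continuous fun x => join (f x) (g x) := by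
  unfold join
  fun_prop

theorem integrable_inv_one_add_abs_sq : Integrable fun y : ℝ => ((1 + |y|) ^ 2)⁻¹ := by
  refine integrable_inv_one_add_sq.mono' ?_ (Filter.Eventually.of_forall fun y => ?_)
  · refine Continuous.aestronglyMeasurable (Continuous.inv₀ (by fun_prop) fun y => ?_)
    positivity
  · rw [Real.norm_of_nonneg (by positivity)]
    gcongr
    rw [add_sq, sq_abs]
    nlinarith [abs_nonneg y]

/-- Fourier inversion in the normal variable alone. -/
theorem fourier_slice (y : ℝ) (φ : 𝓢(Rd (m + 1), ℂ)) (ξ : Rd m) :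
    𝓕 (slice y φ) ξ =
      ∫ τ : ℝ, Complex.exp ((2 * Real.pi * (y * τ) : ℝ) * Complex.I) * 𝓕 φ (join ξ τ) := by
  set b : Rd m → ℂ := fun ξ =>
    ∫ τ : ℝ, Complex.exp ((2 * Real.pi * (y * τ) : ℝ) * Complex.I) * 𝓕 φ (join ξ τ) with hb
  have hnorm : ∀ τ : ℝ, ‖Complex.exp ((2 * Real.pi * (y * τ) : ℝ) * Complex.I)‖ = 1 :=
    fun τ => Complex.norm_exp_ofReal_mul_I _
  have hint : Integrable fun x : Rd (m + 1) =>
      Complex.exp ((2 * Real.pi * (y * normal m x) : ℝ) * Complex.I) * 𝓕 φ x := by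
    refine (𝓕 φ).integrable.bdd_mul (c := 1) ?_ (Filter.Eventually.of_forall fun x => ?_)
    · exact Continuous.aestronglyMeasurable (by fun_prop)
    · exact (Complex.norm_exp_ofReal_mul_I _).le
  have hbint : Integrable b := by
    have h := (integrable_join_iff.mpr hint).integral_prod_right
    simpa only [normal_join] using h
  have hbcont : Continuous b := by
    obtain ⟨C, hC0, hC⟩ := exists_decay (𝓕 φ) 0 2
    refine continuous_of_dominated (bound := fun τ => C * ((1 + |τ|) ^ 2)⁻¹) (fun ξ => ?_)
      (fun ξ => Filter.Eventually.of_forall fun τ => ?_)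
      (integrable_inv_one_add_abs_sq.const_mul C) (Filter.Eventually.of_forall fun τ => ?_)
    · exact Continuous.aestronglyMeasurable (by fun_prop)
    · rw [norm_mul, hnorm, one_mul]
      simpa using hC (join ξ τ)
    · fun_prop
  -- Full inversion on ℝ^(m+1), split by Fubini, shows that the slice is the inverse transform of b.
  -- As b is continuous and integrable and its own transform is the reflected slice, the inversion
  -- theorem on ℝ^m recovers b.
  have hinv : 𝓕⁻ b = slice y φ := by
    ext x
    have h1 : slice y φ x = 𝓕⁻ (𝓕 φ) (join x y) := by
      rw [FourierTransform.fourierInv_fourier_eq, slice_apply]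
    have h3 : Integrable fun v : Rd (m + 1) =>
        Complex.exp (((2 * Real.pi * inner ℝ v (join x y) : ℝ) : ℂ) * Complex.I) • 𝓕 φ v := by
      refine (𝓕 φ).integrable.bdd_mul (c := 1) ?_ (Filter.Eventually.of_forall fun x => ?_)
      · exact Continuous.aestronglyMeasurable (by fun_prop)
      · exact (Complex.norm_exp_ofReal_mul_I _).le
    rw [h1, SchwartzMap.fourierInv_coe, Real.fourierInv_eq', Real.fourierInv_eq',
      integral_split' h3]
    congr 1
    ext ξ
    rw [hb, smul_eq_mul, ← integral_const_mul]
    congr 1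
    ext τ
    rw [inner_eq_split, tangential_join, normal_join, tangential_join, normal_join, smul_eq_mul,
      ← mul_assoc, ← Complex.exp_add]
    congr 2
    push_cast
    ring
  have hFb : 𝓕 b = fun x => slice y φ (-x) := by
    ext x
    rw [← hinv, Real.fourierInv_eq_fourier_neg, neg_neg]
  have h := hbcont.fourier_fourierInv_eq hbint
    (by rw [hFb]; exact (slice y φ).integrable.comp_neg)
  rw [SchwartzMap.fourier_coe, ← hinv, h]

/-- Fourier multipliers in the tangential variables act slicewise. -/
theorem slice_tangentialMult {q : Rd m → ℂ} (hq : q.HasTemperateGrowth) (y : ℝ)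
    (φ : 𝓢(Rd (m + 1), ℂ)) :
    slice y (SchwartzMap.fourierMultiplierCLM ℂ (fun ξ => q (tangential m ξ)) φ) =
      SchwartzMap.fourierMultiplierCLM ℂ q (slice y φ) := by
  have hq' : (fun ξ => q (tangential m ξ)).HasTemperateGrowth :=
    hq.comp (tangential m).hasTemperateGrowth
  have h : 𝓕 (slice y (SchwartzMap.fourierMultiplierCLM ℂ (fun ξ => q (tangential m ξ)) φ)) =
      SchwartzMap.smulLeftCLM ℂ q (𝓕 (slice y φ)) := by
    ext ξ
    rw [fourier_slice, SchwartzMap.smulLeftCLM_apply_apply hq, fourier_slice, smul_eq_mul,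
      ← integral_const_mul]
    congr 1
    ext τ
    rw [SchwartzMap.fourierMultiplierCLM_apply, FourierTransform.fourier_fourierInv_eq,
      SchwartzMap.smulLeftCLM_apply_apply hq', tangential_join, smul_eq_mul]
    ring
  rw [SchwartzMap.fourierMultiplierCLM_apply q, ← h, FourierTransform.fourierInv_fourier_eq]

end Slice

/-! ### Distributions vanishing on a half-space -/

section Vanishing

variable {m : ℕ}

/-- The translation `φ(· + y e_n)`. -/
def shift (y : ℝ) : 𝓢(Rd (m + 1), ℂ) →L[ℂ] 𝓢(Rd (m + 1), ℂ) :=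
  SchwartzMap.compSubConstCLM ℂ (-(y • normalVec m))

theorem shift_apply (y : ℝ) (φ : 𝓢(Rd (m + 1), ℂ)) (x : Rd (m + 1)) :
    shift y φ x = φ (x + y • normalVec m) := by
  change φ (x - -(y • normalVec m)) = _
  rw [sub_neg_eq_add]

/-- Mean value inequality along the segment from x to x + y e_n. For |s| ≤ 1 the weights 1 + |x| and
1 + |x + s e_n| agree up to a factor 2, so a seminorm with one more derivative controls the
difference. -/
theorem norm_iteratedFDeriv_shift_sub_le (φ : 𝓢(Rd (m + 1), ℂ)) (k n : ℕ) : ∃ C, 0 ≤ C ∧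
    ∀ y : ℝ, |y| ≤ 1 → ∀ x,
      ‖x‖ ^ k * ‖iteratedFDeriv ℝ n (fun z => φ (z + y • normalVec m)) x -
        iteratedFDeriv ℝ n φ x‖ ≤ C * |y| := by
  refine ⟨2 ^ k * (2 ^ k * (Finset.Iic (k, n + 1)).sup
    (fun m => SchwartzMap.seminorm ℝ m.1 m.2) φ), by positivity, fun y hy x => ?_⟩
  have hv : ‖normalVec m‖ = 1 := by simp [normalVec]
  have hsub : ∀ s : ℝ, |s| ≤ 1 → 1 + ‖x‖ ≤ 2 * (1 + ‖x + s • normalVec m‖) := fun s hs => by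
    have h1 : ‖x‖ ≤ ‖x + s • normalVec m‖ + ‖s • normalVec m‖ := by
      simpa using norm_sub_le (x + s • normalVec m) (s • normalVec m)
    rw [norm_smul, hv, mul_one, Real.norm_eq_abs] at h1
    nlinarith [norm_nonneg (x + s • normalVec m)]
  rw [iteratedFDeriv_comp_add_right]
  set D := iteratedFDeriv ℝ n φ
  set S := (Finset.Iic (k, n + 1)).sup (fun m => SchwartzMap.seminorm ℝ m.1 m.2) φ
  have hD : Differentiable ℝ D :=
    (φ.smooth ⊤).differentiable_iteratedFDeriv (m := n) (by exact_mod_cast WithTop.coe_lt_top _)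
  have hbound : ∀ s : ℝ, |s| ≤ 1 →
      ‖fderiv ℝ D (x + s • normalVec m)‖ ≤ 2 ^ k * (2 ^ k * S) / (1 + ‖x‖) ^ k := by
    intro s hs
    have h := SchwartzMap.one_add_le_sup_seminorm_apply (𝕜 := ℝ) (m := (k, n + 1)) le_rfl le_rfl φ
      (x + s • normalVec m)
    rw [norm_fderiv_iteratedFDeriv, le_div_iff₀ (by positivity)]
    calc _ ≤ ‖iteratedFDeriv ℝ (n + 1) φ (x + s • normalVec m)‖ *
          (2 * (1 + ‖x + s • normalVec m‖)) ^ k := by gcongr; exact hsub s hs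
      _ = 2 ^ k * ((1 + ‖x + s • normalVec m‖) ^ k *
          ‖iteratedFDeriv ℝ (n + 1) φ (x + s • normalVec m)‖) := by rw [mul_pow]; ring
      _ ≤ _ := by gcongr
  have hmv : ‖D (x + y • normalVec m) - D (x + (0 : ℝ) • normalVec m)‖ ≤
      2 ^ k * (2 ^ k * S) / (1 + ‖x‖) ^ k * ‖y - 0‖ := by
    refine Convex.norm_image_sub_le_of_norm_hasFDerivWithin_le (𝕜 := ℝ)
      (f := fun s : ℝ => D (x + s • normalVec m)) (s := Set.Icc (-1) 1)
      (f' := fun s => (fderiv ℝ D (x + s • normalVec m)).comp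
        ((ContinuousLinearMap.id ℝ ℝ).smulRight (normalVec m)))
      (fun s _ => ?_) (fun s hs => ?_) (convex_Icc _ _) (by simp) (abs_le.mp hy)
    · refine HasFDerivAt.hasFDerivWithinAt ?_
      refine (hD _).hasFDerivAt.comp s ?_
      exact (((ContinuousLinearMap.id ℝ ℝ).smulRight (normalVec m)).hasFDerivAt).const_add x
    · refine (ContinuousLinearMap.opNorm_comp_le _ _).trans ?_
      rw [ContinuousLinearMap.norm_smulRight_apply, hv, mul_one]
      exact (mul_le_of_le_one_right (norm_nonneg _) ContinuousLinearMap.norm_id_le).trans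
        (hbound s (abs_le.mpr hs))
  simp only [zero_smul, add_zero, sub_zero, Real.norm_eq_abs] at hmv
  calc _ ≤ (1 + ‖x‖) ^ k * (2 ^ k * (2 ^ k * S) / (1 + ‖x‖) ^ k * |y|) := by
        gcongr; linarith
    _ = _ := by field_simp

theorem tendsto_shift (φ : 𝓢(Rd (m + 1), ℂ)) :
    Filter.Tendsto (fun y : ℝ => shift y φ) (nhds 0) (nhds φ) := by
  rw [(schwartz_withSeminorms ℂ (Rd (m + 1)) ℂ).tendsto_nhds]
  rintro ⟨k, n⟩ ε hε
  obtain ⟨C, hC0, hC⟩ := norm_iteratedFDeriv_shift_sub_le φ k n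
  have hev : ∀ᶠ y : ℝ in nhds 0, |y| < min 1 (ε / (C + 1)) := by
    have : Filter.Tendsto (fun y : ℝ => |y|) (nhds 0) (nhds 0) := by
      simpa using (continuous_abs.tendsto (0 : ℝ))
    exact this.eventually_lt_const (by positivity)
  filter_upwards [hev] with y hy
  refine lt_of_le_of_lt (SchwartzMap.seminorm_le_bound ℂ k n _ (M := C * |y|) (by positivity)
    fun x => ?_) ?_
  · have e : ((shift y φ - φ : 𝓢(Rd (m + 1), ℂ)) : Rd (m + 1) → ℂ) =
        (fun z => φ (z + y • normalVec m)) - φ := by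
      ext z; simp [shift_apply]
    rw [e, iteratedFDeriv_sub_apply]
    · exact hC y (hy.le.trans (min_le_left _ _)) x
    · exact (((φ.smooth n).comp (by fun_prop : ContDiff ℝ n fun z : Rd (m + 1) =>
        z + y • normalVec m))).contDiffAt
    · exact (φ.smooth n).contDiffAt
  · have h2 : |y| < ε / (C + 1) := hy.trans_le (min_le_right _ _)
    rw [lt_div_iff₀ (by positivity)] at h2
    nlinarith [abs_nonneg y]

theorem isOpen_upper : IsOpen (upper m) := isOpen_lt continuous_const (normal m).continuous

theorem isOpen_lower : IsOpen (lower m) := isOpen_lt (normal m).continuous continuous_const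

theorem normal_add_smul (x : Rd (m + 1)) (y : ℝ) :
    normal m (x + y • normalVec m) = normal m x + y := by
  rw [map_add, map_smul]
  simp [normal, normalVec]

/-- A distribution vanishing on the open upper half-space kills every test function that vanishes
on the open lower one. -/
theorem isVanishingOn_upper_iff {u : 𝓢'(Rd (m + 1), ℂ)} :
    IsVanishingOn u (upper m) ↔
      ∀ φ : 𝓢(Rd (m + 1), ℂ), (∀ x, normal m x < 0 → φ x = 0) → u φ = 0 := by
  refine ⟨fun h φ hφ => ?_, fun h φ hφ => h φ fun x hx => ?_⟩
  -- For y < 0 the translate φ(· + y e_n) is supported in x_n ≥ -y, hence inside the open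
  -- half-space, and is killed by u; then y tends to 0 from below.
  · have h1 : Filter.Tendsto (fun y : ℝ => u (shift y φ)) (nhdsWithin 0 (Set.Iio 0))
        (nhds (u φ)) :=
      ((u.continuous.tendsto φ).comp (tendsto_shift φ)).mono_left nhdsWithin_le_nhds
    refine tendsto_nhds_unique h1 (tendsto_const_nhds.congr' ?_)
    filter_upwards [self_mem_nhdsWithin] with y hy
    refine (h _ ?_).symm
    have hc : IsClosed {x : Rd (m + 1) | -y ≤ normal m x} :=
      isClosed_le continuous_const (normal m).continuous
    refine (closure_minimal (fun x hx => ?_) hc).trans fun x hx => ?_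
    · by_contra hlt
      refine hx ?_
      rw [shift_apply]
      refine hφ _ ?_
      rw [normal_add_smul]
      simp only [Set.mem_ofPred_eq, not_le] at hlt
      linarith
    · have hx' : -y ≤ normal m x := hx
      have hy' : y < 0 := hy
      change 0 < normal m x
      linarith
  · by_contra hne
    have := hφ (subset_tsupport _ hne)
    exact absurd (this : 0 < normal m x) (not_lt.mpr hx.le)

theorem isVanishingOn_lower_iff {u : 𝓢'(Rd (m + 1), ℂ)} :
    IsVanishingOn u (lower m) ↔
      ∀ φ : 𝓢(Rd (m + 1), ℂ), (∀ x, 0 < normal m x → φ x = 0) → u φ = 0 := by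
  refine ⟨fun h φ hφ => ?_, fun h φ hφ => h φ fun x hx => ?_⟩
  · have h1 : Filter.Tendsto (fun y : ℝ => u (shift y φ)) (nhdsWithin 0 (Set.Ioi 0))
        (nhds (u φ)) :=
      ((u.continuous.tendsto φ).comp (tendsto_shift φ)).mono_left nhdsWithin_le_nhds
    refine tendsto_nhds_unique h1 (tendsto_const_nhds.congr' ?_)
    filter_upwards [self_mem_nhdsWithin] with y hy
    refine (h _ ?_).symm
    have hc : IsClosed {x : Rd (m + 1) | normal m x ≤ -y} :=
      isClosed_le (normal m).continuous continuous_const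
    refine (closure_minimal (fun x hx => ?_) hc).trans fun x hx => ?_
    · by_contra hlt
      refine hx ?_
      rw [shift_apply]
      refine hφ _ ?_
      rw [normal_add_smul]
      simp only [Set.mem_ofPred_eq, not_le] at hlt
      linarith
    · have hx' : normal m x ≤ -y := hx
      have hy' : 0 < y := hy
      change normal m x < 0
      linarith
  · by_contra hne
    have := hφ (subset_tsupport _ hne)
    exact absurd (this : normal m x < 0) (not_lt.mpr hx.le)

end Vanishing

/-! ### A Schwartz function equal to `e^{-y}` on the positive half-line -/

theorem contDiff_expCutoff :
    ContDiff ℝ (⊤ : ℕ∞) fun y : ℝ => Real.exp (-y) * Real.smoothTransition (y + 1) := by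
  have h : ContDiff ℝ (⊤ : ℕ∞) fun y : ℝ => Real.smoothTransition (y + 1) :=
    Real.smoothTransition.contDiff.comp (by fun_prop)
  exact (by fun_prop : ContDiff ℝ (⊤ : ℕ∞) fun y : ℝ => Real.exp (-y)).mul h

/-- A Schwartz function equal to `e^{-y}` for `y ≥ 0`. -/
def expCutoffReal : 𝓢(ℝ, ℝ) where
  toFun y := Real.exp (-y) * Real.smoothTransition (y + 1)
  smooth' := contDiff_expCutoff
  decay' k n := by
    set f : ℝ → ℝ := fun y => Real.exp (-y) * Real.smoothTransition (y + 1) with hf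
    have hcont : Continuous fun y : ℝ => ‖y‖ ^ k * ‖iteratedFDeriv ℝ n f y‖ := by
      have := contDiff_expCutoff.continuous_iteratedFDeriv (m := n) (by exact_mod_cast le_top)
      fun_prop
    obtain ⟨C, hC⟩ := (isCompact_Icc (a := (-2 : ℝ)) (b := 1)).exists_bound_of_continuousOn
      hcont.continuousOn
    -- The function vanishes for y < -1, is bounded by C on the compact part, and equals e^{-y} for
    -- y > 1, where y^k e^{-y} ≤ k!.
    refine ⟨max C (k.factorial : ℝ), fun y => ?_⟩
    rcases lt_or_ge y (-2) with hy | hy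
    · have h0 : f =ᶠ[nhds y] fun _ => 0 := by
        filter_upwards [Iio_mem_nhds (show y < -1 by linarith)] with z hz
        have hz' : z < -1 := hz
        simp only [hf]
        rw [Real.smoothTransition.zero_of_nonpos (by linarith), mul_zero]
      rw [(h0.iteratedFDeriv ℝ n).eq_of_nhds]
      have h1 : iteratedFDeriv ℝ n (fun _ : ℝ => (0 : ℝ)) y = 0 := by
        simp
      rw [h1]
      simp
    rcases le_or_gt y 1 with hy' | hy'
    · refine le_trans ?_ (le_max_left _ _)
      exact (le_abs_self _).trans (hC y ⟨hy, hy'⟩)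
    · have h0 : f =ᶠ[nhds y] fun z => Real.exp (-z) := by
        filter_upwards [Ioi_mem_nhds (show 0 < y by linarith)] with z hz
        have hz' : 0 < z := hz
        simp only [hf]
        rw [Real.smoothTransition.one_of_one_le (by linarith), mul_one]
      rw [(h0.iteratedFDeriv ℝ n).eq_of_nhds, norm_iteratedFDeriv_eq_norm_iteratedDeriv]
      have h1 : iteratedDeriv n (fun z : ℝ => Real.exp (-z)) y = (-1) ^ n * Real.exp (-y) := by
        have := iteratedDeriv_comp_neg n Real.exp y
        simpa [iteratedDeriv_eq_iterate] using this
      rw [h1]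
      refine le_trans ?_ (le_max_right _ _)
      have hy0 : 0 ≤ y := by linarith
      have h2 := Real.pow_div_factorial_le_exp y hy0 k
      rw [div_le_iff₀ (by positivity)] at h2
      simp only [norm_mul, norm_pow, norm_neg, norm_one, one_pow, one_mul, Real.norm_eq_abs,
        abs_of_nonneg hy0, Real.abs_exp]
      rw [Real.exp_neg, ← div_eq_mul_inv, div_le_iff₀ (Real.exp_pos _)]
      linarith

theorem expCutoffReal_apply {y : ℝ} (hy : 0 ≤ y) : expCutoffReal y = Real.exp (-y) := by
  change Real.exp (-y) * Real.smoothTransition (y + 1) = _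
  rw [Real.smoothTransition.one_of_one_le (by linarith), mul_one]

/-- A Schwartz function equal to `e^{-y}` for `y ≥ 0`. -/
def expCutoff : 𝓢(ℝ, ℂ) := SchwartzMap.postcompCLM (𝕜 := ℝ) Complex.ofRealCLM expCutoffReal

theorem expCutoff_apply {y : ℝ} (hy : 0 ≤ y) : expCutoff y = Real.exp (-y) := by
  rw [expCutoff, SchwartzMap.postcompCLM_apply, expCutoffReal_apply hy]
  rfl

/-! ### Symbols -/

section Symbols

variable {m : ℕ}

/-- `⟨ξ'⟩`, in the variable of Mathlib's Fourier transform. -/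
def kappa (m : ℕ) (ξ : Rd m) : ℝ := (1 + ‖(2 * Real.pi) • ξ‖ ^ 2) ^ (1 / 2 : ℝ)

theorem one_le_kappa (ξ : Rd m) : 1 ≤ kappa m ξ :=
  Real.one_le_rpow (le_add_of_nonneg_right (by positivity)) (by norm_num)

theorem kappa_pos (ξ : Rd m) : 0 < kappa m ξ := one_pos.trans_le (one_le_kappa ξ)

theorem kappa_neg (ξ : Rd m) : kappa m (-ξ) = kappa m ξ := by simp [kappa]

theorem kappa_sq (ξ : Rd m) : kappa m ξ ^ 2 = 1 + ‖(2 * Real.pi) • ξ‖ ^ 2 := by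
  rw [kappa, ← Real.rpow_natCast, ← Real.rpow_mul (by positivity)]
  norm_num

@[fun_prop]
theorem hasTemperateGrowth_kappa : (kappa m).HasTemperateGrowth :=
  (Function.hasTemperateGrowth_one_add_norm_sq_rpow (Rd m) (1 / 2)).comp
    ((2 * Real.pi) • ContinuousLinearMap.id ℝ (Rd m)).hasTemperateGrowth

/-- `⟨ξ'⟩ + iεξ_n`. -/
def sgnBase (m : ℕ) (ε : ℝ) (ξ : Rd (m + 1)) : ℂ :=
  (kappa m (tangential m ξ) : ℂ) + Complex.I * ((ε * (2 * Real.pi * normal m ξ) : ℝ) : ℂ)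

/-- The symbol `(⟨ξ'⟩ + iεξ_n)^t`. -/
def sgnSymbol (m : ℕ) (ε t : ℝ) (ξ : Rd (m + 1)) : ℂ := sgnBase m ε ξ ^ (t : ℂ)

theorem sgnBase_one : sgnBase m 1 = xiBase m := by
  ext ξ
  simp [sgnBase, xiBase, kappa]

theorem sgnSymbol_one (t : ℝ) : sgnSymbol m 1 t = xiSymbol m t := by
  ext ξ
  rw [sgnSymbol, xiSymbol, sgnBase_one]

theorem sgnBase_neg (ε : ℝ) (ξ : Rd (m + 1)) : sgnBase m ε (-ξ) = sgnBase m (-ε) ξ := by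
  simp [sgnBase, kappa_neg]

theorem sgnSymbol_neg (ε t : ℝ) (ξ : Rd (m + 1)) : sgnSymbol m ε t (-ξ) = sgnSymbol m (-ε) t ξ := by
  rw [sgnSymbol, sgnBase_neg, sgnSymbol]

theorem re_sgnBase (ε : ℝ) (ξ : Rd (m + 1)) :
    (sgnBase m ε ξ).re = kappa m (tangential m ξ) := by
  simp [sgnBase]

theorem im_sgnBase (ε : ℝ) (ξ : Rd (m + 1)) :
    (sgnBase m ε ξ).im = ε * (2 * Real.pi * normal m ξ) := by
  simp [sgnBase]

theorem one_le_re_sgnBase (ε : ℝ) (ξ : Rd (m + 1)) : 1 ≤ (sgnBase m ε ξ).re := by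
  rw [re_sgnBase]
  exact one_le_kappa _

theorem sgnBase_ne_zero (ε : ℝ) (ξ : Rd (m + 1)) : sgnBase m ε ξ ≠ 0 := fun h => by
  have := one_le_re_sgnBase (m := m) ε ξ
  rw [h] at this
  norm_num at this

theorem hasTemperateGrowth_kappa_tangential :
    (fun ξ : Rd (m + 1) => (kappa m (tangential m ξ) : ℂ)).HasTemperateGrowth :=
  Function.Complex.hasTemperateGrowth_ofReal.comp
    (hasTemperateGrowth_kappa.comp (tangential m).hasTemperateGrowth)

theorem hasTemperateGrowth_sgnBase (ε : ℝ) : (sgnBase m ε).HasTemperateGrowth := by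
  have h2 : (fun ξ : Rd (m + 1) => ε * (2 * Real.pi * normal m ξ)).HasTemperateGrowth :=
    (ε • (2 * Real.pi) • normal m).hasTemperateGrowth
  exact hasTemperateGrowth_kappa_tangential.add ((Function.HasTemperateGrowth.const Complex.I).mul
    (Function.Complex.hasTemperateGrowth_ofReal.comp h2))

@[fun_prop]
theorem hasTemperateGrowth_sgnSymbol (ε t : ℝ) : (sgnSymbol m ε t).HasTemperateGrowth :=
  hasTemperateGrowth_cpow (hasTemperateGrowth_sgnBase ε) (one_le_re_sgnBase ε) t

theorem sgnSymbol_add (ε s t : ℝ) (ξ : Rd (m + 1)) :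
    sgnSymbol m ε (s + t) ξ = sgnSymbol m ε s ξ * sgnSymbol m ε t ξ := by
  rw [sgnSymbol, sgnSymbol, sgnSymbol, Complex.ofReal_add,
    Complex.cpow_add _ _ (sgnBase_ne_zero ε ξ)]

theorem sgnSymbol_zero (ε : ℝ) (ξ : Rd (m + 1)) : sgnSymbol m ε 0 ξ = 1 := by
  simp [sgnSymbol]

theorem sgnSymbol_one_right (ε : ℝ) (ξ : Rd (m + 1)) : sgnSymbol m ε 1 ξ = sgnBase m ε ξ := by
  simp [sgnSymbol]

/-- `Op((⟨ξ'⟩ + iεξ_n)^t)` on Schwartz functions. -/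
abbrev sgnOp (m : ℕ) (ε t : ℝ) : 𝓢(Rd (m + 1), ℂ) →L[ℂ] 𝓢(Rd (m + 1), ℂ) :=
  SchwartzMap.fourierMultiplierCLM ℂ (sgnSymbol m ε t)

/-- `Op((⟨ξ'⟩ + iεξ_n)^t)` on tempered distributions. -/
abbrev sgnDOp (m : ℕ) (ε t : ℝ) : 𝓢'(Rd (m + 1), ℂ) →L[ℂ] 𝓢'(Rd (m + 1), ℂ) :=
  fourierMultiplierCLM ℂ (sgnSymbol m ε t)

theorem Xi_eq_sgnDOp (t : ℝ) : Xi m t = sgnDOp m 1 t := by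
  rw [Xi, sgnDOp, sgnSymbol_one]

theorem sgnOp_sgnOp (ε s t : ℝ) (φ : 𝓢(Rd (m + 1), ℂ)) :
    sgnOp m ε s (sgnOp m ε t φ) = sgnOp m ε (s + t) φ := by
  rw [sgnOp, sgnOp, SchwartzMap.fourierMultiplierCLM_fourierMultiplierCLM_apply
    (hasTemperateGrowth_sgnSymbol ε s) (hasTemperateGrowth_sgnSymbol ε t)]
  congr 2
  ext ξ
  exact (sgnSymbol_add ε s t ξ).symm

theorem sgnDOp_sgnDOp (ε s t : ℝ) (u : 𝓢'(Rd (m + 1), ℂ)) :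
    sgnDOp m ε s (sgnDOp m ε t u) = sgnDOp m ε (s + t) u := by
  rw [sgnDOp, sgnDOp, fourierMultiplierCLM_fourierMultiplierCLM_apply
    (hasTemperateGrowth_sgnSymbol ε t) (hasTemperateGrowth_sgnSymbol ε s)]
  congr 2
  ext ξ
  rw [Pi.mul_apply, mul_comm]
  exact (sgnSymbol_add ε s t ξ).symm

theorem sgnDOp_zero (ε : ℝ) (u : 𝓢'(Rd (m + 1), ℂ)) : sgnDOp m ε 0 u = u := by
  have : sgnSymbol m ε 0 = fun _ => 1 := funext (sgnSymbol_zero ε)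
  rw [sgnDOp, this]
  simp

/-- Transposition reflects the symbol, which is even in ξ' and changes the sign of iξ_n: the
transposes of powers of Ξ₊ are powers of Ξ₋. -/
theorem sgnDOp_apply (ε t : ℝ) (u : 𝓢'(Rd (m + 1), ℂ)) (φ : 𝓢(Rd (m + 1), ℂ)) :
    sgnDOp m ε t u φ = u (sgnOp m (-ε) t φ) := by
  rw [sgnDOp, fourierMultiplier_apply (hasTemperateGrowth_sgnSymbol ε t)]
  simp only [sgnSymbol_neg]

end Symbols

/-! ### The operators `e^{-r⟨D'⟩}` and the kernel of negative powers -/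

section Semigroup

variable {m : ℕ}

/-- The symbol `e^{-r⟨ξ'⟩}`, modified for `r < 0`. -/
def poissonSymbol (m : ℕ) (r : ℝ) (ξ : Rd m) : ℂ := expCutoff (r * kappa m ξ)

theorem poissonSymbol_apply {r : ℝ} (hr : 0 ≤ r) (ξ : Rd m) :
    poissonSymbol m r ξ = Complex.exp (-(r * kappa m ξ : ℝ)) := by
  rw [poissonSymbol, expCutoff_apply (mul_nonneg hr (kappa_pos ξ).le)]
  push_cast
  rfl

theorem hasTemperateGrowth_poissonSymbol (r : ℝ) : (poissonSymbol m r).HasTemperateGrowth := by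
  have h : (fun ξ : Rd m => r * kappa m ξ).HasTemperateGrowth :=
    (Function.HasTemperateGrowth.const r).mul hasTemperateGrowth_kappa
  exact expCutoff.hasTemperateGrowth.comp h

/-- `e^{-r⟨D'⟩}` on `ℝ^m`. -/
def poisson (m : ℕ) (r : ℝ) : 𝓢(Rd m, ℂ) →L[ℂ] 𝓢(Rd m, ℂ) :=
  SchwartzMap.fourierMultiplierCLM ℂ (poissonSymbol m r)

/-- `e^{-r⟨D'⟩}` on `ℝ^(m+1)`. -/
def tPoisson (m : ℕ) (r : ℝ) : 𝓢(Rd (m + 1), ℂ) →L[ℂ] 𝓢(Rd (m + 1), ℂ) :=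
  SchwartzMap.fourierMultiplierCLM ℂ fun ξ => poissonSymbol m r (tangential m ξ)

theorem slice_tPoisson (r y : ℝ) (φ : 𝓢(Rd (m + 1), ℂ)) :
    slice y (tPoisson m r φ) = poisson m r (slice y φ) :=
  slice_tangentialMult (hasTemperateGrowth_poissonSymbol r) y φ

theorem schwartzMultiplier_apply {E : Type} [NormedAddCommGroup E] [InnerProductSpace ℝ E]
    [FiniteDimensional ℝ E] [MeasurableSpace E] [BorelSpace E] {p : E → ℂ}
    (hp : p.HasTemperateGrowth) (φ : 𝓢(E, ℂ)) (x : E) :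
    SchwartzMap.fourierMultiplierCLM ℂ p φ x =
      ∫ ξ, Complex.exp ((2 * Real.pi * inner ℝ ξ x : ℝ) * Complex.I) * (p ξ * 𝓕 φ ξ) := by
  rw [SchwartzMap.fourierMultiplierCLM_apply, SchwartzMap.fourierInv_coe, Real.fourierInv_eq']
  simp only [SchwartzMap.smulLeftCLM_apply_apply hp, smul_eq_mul]

theorem tPoisson_symbol (r : ℝ) :
    (fun ξ : Rd (m + 1) => poissonSymbol m r (tangential m ξ)).HasTemperateGrowth :=
  (hasTemperateGrowth_poissonSymbol r).comp (tangential m).hasTemperateGrowth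

/-- The factor e^{-r} comes from ⟨ξ'⟩ ≥ 1. It makes all later superpositions over r converge at
infinity. -/
theorem norm_tPoisson_le {r : ℝ} (hr : 0 ≤ r) (φ : 𝓢(Rd (m + 1), ℂ)) (x : Rd (m + 1)) :
    ‖tPoisson m r φ x‖ ≤ Real.exp (-r) * ∫ ξ, ‖𝓕 φ ξ‖ := by
  rw [tPoisson, schwartzMultiplier_apply (tPoisson_symbol r), ← integral_const_mul]
  refine norm_integral_le_of_norm_le ((𝓕 φ).integrable.norm.const_mul _)
    (Filter.Eventually.of_forall fun ξ => ?_)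
  rw [norm_mul, Complex.norm_exp_ofReal_mul_I, one_mul, norm_mul, poissonSymbol_apply hr,
    Complex.norm_exp]
  gcongr
  simp only [Complex.neg_re, Complex.ofReal_re]
  nlinarith [one_le_kappa (tangential m ξ)]

theorem integrableOn_rpow_mul_exp {c : ℝ} (hc : 0 < c) :
    IntegrableOn (fun r : ℝ => r ^ (c - 1) * Real.exp (-r)) (Set.Ioi 0) := by
  have := Real.GammaIntegral_convergent hc
  refine this.congr_fun (fun x _ => mul_comm _ _) measurableSet_Ioi

theorem integrableOn_rpow_mul_exp' {c b : ℝ} (hc : 0 < c) (hb : 0 < b) :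
    IntegrableOn (fun r : ℝ => r ^ (c - 1) * Real.exp (-(b * r))) (Set.Ioi 0) := by
  have := integrableOn_rpow_mul_exp_neg_mul_rpow (s := c - 1) (p := 1) (by linarith) one_pos hb
  refine this.congr_fun (fun x _ => ?_) measurableSet_Ioi
  simp

/-- The Laplace transform of `r^{c-1}`. -/
theorem integral_rpow_mul_cexp_neg_mul {c : ℝ} (hc : 0 < c) {z : ℂ} (hz : 0 < z.re) :
    ∫ r in Set.Ioi (0 : ℝ), ((r ^ (c - 1) : ℝ) : ℂ) * Complex.exp (-(z * r)) =
      z ^ ((-c : ℝ) : ℂ) * (Real.Gamma c : ℂ) := by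
  have hnorm : ∀ (w : ℂ) {r : ℝ}, 0 < r → ‖((r ^ (c - 1) : ℝ) : ℂ) * Complex.exp (-(w * r))‖ =
      r ^ (c - 1) * Real.exp (-(w.re * r)) := fun w r hr => by
    rw [norm_mul, Complex.norm_real, Real.norm_of_nonneg (by positivity), Complex.norm_exp]
    simp
  have hmeas : ∀ w : ℂ, AEStronglyMeasurable
      (fun r : ℝ => ((r ^ (c - 1) : ℝ) : ℂ) * Complex.exp (-(w * r)))
      (volume.restrict (Set.Ioi 0)) := fun w =>
    Measurable.aestronglyMeasurable (by fun_prop)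
  have hopen : IsOpen {w : ℂ | 0 < w.re} := isOpen_lt continuous_const Complex.continuous_re
  have hdiff : DifferentiableOn ℂ (fun w : ℂ => ∫ r in Set.Ioi (0 : ℝ),
      ((r ^ (c - 1) : ℝ) : ℂ) * Complex.exp (-(w * r))) {w : ℂ | 0 < w.re} := by
    intro w hw
    have hw' : 0 < w.re := hw
    refine DifferentiableAt.differentiableWithinAt ?_
    have h := hasDerivAt_integral_of_dominated_loc_of_deriv_le (μ := volume.restrict (Set.Ioi 0))
      (F := fun (w : ℂ) (r : ℝ) => ((r ^ (c - 1) : ℝ) : ℂ) * Complex.exp (-(w * r)))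
      (F' := fun (w : ℂ) (r : ℝ) => ((r ^ (c - 1) : ℝ) : ℂ) * (Complex.exp (-(w * r)) * -r))
      (x₀ := w) (s := {v : ℂ | w.re / 2 < v.re})
      (bound := fun r => r ^ (c + 1 - 1) * Real.exp (-(w.re / 2 * r)))
      ((isOpen_lt continuous_const Complex.continuous_re).mem_nhds (by
        change w.re / 2 < w.re; linarith))
      (Eventually.of_forall hmeas) ?_ ?_ ?_ (integrableOn_rpow_mul_exp' (by linarith)
        (by linarith)) ?_
    · exact h.2.differentiableAt
    · refine (integrableOn_rpow_mul_exp' hc hw').mono' (hmeas w) ?_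
      filter_upwards [ae_restrict_mem measurableSet_Ioi] with r hr
      exact (hnorm w hr).le
    · exact Measurable.aestronglyMeasurable (by fun_prop)
    · filter_upwards [ae_restrict_mem measurableSet_Ioi] with r hr v hv
      have hr' : 0 < r := hr
      have hv' : w.re / 2 < v.re := hv
      rw [← mul_assoc, norm_mul, hnorm v hr', norm_neg, Complex.norm_real,
        Real.norm_of_nonneg hr'.le]
      have : r ^ (c + 1 - 1) = r ^ (c - 1) * r := by
        rw [← Real.rpow_add_one hr'.ne']; ring_nf
      rw [this, mul_right_comm]
      gcongr
    · filter_upwards with r v hv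
      have h1 : HasDerivAt (fun v : ℂ => -(v * r)) (-(r : ℂ)) v := by
        have h := ((hasDerivAt_id' v).mul_const (r : ℂ)).fun_neg
        rwa [one_mul] at h
      exact (h1.cexp).const_mul _
  have hdiff2 : DifferentiableOn ℂ (fun w : ℂ => w ^ ((-c : ℝ) : ℂ) * (Real.Gamma c : ℂ))
      {w : ℂ | 0 < w.re} := fun w hw =>
    ((differentiableAt_id.cpow_const (Or.inl hw)).mul_const _).differentiableWithinAt
  -- Both sides are holomorphic on the right half-plane, so it is enough to compare them at positive
  -- reals accumulating at 1, where the integral is Euler's.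
  refine AnalyticOnNhd.eqOn_of_preconnected_of_frequently_eq (hdiff.analyticOnNhd hopen)
    (hdiff2.analyticOnNhd hopen) (convex_halfSpace_re_gt 0).isPreconnected
    (z₀ := 1) (by simp) ?_ hz
  have hreal : ∀ b : ℝ, 0 < b → ∫ r in Set.Ioi (0 : ℝ),
      ((r ^ (c - 1) : ℝ) : ℂ) * Complex.exp (-((b : ℂ) * r)) =
      (b : ℂ) ^ ((-c : ℝ) : ℂ) * (Real.Gamma c : ℂ) := by
    intro b hb
    have h := Complex.integral_cpow_mul_exp_neg_mul_Ioi (a := (c : ℂ)) (by simpa using hc) hb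
    rw [Complex.Gamma_ofReal, one_div, Complex.inv_cpow, ← Complex.cpow_neg] at h
    · rw [Complex.ofReal_neg, ← h]
      refine setIntegral_congr_fun measurableSet_Ioi fun r hr => ?_
      rw [Complex.ofReal_cpow (le_of_lt hr)]
      push_cast
      rfl
    · rw [Complex.arg_ofReal_of_nonneg hb.le]
      exact Real.pi_pos.ne
  have htend : Tendsto (fun n : ℕ => (((1 + 1 / ((n : ℝ) + 1) : ℝ)) : ℂ)) atTop
      (nhdsWithin 1 {1}ᶜ) := by
    refine tendsto_nhdsWithin_iff.mpr ⟨?_, Eventually.of_forall fun n => ?_⟩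
    · have := (tendsto_one_div_add_atTop_nhds_zero_nat (𝕜 := ℝ)).const_add 1
      rw [add_zero] at this
      have h := (Complex.continuous_ofReal.tendsto _).comp this
      rwa [Complex.ofReal_one] at h
    · have h : (1 + 1 / ((n : ℝ) + 1) : ℝ) ≠ 1 := by
        have : (0 : ℝ) < 1 / ((n : ℝ) + 1) := by positivity
        linarith
      exact fun h' => h (by exact_mod_cast Set.mem_singleton_iff.mp h')
  exact htend.frequently (Frequently.of_forall fun n => hreal _ (by positivity))

/-- Negative powers of `⟨D'⟩ + ε∂_n` as superpositions of translated `e^{-r⟨D'⟩}`. -/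
theorem sgnOp_neg_apply (ε : ℝ) {c : ℝ} (hc : 0 < c) (χ : 𝓢(Rd (m + 1), ℂ)) (x : Rd (m + 1)) :
    sgnOp m ε (-c) χ x = (Real.Gamma c : ℂ)⁻¹ * ∫ r in Set.Ioi (0 : ℝ),
      ((r ^ (c - 1) : ℝ) : ℂ) * tPoisson m r χ (x - (ε * r) • normalVec m) := by
  have hΓ : (Real.Gamma c : ℂ) ≠ 0 := by exact_mod_cast (Real.Gamma_pos_of_pos hc).ne'
  rw [eq_inv_mul_iff_mul_eq₀ hΓ, schwartzMultiplier_apply (hasTemperateGrowth_sgnSymbol ε (-c)),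
    ← integral_const_mul]
  set e : Rd (m + 1) → ℂ := fun ξ => Complex.exp ((2 * Real.pi * inner ℝ ξ x : ℝ) * Complex.I)
    with he
  have h1 : ∀ ξ, (Real.Gamma c : ℂ) * (e ξ * (sgnSymbol m ε (-c) ξ * 𝓕 χ ξ)) =
      ∫ r in Set.Ioi (0 : ℝ), ((r ^ (c - 1) : ℝ) : ℂ) *
        Complex.exp (-(sgnBase m ε ξ * r)) * (e ξ * 𝓕 χ ξ) := by
    intro ξ
    rw [integral_mul_const, integral_rpow_mul_cexp_neg_mul hc
      (one_pos.trans_le (one_le_re_sgnBase ε ξ)), sgnSymbol]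
    ring
  rw [integral_congr_ae (Eventually.of_forall h1), integral_integral_swap]
  · refine setIntegral_congr_fun measurableSet_Ioi fun r hr => ?_
    have hr' : 0 < r := hr
    rw [tPoisson, schwartzMultiplier_apply (tPoisson_symbol r), ← integral_const_mul]
    congr 1
    ext ξ
    rw [poissonSymbol_apply hr'.le]
    -- The exponential of -r(⟨ξ'⟩ + iεξ_n) splits into the symbol of e^{-r⟨D'⟩} and a character that
    -- moves x to x - εr e_n.
    have h5 : Complex.exp (-(sgnBase m ε ξ * r)) * e ξ =
        Complex.exp ((2 * Real.pi * inner ℝ ξ (x - (ε * r) • normalVec m) : ℝ) * Complex.I) *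
          Complex.exp (-(r * kappa m (tangential m ξ) : ℝ)) := by
      have h6 : inner ℝ ξ (normalVec m) = normal m ξ := by
        simp [normalVec, normal, EuclideanSpace.inner_single_right]
      rw [he, ← Complex.exp_add, ← Complex.exp_add, inner_sub_right, inner_smul_right, h6, sgnBase]
      congr 1
      push_cast
      ring
    linear_combination ((r ^ (c - 1) : ℝ) : ℂ) * 𝓕 χ ξ * h5
  · have hbound := ((𝓕 χ).integrable (μ := (volume : Measure (Rd (m + 1))))).norm.mul_prod
      (integrableOn_rpow_mul_exp hc)
    refine hbound.mono' ?_ ?_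
    · have hb : Continuous (sgnBase m ε) := (hasTemperateGrowth_sgnBase ε).1.continuous
      have he' : Continuous e := by fun_prop
      refine Measurable.aestronglyMeasurable ?_
      have := (𝓕 χ).continuous
      refine (Measurable.mul ?_ ?_).mul ?_
      · fun_prop
      · fun_prop
      · fun_prop
    · have hmeas : MeasurableSet (Set.univ ×ˢ Set.Ioi (0 : ℝ) : Set (Rd (m + 1) × ℝ)) :=
        MeasurableSet.univ.prod measurableSet_Ioi
      rw [← Measure.restrict_univ (μ := (volume : Measure (Rd (m + 1)))), Measure.prod_restrict]
      filter_upwards [ae_restrict_mem hmeas] with p hp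
      have hr : 0 < p.2 := hp.2
      simp only [Function.uncurry]
      rw [norm_mul, norm_mul, norm_mul, he, Complex.norm_exp_ofReal_mul_I, one_mul,
        Complex.norm_real, Real.norm_of_nonneg (by positivity), Complex.norm_exp, mul_comm]
      gcongr
      simp only [Complex.neg_re, Complex.mul_re, Complex.ofReal_re, Complex.ofReal_im, mul_zero,
        sub_zero]
      nlinarith [one_le_re_sgnBase ε p.1]

end Semigroup

/-! ### Operators preserving supports in a half-space -/

section Support

variable {m : ℕ}

/-- `A` maps functions vanishing where `0 < σ x_n` to such functions. -/
def PreservesZero (m : ℕ) (σ : ℝ) (A : 𝓢(Rd (m + 1), ℂ) → 𝓢(Rd (m + 1), ℂ)) : Prop :=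
  ∀ φ : 𝓢(Rd (m + 1), ℂ), (∀ x, 0 < σ * normal m x → φ x = 0) →
    ∀ x, 0 < σ * normal m x → A φ x = 0

/-- A tangential multiplier acts on each slice x_n = const by itself, so a slice that is zero stays
zero. -/
theorem preservesZero_tangential {q : Rd m → ℂ} (hq : q.HasTemperateGrowth) (σ : ℝ) :
    PreservesZero m σ (SchwartzMap.fourierMultiplierCLM ℂ fun ξ => q (tangential m ξ)) := by
  intro φ hφ x hx
  have h1 : slice (normal m x) φ = 0 := by
    ext z
    rw [slice_apply]
    exact hφ _ (by simpa using hx)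
  have h2 := congrArg (fun f => f (tangential m x)) (slice_tangentialMult hq (normal m x) φ)
  simp only [slice_apply, join_tangential_normal] at h2
  rw [h2, h1, map_zero]
  rfl

/-- The value at x involves only slices at height x_n - εr with r > 0, and σε ≤ 0 keeps these inside
the region 0 < σx_n. -/
theorem preservesZero_sgnOp_neg {σ ε c : ℝ} (hσ : σ * ε ≤ 0) (hc : 0 < c) :
    PreservesZero m σ (sgnOp m ε (-c)) := by
  intro φ hφ x hx
  rw [sgnOp_neg_apply ε hc]
  have h : ∀ r ∈ Set.Ioi (0 : ℝ), ((r ^ (c - 1) : ℝ) : ℂ) *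
      tPoisson m r φ (x - (ε * r) • normalVec m) = 0 := by
    intro r hr
    have hr' : 0 < r := hr
    rw [tPoisson, preservesZero_tangential (hasTemperateGrowth_poissonSymbol r) σ φ hφ, mul_zero]
    rw [sub_eq_add_neg, ← neg_smul, normal_add_smul]
    nlinarith [mul_nonneg (neg_nonneg.mpr hσ) hr'.le]
  rw [setIntegral_congr_fun measurableSet_Ioi h]
  simp

open LineDeriv in
theorem sgnOp_one (ε : ℝ) (φ : 𝓢(Rd (m + 1), ℂ)) :
    sgnOp m ε 1 φ = SchwartzMap.fourierMultiplierCLM ℂ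
      (fun ξ => (kappa m (tangential m ξ) : ℂ)) φ + ε • ∂_{normalVec m} φ := by
  have hn : (fun ξ : Rd (m + 1) => inner ℝ ξ (normalVec m)).HasTemperateGrowth := by fun_prop
  have hn' : (fun ξ : Rd (m + 1) => (RCLike.ofReal (inner ℝ ξ (normalVec m) : ℝ) : ℂ)).HasTemperateGrowth :=
    Function.Complex.hasTemperateGrowth_ofReal.comp hn
  have hin : ∀ ξ, inner ℝ ξ (normalVec m) = normal m ξ := fun ξ => by
    simp [normalVec, normal, EuclideanSpace.inner_single_right]
  apply (fourierCLE ℂ 𝓢(Rd (m + 1), ℂ)).injective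
  ext ξ
  simp only [fourierCLE_apply]
  rw [SchwartzMap.lineDeriv_eq_fourierMultiplierCLM, ← SchwartzMap.fourierMultiplierCLM_ofReal ℂ hn]
  rw [FourierTransform.fourier_add, FourierTransform.fourier_smul, FourierTransform.fourier_smul]
  simp only [SchwartzMap.fourierMultiplierCLM_apply, FourierTransform.fourier_fourierInv_eq,
    add_apply, smul_apply]
  rw [SchwartzMap.smulLeftCLM_apply_apply (hasTemperateGrowth_sgnSymbol ε 1),
    SchwartzMap.smulLeftCLM_apply_apply hasTemperateGrowth_kappa_tangential,
    SchwartzMap.smulLeftCLM_apply_apply hn', sgnSymbol_one_right, sgnBase, hin]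
  simp only [smul_eq_mul, Complex.real_smul, Complex.coe_algebraMap]
  push_cast
  ring

/-- ⟨D'⟩ + ε∂_n is local in x_n, so no sign condition links σ and ε. -/
theorem preservesZero_sgnOp_one (σ ε : ℝ) : PreservesZero m σ (sgnOp m ε 1) := by
  intro φ hφ x hx
  rw [sgnOp_one]
  have h1 := preservesZero_tangential
    (Function.Complex.hasTemperateGrowth_ofReal.comp (hasTemperateGrowth_kappa (m := m))) σ φ hφ x hx
  have h2 : fderiv ℝ φ x = 0 := by
    have : (φ : Rd (m + 1) → ℂ) =ᶠ[nhds x] fun _ => 0 := by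
      have ho : IsOpen {z : Rd (m + 1) | 0 < σ * normal m z} :=
        isOpen_lt continuous_const (by fun_prop)
      filter_upwards [ho.mem_nhds hx] with z hz using hφ z hz
    rw [this.fderiv_eq]
    simp
  rw [add_apply, smul_apply, SchwartzMap.lineDerivOp_apply_eq_fderiv, h2]
  simpa using h1

theorem PreservesZero.comp {σ : ℝ} {A B : 𝓢(Rd (m + 1), ℂ) → 𝓢(Rd (m + 1), ℂ)}
    (hA : PreservesZero m σ A) (hB : PreservesZero m σ B) : PreservesZero m σ fun φ => A (B φ) :=
  fun φ hφ => hA _ (hB φ hφ)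

/-- Any power is a negative power followed by finitely many applications of the first order
operator; the induction is on an integer above t. -/
theorem preservesZero_sgnOp {σ ε : ℝ} (hσ : σ * ε ≤ 0) (t : ℝ) :
    PreservesZero m σ (sgnOp m ε t) := by
  have hnat : ∀ (N : ℕ) (t : ℝ), t < N → PreservesZero m σ (sgnOp m ε t) := by
    intro N
    induction N with
    | zero =>
      intro t ht
      have h := preservesZero_sgnOp_neg (m := m) hσ (c := -t) (by simpa using ht)
      rwa [neg_neg] at h
    | succ N ih =>
      intro t ht
      have h := (preservesZero_sgnOp_one (m := m) σ ε).comp (ih (t - 1) (by push_cast at ht; linarith))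
      have e : (fun φ => sgnOp m ε 1 (sgnOp m ε (t - 1) φ)) = sgnOp m ε t := by
        ext φ : 1
        rw [sgnOp_sgnOp]
        congr 2
        ring
      rwa [e] at h
  obtain ⟨N, hN⟩ := exists_nat_gt t
  exact hnat N t hN

/-- `Ξ₊^t` preserves supports in the closed upper half-space. -/
theorem isVanishingOn_lower_sgnDOp {u : 𝓢'(Rd (m + 1), ℂ)} (hu : IsVanishingOn u (lower m))
    (t : ℝ) : IsVanishingOn (sgnDOp m 1 t u) (lower m) := by
  rw [isVanishingOn_lower_iff] at hu ⊢
  intro φ hφ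
  rw [sgnDOp_apply]
  refine hu _ fun x hx => ?_
  exact preservesZero_sgnOp (σ := 1) (ε := -1) (by norm_num) t φ (by simpa using hφ) x
    (by simpa using hx)

/-- `Ξ₋^t` preserves supports in the closed lower half-space. -/
theorem isVanishingOn_upper_sgnDOp {u : 𝓢'(Rd (m + 1), ℂ)} (hu : IsVanishingOn u (upper m))
    (t : ℝ) : IsVanishingOn (sgnDOp m (-1) t u) (upper m) := by
  rw [isVanishingOn_upper_iff] at hu ⊢
  intro φ hφ
  rw [sgnDOp_apply, neg_neg]
  refine hu _ fun x hx => ?_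
  exact preservesZero_sgnOp (σ := -1) (ε := 1) (by norm_num) t φ
    (fun x hx => hφ x (by linarith)) x (by linarith)

/-- `Ξ₊^1` is local in the normal variable. -/
theorem isVanishingOn_upper_sgnDOp_one {u : 𝓢'(Rd (m + 1), ℂ)} (hu : IsVanishingOn u (upper m))
    (ε : ℝ) : IsVanishingOn (sgnDOp m ε 1 u) (upper m) := by
  rw [isVanishingOn_upper_iff] at hu ⊢
  intro φ hφ
  rw [sgnDOp_apply]
  refine hu _ fun x hx => ?_
  exact preservesZero_sgnOp_one (-1) (-ε) φ (fun x hx => hφ x (by linarith)) x (by linarith)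

theorem isVanishingOn_upper_tangential {q : Rd m → ℂ} (hq : q.HasTemperateGrowth)
    {u : 𝓢'(Rd (m + 1), ℂ)} (hu : IsVanishingOn u (upper m)) :
    IsVanishingOn (fourierMultiplierCLM ℂ (fun ξ => q (tangential m ξ)) u) (upper m) := by
  rw [isVanishingOn_upper_iff] at hu ⊢
  intro φ hφ
  have hq' : (fun ξ : Rd m => q (-ξ)).HasTemperateGrowth :=
    hq.comp (-ContinuousLinearMap.id ℝ (Rd m)).hasTemperateGrowth
  have hq2 : (fun ξ : Rd (m + 1) => q (tangential m ξ)).HasTemperateGrowth :=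
    hq.comp (tangential m).hasTemperateGrowth
  rw [fourierMultiplier_apply hq2]
  refine hu _ fun x hx => ?_
  have h := preservesZero_tangential hq' (-1) φ (fun x hx => hφ x (by linarith)) x (by linarith)
  simpa only [Function.comp_def, map_neg] using h

end Support

/-! ### Pairings with `L²` functions -/

section Riesz

variable {E : Type} [NormedAddCommGroup E] [InnerProductSpace ℝ E] [FiniteDimensional ℝ E]
  [MeasurableSpace E] [BorelSpace E]

theorem lp_toDist_apply_eq_inner (f : Lp ℂ 2 (volume : Measure E)) (χ : 𝓢(E, ℂ)) :
    (f : 𝓢'(E, ℂ)) χ = inner ℂ (star f) (χ.toLp 2) := by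
  rw [Lp.toTemperedDistribution_apply, L2.inner_def]
  refine integral_congr_ae ?_
  filter_upwards [χ.coeFn_toLp 2 volume, Lp.coeFn_star f] with x h1 h2
  rw [h1, h2]
  simp [Pi.star_apply, mul_comm]

theorem norm_lp_toDist_apply_le (f : Lp ℂ 2 (volume : Measure E)) (χ : 𝓢(E, ℂ)) :
    ‖(f : 𝓢'(E, ℂ)) χ‖ ≤ ‖f‖ * ‖χ.toLp 2‖ := by
  rw [lp_toDist_apply_eq_inner]
  refine (norm_inner_le_norm _ _).trans_eq ?_
  congr 1
  rw [Lp.norm_def, Lp.norm_def]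
  congr 1
  refine eLpNorm_congr_norm_ae ?_
  filter_upwards [Lp.coeFn_star f] with x h
  rw [h, Pi.star_apply, norm_star]

/-- A tempered distribution bounded in the `L²` norm is an `L²` function. -/
theorem exists_lp_of_bound (T : 𝓢'(E, ℂ)) {C : ℝ} (hC : 0 ≤ C)
    (hT : ∀ χ : 𝓢(E, ℂ), ‖T χ‖ ≤ C * ‖χ.toLp 2‖) :
    ∃ f : Lp ℂ 2 (volume : Measure E), (f : 𝓢'(E, ℂ)) = T ∧ ‖f‖ ≤ C := by
  set e : 𝓢(E, ℂ) →ₗ[ℂ] Lp ℂ 2 (volume : Measure E) :=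
    (SchwartzMap.toLpCLM ℂ ℂ 2 volume).toLinearMap
  set T' : 𝓢(E, ℂ) →ₗ[ℂ] ℂ :=
    { toFun := fun χ => T χ, map_add' := map_add T, map_smul' := map_smul T }
  have hd : DenseRange e := SchwartzMap.denseRange_toLpCLM (p := 2) ENNReal.ofNat_ne_top
  have hT' : ∀ χ, ‖T' χ‖ ≤ C * ‖e χ‖ := hT
  set l : Lp ℂ 2 (volume : Measure E) →L[ℂ] ℂ := T'.extendOfNorm e with hl
  set g := (InnerProductSpace.toDual ℂ (Lp ℂ 2 (volume : Measure E))).symm l with hg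
  have key : ∀ χ : 𝓢(E, ℂ), inner ℂ g (χ.toLp 2) = T χ := fun χ => by
    rw [hg, InnerProductSpace.toDual_symm_apply]
    exact LinearMap.extendOfNorm_eq hd ⟨C, hT'⟩ χ
  -- The distributional pairing is bilinear whereas the inner product is conjugate linear in its
  -- first slot, so the Riesz representative has to be conjugated.
  refine ⟨star g, ?_, ?_⟩
  · ext χ
    rw [lp_toDist_apply_eq_inner, star_star, key]
  · have h1 : ‖star g‖ = ‖g‖ := by
      rw [Lp.norm_def, Lp.norm_def]
      congr 1
      refine eLpNorm_congr_norm_ae ?_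
      filter_upwards [Lp.coeFn_star g] with x h
      rw [h, Pi.star_apply, norm_star]
    rw [h1]
    rw [hg, LinearIsometryEquiv.norm_map]
    exact LinearMap.opNorm_extendOfNorm_le hd hC hT'

theorem norm_toLp_two_sq (φ : 𝓢(E, ℂ)) : ‖φ.toLp 2‖ ^ 2 = ∫ x, ‖φ x‖ ^ 2 := by
  rw [SchwartzMap.norm_toLp' (by norm_num) (by norm_num)]
  simp only [ENNReal.toReal_ofNat, Real.rpow_ofNat]
  rw [← Real.rpow_natCast, ← Real.rpow_mul (by positivity)]
  norm_num

theorem norm_integral_mul_sq_le {α : Type*} [MeasurableSpace α] {μ : Measure α} {q f : α → ℂ}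
    (hq : MemLp q 2 μ) (hf : MemLp f 2 μ) :
    ‖∫ x, q x * f x ∂μ‖ ^ 2 ≤ (∫ x, ‖q x‖ ^ 2 ∂μ) * ∫ x, ‖f x‖ ^ 2 ∂μ := by
  have h1 : ‖∫ x, q x * f x ∂μ‖ ≤ ∫ x, ‖q x‖ * ‖f x‖ ∂μ := by
    refine (norm_integral_le_integral_norm _).trans_eq ?_
    simp only [norm_mul]
  have h2 := integral_mul_norm_le_Lp_mul_Lq (μ := μ) (p := 2) (q := 2) (f := q) (g := f)
    ⟨by norm_num, by norm_num, by norm_num⟩ (by simpa using hq) (by simpa using hf)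
  have h3 := h1.trans h2
  calc _ ≤ _ := pow_le_pow_left₀ (norm_nonneg _) h3 2
    _ = _ := by
      rw [mul_pow, ← Real.rpow_natCast, ← Real.rpow_natCast, ← Real.rpow_mul (by positivity),
        ← Real.rpow_mul (by positivity)]
      norm_num

end Riesz

/-! ### The trace estimate -/

section Trace

variable {m : ℕ}

theorem integrable_one_add_sq_rpow {ρ : ℝ} (hρ : 1 / 2 < ρ) :
    Integrable fun τ : ℝ => (1 + τ ^ 2) ^ (-ρ) := by
  have h := integrable_rpow_neg_one_add_norm_sq (E := ℝ) (μ := volume) (r := 2 * ρ)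
    (by simp; linarith)
  refine h.congr (Eventually.of_forall fun τ => ?_)
  simp only [Real.norm_eq_abs, sq_abs]
  congr 1
  ring

/-- `∫ (1 + τ²)^{-ρ} dτ`. -/
def traceConst (ρ : ℝ) : ℝ := ∫ τ : ℝ, (1 + τ ^ 2) ^ (-ρ)

theorem traceConst_nonneg (ρ : ℝ) : 0 ≤ traceConst ρ :=
  integral_nonneg fun τ => by positivity

theorem add_sq_rpow_eq {A : ℝ} (hA : 0 < A) (ρ τ : ℝ) :
    (A + τ ^ 2) ^ (-ρ) = A ^ (-ρ) * (1 + ((A ^ (1 / 2 : ℝ))⁻¹ * τ) ^ 2) ^ (-ρ) := by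
  rw [← Real.mul_rpow hA.le (by positivity)]
  congr 1
  have : (A ^ (1 / 2 : ℝ)) ^ 2 = A := by
    rw [← Real.rpow_natCast, ← Real.rpow_mul hA.le]; norm_num
  rw [mul_pow, inv_pow, this]
  field_simp

theorem integrable_add_sq_rpow {A ρ : ℝ} (hA : 0 < A) (hρ : 1 / 2 < ρ) :
    Integrable fun τ : ℝ => (A + τ ^ 2) ^ (-ρ) := by
  simp_rw [add_sq_rpow_eq hA]
  exact ((integrable_one_add_sq_rpow hρ).comp_mul_left' (by positivity)).const_mul _

/-- Scaling τ by A^{1/2}. With A = 1 + |ξ'|² the exponent 1/2 - ρ is the half derivative lost by the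
trace. -/
theorem integral_add_sq_rpow {A : ℝ} (hA : 0 < A) (ρ : ℝ) :
    ∫ τ : ℝ, (A + τ ^ 2) ^ (-ρ) = A ^ (1 / 2 - ρ) * traceConst ρ := by
  simp_rw [add_sq_rpow_eq hA]
  rw [integral_const_mul, Measure.integral_comp_mul_left (fun τ => (1 + τ ^ 2) ^ (-ρ)), inv_inv,
    abs_of_pos (by positivity), smul_eq_mul, ← mul_assoc, ← Real.rpow_add hA, traceConst]
  congr 2
  ring

theorem norm_sq_join (ξ : Rd m) (τ : ℝ) : ‖join ξ τ‖ ^ 2 = ‖ξ‖ ^ 2 + τ ^ 2 := by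
  rw [norm_sq_split, tangential_join, normal_join]

theorem norm_symbol_join_sq_le {q : Rd (m + 1) → ℂ} {C ρ : ℝ}
    (hC : ∀ ξ, ‖q ξ‖ ≤ C * ((1 + ‖tangential m ξ‖ ^ 2) ^ ((ρ - 1 / 2) / 2) *
      (1 + ‖ξ‖ ^ 2) ^ (-ρ / 2))) (ξ : Rd m) (τ : ℝ) :
    ‖q (join ξ τ)‖ ^ 2 ≤
      C ^ 2 * (1 + ‖ξ‖ ^ 2) ^ (ρ - 1 / 2) * (1 + ‖ξ‖ ^ 2 + τ ^ 2) ^ (-ρ) := by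
  have h := pow_le_pow_left₀ (norm_nonneg _) (hC (join ξ τ)) 2
  have hsq : ∀ {A : ℝ}, 0 < A → ∀ r : ℝ, (A ^ (r / 2)) ^ 2 = A ^ r := fun hA r => by
    rw [← Real.rpow_natCast, ← Real.rpow_mul hA.le]
    norm_num
  rw [tangential_join, norm_sq_join, mul_pow, mul_pow, hsq (by positivity), hsq (by positivity),
    ← mul_assoc, ← add_assoc] at h
  exact h

/-- The Fourier transform of the trace is the integral over ξ_n of q·𝓕χ. Cauchy–Schwarz in ξ_n
leaves ∫|q|² dξ_n, which the weights in the hypothesis bound uniformly in ξ'. The trace theorem is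
one instance, and by duality so are the mapping properties of layer potentials. -/
theorem norm_schwartzTrace_mult_le {q : Rd (m + 1) → ℂ} (hq : q.HasTemperateGrowth) {C ρ : ℝ}
    (hρ : 1 / 2 < ρ) (hC : ∀ ξ, ‖q ξ‖ ≤ C * ((1 + ‖tangential m ξ‖ ^ 2) ^ ((ρ - 1 / 2) / 2) *
      (1 + ‖ξ‖ ^ 2) ^ (-ρ / 2))) (χ : 𝓢(Rd (m + 1), ℂ)) :
    ‖(schwartzTrace m (SchwartzMap.fourierMultiplierCLM ℂ q χ)).toLp 2‖ ≤
      C * Real.sqrt (traceConst ρ) * ‖χ.toLp 2‖ := by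
  have hC0 : 0 ≤ C := by
    have := (norm_nonneg _).trans (hC 0)
    simpa using this
  have hF : ∀ ξ : Rd m, 𝓕 (schwartzTrace m (SchwartzMap.fourierMultiplierCLM ℂ q χ)) ξ =
      ∫ τ : ℝ, q (join ξ τ) * 𝓕 χ (join ξ τ) := by
    intro ξ
    rw [← slice_zero, fourier_slice]
    congr 1
    ext τ
    rw [SchwartzMap.fourierMultiplierCLM_apply, FourierTransform.fourier_fourierInv_eq,
      SchwartzMap.smulLeftCLM_apply_apply hq]
    simp
  have hsq : Integrable fun ξ => ‖𝓕 χ ξ‖ ^ 2 :=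
    (memLp_two_iff_integrable_sq_norm (𝓕 χ).continuous.aestronglyMeasurable).mp
      ((𝓕 χ).memLp 2 volume)
  have hsq' := integrable_join_iff.mpr hsq
  have hq2 : ∀ ξ : Rd m, MemLp (fun τ : ℝ => q (join ξ τ)) 2 volume := by
    intro ξ
    have hc : Continuous fun τ : ℝ => q (join ξ τ) := hq.1.continuous.comp (by fun_prop)
    rw [memLp_two_iff_integrable_sq_norm hc.aestronglyMeasurable]
    refine ((integrable_add_sq_rpow (A := 1 + ‖ξ‖ ^ 2) (by positivity) hρ).const_mul
      (C ^ 2 * (1 + ‖ξ‖ ^ 2) ^ (ρ - 1 / 2))).mono' (hc.norm.pow 2).aestronglyMeasurable (Eventually.of_forall fun τ => ?_)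
    rw [Real.norm_of_nonneg (by positivity)]
    exact norm_symbol_join_sq_le hC ξ τ
  have hqint : ∀ ξ : Rd m, ∫ τ : ℝ, ‖q (join ξ τ)‖ ^ 2 ≤ C ^ 2 * traceConst ρ := by
    intro ξ
    have h1 : ∫ τ : ℝ, ‖q (join ξ τ)‖ ^ 2 ≤ ∫ τ : ℝ,
        C ^ 2 * (1 + ‖ξ‖ ^ 2) ^ (ρ - 1 / 2) * (1 + ‖ξ‖ ^ 2 + τ ^ 2) ^ (-ρ) := by
      refine integral_mono ?_ ?_ (norm_symbol_join_sq_le hC ξ)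
      · exact (memLp_two_iff_integrable_sq_norm (hq2 ξ).1).mp (hq2 ξ)
      · exact (integrable_add_sq_rpow (by positivity) hρ).const_mul _
    refine h1.trans_eq ?_
    have h2 : (1 + ‖ξ‖ ^ 2) ^ (ρ - 1 / 2) * (1 + ‖ξ‖ ^ 2) ^ (1 / 2 - ρ) = 1 := by
      rw [← Real.rpow_add (by positivity)]
      norm_num
    rw [integral_const_mul, integral_add_sq_rpow (by positivity)]
    linear_combination C ^ 2 * traceConst ρ * h2
  have hχ2 : ∀ᵐ ξ : Rd m, Integrable fun τ : ℝ => ‖𝓕 χ (join ξ τ)‖ ^ 2 := hsq'.prod_left_ae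
  refine le_of_sq_le_sq ?_ (by positivity)
  rw [← SchwartzMap.norm_fourier_toL2_eq, norm_toLp_two_sq, mul_pow, mul_pow,
    Real.sq_sqrt (traceConst_nonneg ρ), ← SchwartzMap.norm_fourier_toL2_eq χ, norm_toLp_two_sq,
    integral_split' hsq, ← integral_const_mul]
  refine integral_mono_of_nonneg (Eventually.of_forall fun ξ => by positivity)
    (hsq'.integral_prod_right.const_mul _) ?_
  filter_upwards [hχ2] with ξ hξ
  rw [hF ξ]
  refine (norm_integral_mul_sq_le (hq2 ξ) ?_).trans ?_
  · rw [memLp_two_iff_integrable_sq_norm]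
    · exact hξ
    · exact ((𝓕 χ).continuous.comp (by fun_prop)).aestronglyMeasurable
  · exact mul_le_mul_of_nonneg_right (hqint ξ) (integral_nonneg fun τ => by positivity)

end Trace

/-! ### Bessel operators on Schwartz functions -/

section Bessel

variable {E : Type} [NormedAddCommGroup E] [InnerProductSpace ℝ E] [FiniteDimensional ℝ E]
  [MeasurableSpace E] [BorelSpace E]

/-- The symbol `(1 + |ξ|²)^{s/2}`. -/
def besselSymbol (E : Type) [NormedAddCommGroup E] (s : ℝ) (ξ : E) : ℂ :=
  (((1 + ‖ξ‖ ^ 2) ^ (s / 2) : ℝ) : ℂ)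

theorem hasTemperateGrowth_besselSymbol (s : ℝ) : (besselSymbol E s).HasTemperateGrowth :=
  hasTemperateGrowth_bessel s

theorem besselSymbol_neg (s : ℝ) (ξ : E) : besselSymbol E s (-ξ) = besselSymbol E s ξ := by
  simp [besselSymbol]

theorem besselSymbol_add (s s' : ℝ) (ξ : E) :
    besselSymbol E (s + s') ξ = besselSymbol E s ξ * besselSymbol E s' ξ := by
  rw [besselSymbol, add_div, Real.rpow_add (by positivity), Complex.ofReal_mul]
  rfl

theorem besselSymbol_zero (ξ : E) : besselSymbol E 0 ξ = 1 := by simp [besselSymbol]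

theorem norm_besselSymbol (s : ℝ) (ξ : E) : ‖besselSymbol E s ξ‖ = (1 + ‖ξ‖ ^ 2) ^ (s / 2) := by
  rw [besselSymbol, Complex.norm_real, Real.norm_of_nonneg (by positivity)]

/-- The Bessel operator on Schwartz functions. -/
abbrev besselOp (s : ℝ) : 𝓢(E, ℂ) →L[ℂ] 𝓢(E, ℂ) :=
  SchwartzMap.fourierMultiplierCLM ℂ (besselSymbol E s)

theorem besselPotential_eq (s : ℝ) :
    besselPotential E ℂ s = fourierMultiplierCLM ℂ (besselSymbol E s) := rfl

theorem besselPotential_apply (s : ℝ) (u : 𝓢'(E, ℂ)) (χ : 𝓢(E, ℂ)) :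
    besselPotential E ℂ s u χ = u (besselOp s χ) := by
  rw [besselPotential_eq, fourierMultiplier_apply (hasTemperateGrowth_besselSymbol s)]
  simp only [besselSymbol_neg]

theorem SobolevSpace.equivL2_ofSchwartz (s : ℝ) (φ : 𝓢(E, ℂ)) :
    SobolevSpace.equivL2 s (SobolevSpace.ofSchwartz s φ) = (besselOp s φ).toLp 2 := by
  apply lp_toDist_injective
  rw [SobolevSpace.equivL2_toDist, Lp.toTemperedDistribution_toLp_eq,
    SobolevSpace.toDist_ofSchwartz, besselPotential_eq,
    fourierMultiplierCLM_toTemperedDistributionCLM_eq (hasTemperateGrowth_besselSymbol _)]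

theorem SobolevSpace.norm_ofSchwartz (s : ℝ) (φ : 𝓢(E, ℂ)) :
    ‖SobolevSpace.ofSchwartz s φ‖ = ‖(besselOp s φ).toLp 2‖ := by
  rw [← SobolevSpace.equivL2_ofSchwartz, LinearIsometryEquiv.norm_map]

/-- The inclusion of the Schwartz functions into `H^s(E)`. -/
def SobolevSpace.ofSchwartzLM (s : ℝ) : 𝓢(E, ℂ) →ₗ[ℂ] SobolevSpace E s where
  toFun := SobolevSpace.ofSchwartz s
  map_add' φ ψ := SobolevSpace.toDist_injective <| by
    rw [map_add]
    exact map_add (SchwartzMap.toTemperedDistributionCLM E ℂ volume) φ ψ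
  map_smul' c φ := SobolevSpace.toDist_injective <| by
    rw [map_smul]
    exact map_smul (SchwartzMap.toTemperedDistributionCLM E ℂ volume) c φ

theorem SobolevSpace.toDist_apply_eq {s : ℝ} (u : SobolevSpace E s) (χ : 𝓢(E, ℂ)) :
    u.toDist χ = ((SobolevSpace.equivL2 s u : Lp ℂ 2 (volume : Measure E)) : 𝓢'(E, ℂ))
      (besselOp (-s) χ) := by
  rw [SobolevSpace.equivL2_toDist, ← besselPotential_apply]
  simp

instance (s : ℝ) : CompleteSpace (SobolevSpace E s) :=
  (SobolevSpace.equivL2 (E := E) s).toIsometryEquiv.completeSpace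

/-- Fourier multipliers are additive in the symbol. -/
theorem fourierMultiplier_add {p q : E → ℂ} (hp : p.HasTemperateGrowth)
    (hq : q.HasTemperateGrowth) (u : 𝓢'(E, ℂ)) :
    fourierMultiplierCLM ℂ (fun ξ => p ξ + q ξ) u =
      fourierMultiplierCLM ℂ p u + fourierMultiplierCLM ℂ q u := by
  have h := fourierMultiplierCLM_sum (F := ℂ) (g := fun b : Bool => bif b then p else q)
    (s := Finset.univ) (fun b _ => by cases b <;> assumption)
  have h' := congrArg (fun A => A u) h
  simp only [Fintype.sum_bool, cond_true, cond_false] at h'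
  exact h'

end Bessel

/-! ### The trace operator on Sobolev spaces. -/

section TraceSobolev

variable {m : ℕ}

theorem hasTemperateGrowth_bessel_tangential (r : ℝ) :
    (fun ξ : Rd (m + 1) => besselSymbol (Rd m) r (tangential m ξ)).HasTemperateGrowth :=
  (hasTemperateGrowth_besselSymbol r).comp (tangential m).hasTemperateGrowth

theorem schwartzTrace_tangentialMult {q : Rd m → ℂ} (hq : q.HasTemperateGrowth)
    (φ : 𝓢(Rd (m + 1), ℂ)) :
    schwartzTrace m (SchwartzMap.fourierMultiplierCLM ℂ (fun ξ => q (tangential m ξ)) φ) =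
      SchwartzMap.fourierMultiplierCLM ℂ q (schwartzTrace m φ) := by
  rw [← slice_zero, slice_tangentialMult hq]

theorem norm_ofSchwartz_trace_le {σ : ℝ} (hσ : 1 / 2 < σ) (φ : 𝓢(Rd (m + 1), ℂ)) :
    ‖SobolevSpace.ofSchwartz (σ - 1 / 2) (schwartzTrace m φ)‖ ≤
      Real.sqrt (traceConst σ) * ‖SobolevSpace.ofSchwartz σ φ‖ := by
  have hq := (hasTemperateGrowth_bessel_tangential (m := m) (σ - 1 / 2)).mul
    (hasTemperateGrowth_besselSymbol (E := Rd (m + 1)) (-σ))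
  rw [SobolevSpace.norm_ofSchwartz, SobolevSpace.norm_ofSchwartz,
    ← schwartzTrace_tangentialMult (hasTemperateGrowth_besselSymbol _)]
  have h := norm_schwartzTrace_mult_le hq (C := 1) hσ (fun ξ => ?_) (besselOp σ φ)
  · rw [one_mul] at h
    refine le_trans (le_of_eq ?_) h
    rw [SchwartzMap.fourierMultiplierCLM_fourierMultiplierCLM_apply hq
      (hasTemperateGrowth_besselSymbol σ)]
    have e : besselSymbol (Rd (m + 1)) (-σ) * besselSymbol (Rd (m + 1)) σ = 1 := by
      ext ξ
      rw [Pi.mul_apply, ← besselSymbol_add, neg_add_cancel, besselSymbol_zero, Pi.one_apply]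
    rw [mul_assoc, e, mul_one]
  · rw [Pi.mul_apply, norm_mul, norm_besselSymbol, norm_besselSymbol, one_mul]

/-- The trace operator `H^σ(ℝⁿ) → H^{σ-1/2}(ℝ^{n-1})`, for `σ > 1/2`. -/
def traceMap (m : ℕ) (σ r : ℝ) : SobolevSpace (Rd (m + 1)) σ →L[ℂ] SobolevSpace (Rd m) r :=
  (SobolevSpace.ofSchwartzLM r ∘ₗ (schwartzTrace m).toLinearMap).extendOfNorm
    (SobolevSpace.ofSchwartzLM σ)

/-- The extension by density has its intended values because of the trace estimate, hence the
hypotheses here. The order r is a variable of its own because it is later written t - a + 1/2, which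
is equal to σ - 1/2 but not by definition. -/
theorem traceMap_ofSchwartz {σ r : ℝ} (hσ : 1 / 2 < σ) (hr : r = σ - 1 / 2)
    (φ : 𝓢(Rd (m + 1), ℂ)) :
    traceMap m σ r (SobolevSpace.ofSchwartz σ φ) =
      SobolevSpace.ofSchwartz r (schwartzTrace m φ) := by
  subst hr
  exact LinearMap.extendOfNorm_eq
    (f := SobolevSpace.ofSchwartzLM (σ - 1 / 2) ∘ₗ (schwartzTrace m).toLinearMap)
    (e := SobolevSpace.ofSchwartzLM σ) (SobolevSpace.denseRange_ofSchwartz σ)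
    ⟨_, norm_ofSchwartz_trace_le hσ⟩ φ

end TraceSobolev

/-! ### Layers and Poisson operators -/

section Layer

variable {m : ℕ}

/-- The distribution `ψ ⊗ δ(x_n)`. -/
def layer (m : ℕ) : 𝓢'(Rd m, ℂ) →L[ℂ] 𝓢'(Rd (m + 1), ℂ) :=
  PointwiseConvergenceCLM.precomp ℂ (schwartzTrace m)

theorem layer_apply (ψ : 𝓢'(Rd m, ℂ)) (χ : 𝓢(Rd (m + 1), ℂ)) :
    layer m ψ χ = ψ (schwartzTrace m χ) := rfl

theorem isVanishingOn_upper_layer (ψ : 𝓢'(Rd m, ℂ)) : IsVanishingOn (layer m ψ) (upper m) := by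
  intro φ hφ
  rw [layer_apply]
  have : schwartzTrace m φ = 0 := by
    ext x
    rw [schwartzTrace_apply]
    by_contra h
    have h1 : join x 0 ∈ upper m := hφ (subset_tsupport _ h)
    have h2 : 0 < normal m (join x 0) := h1
    simp at h2
  rw [this, map_zero]

theorem isVanishingOn_lower_layer (ψ : 𝓢'(Rd m, ℂ)) : IsVanishingOn (layer m ψ) (lower m) := by
  intro φ hφ
  rw [layer_apply]
  have : schwartzTrace m φ = 0 := by
    ext x
    rw [schwartzTrace_apply]
    by_contra h
    have h1 : join x 0 ∈ lower m := hφ (subset_tsupport _ h)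
    have h2 : normal m (join x 0) < 0 := h1
    simp at h2
  rw [this, map_zero]

/-- By duality: pairing ⟨D⟩^σ Op(p)(ψ ⊗ δ) with χ equals pairing the L² function ⟨D'⟩^r ψ with the
trace of a multiplier applied to χ. The trace estimate bounds this by the L² norm of χ, and the
Riesz theorem applies. -/
theorem exists_layerPotential {p : Rd (m + 1) → ℂ} (hp : p.HasTemperateGrowth) {C ρ r σ : ℝ}
    (hρ : 1 / 2 < ρ)
    (hC : ∀ ξ, ‖p ξ‖ ≤ C * ((1 + ‖tangential m ξ‖ ^ 2) ^ ((r + ρ - 1 / 2) / 2) *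
      (1 + ‖ξ‖ ^ 2) ^ ((-ρ - σ) / 2))) (ψ : SobolevSpace (Rd m) r) :
    ∃ v : SobolevSpace (Rd (m + 1)) σ, v.toDist = fourierMultiplierCLM ℂ p (layer m ψ.toDist) ∧
      ‖v‖ ≤ C * Real.sqrt (traceConst ρ) * ‖ψ‖ := by
  have hC0 : 0 ≤ C := by
    have := (norm_nonneg _).trans (hC 0)
    simpa using this
  have hp' : (fun ξ => p (-ξ)).HasTemperateGrowth :=
    hp.comp (-ContinuousLinearMap.id ℝ (Rd (m + 1))).hasTemperateGrowth
  have hq := ((hasTemperateGrowth_bessel_tangential (m := m) (-r)).mul hp').mul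
    (hasTemperateGrowth_besselSymbol (E := Rd (m + 1)) σ)
  set f : Lp ℂ 2 (volume : Measure (Rd m)) := SobolevSpace.equivL2 r ψ with hf
  have key : ∀ χ : 𝓢(Rd (m + 1), ℂ),
      besselPotential _ ℂ σ (fourierMultiplierCLM ℂ p (layer m ψ.toDist)) χ =
        (f : 𝓢'(Rd m, ℂ)) (schwartzTrace m (SchwartzMap.fourierMultiplierCLM ℂ
          (((fun ξ => besselSymbol (Rd m) (-r) (tangential m ξ)) * fun ξ => p (-ξ)) *
            besselSymbol (Rd (m + 1)) σ) χ)) := by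
    intro χ
    rw [besselPotential_apply, fourierMultiplier_apply hp, layer_apply,
      SobolevSpace.toDist_apply_eq, ← schwartzTrace_tangentialMult
        (hasTemperateGrowth_besselSymbol _),
      SchwartzMap.fourierMultiplierCLM_fourierMultiplierCLM_apply hp'
        (hasTemperateGrowth_besselSymbol σ),
      SchwartzMap.fourierMultiplierCLM_fourierMultiplierCLM_apply
        (hasTemperateGrowth_bessel_tangential (m := m) (-r))
        (hp'.mul (hasTemperateGrowth_besselSymbol σ)), mul_assoc]
  obtain ⟨g, hg, hgn⟩ := exists_lp_of_bound
    (besselPotential _ ℂ σ (fourierMultiplierCLM ℂ p (layer m ψ.toDist)))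
    (C := C * Real.sqrt (traceConst ρ) * ‖ψ‖) (by positivity) fun χ => by
      rw [key]
      refine (norm_lp_toDist_apply_le _ _).trans ?_
      have h := norm_schwartzTrace_mult_le hq hρ (C := C) (fun ξ => ?_) χ
      · rw [hf, LinearIsometryEquiv.norm_map]
        calc _ ≤ ‖ψ‖ * (C * Real.sqrt (traceConst ρ) * ‖χ.toLp 2‖) := by gcongr
          _ = _ := by ring
      · have h1 := hC (-ξ)
        rw [map_neg, norm_neg, norm_neg] at h1
        simp only [Pi.mul_apply]
        rw [norm_mul, norm_mul, norm_besselSymbol, norm_besselSymbol]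
        calc _ ≤ (1 + ‖tangential m ξ‖ ^ 2) ^ (-r / 2) *
              (C * ((1 + ‖tangential m ξ‖ ^ 2) ^ ((r + ρ - 1 / 2) / 2) *
                (1 + ‖ξ‖ ^ 2) ^ ((-ρ - σ) / 2))) * (1 + ‖ξ‖ ^ 2) ^ (σ / 2) := by gcongr
          _ = C * (((1 + ‖tangential m ξ‖ ^ 2) ^ (-r / 2) *
              (1 + ‖tangential m ξ‖ ^ 2) ^ ((r + ρ - 1 / 2) / 2)) *
                ((1 + ‖ξ‖ ^ 2) ^ ((-ρ - σ) / 2) * (1 + ‖ξ‖ ^ 2) ^ (σ / 2))) := by ring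
          _ = _ := by
            rw [← Real.rpow_add (by positivity), ← Real.rpow_add (by positivity)]
            congr 3 <;> ring
  refine ⟨(SobolevSpace.equivL2 σ).symm g, ?_, ?_⟩
  · rw [SobolevSpace.toDist_equivL2_symm, hg]
    simp
  · rwa [LinearIsometryEquiv.norm_map]

/-- The operator `ψ ↦ Op(p)(ψ ⊗ δ)` from `H^r(ℝ^{n-1})` to `H^σ(ℝⁿ)`. -/
def layerPotential {p : Rd (m + 1) → ℂ} (hp : p.HasTemperateGrowth) {C ρ r σ : ℝ}
    (hρ : 1 / 2 < ρ)
    (hC : ∀ ξ, ‖p ξ‖ ≤ C * ((1 + ‖tangential m ξ‖ ^ 2) ^ ((r + ρ - 1 / 2) / 2) *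
      (1 + ‖ξ‖ ^ 2) ^ ((-ρ - σ) / 2))) :
    SobolevSpace (Rd m) r →L[ℂ] SobolevSpace (Rd (m + 1)) σ :=
  LinearMap.mkContinuous
    { toFun := fun ψ => (exists_layerPotential hp hρ hC ψ).choose
      map_add' := fun ψ₁ ψ₂ => SobolevSpace.toDist_injective <| by
        refine (exists_layerPotential hp hρ hC (ψ₁ + ψ₂)).choose_spec.1.trans ?_
        refine Eq.trans ?_ (map_add SobolevSpace.toDist _ _).symm
        rw [map_add SobolevSpace.toDist ψ₁ ψ₂, map_add (layer m), map_add (fourierMultiplierCLM ℂ p)]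
        exact (congrArg₂ (· + ·) (exists_layerPotential hp hρ hC ψ₁).choose_spec.1
          (exists_layerPotential hp hρ hC ψ₂).choose_spec.1).symm
      map_smul' := fun c ψ => SobolevSpace.toDist_injective <| by
        refine (exists_layerPotential hp hρ hC (c • ψ)).choose_spec.1.trans ?_
        refine Eq.trans ?_ (map_smul SobolevSpace.toDist _ _).symm
        rw [map_smul SobolevSpace.toDist c ψ, map_smul (layer m),
          map_smul (fourierMultiplierCLM ℂ p)]
        exact (congrArg (c • ·) (exists_layerPotential hp hρ hC ψ).choose_spec.1).symm } _
    fun ψ => (exists_layerPotential hp hρ hC ψ).choose_spec.2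

theorem toDist_layerPotential {p : Rd (m + 1) → ℂ} (hp : p.HasTemperateGrowth) {C ρ r σ : ℝ}
    (hρ : 1 / 2 < ρ)
    (hC : ∀ ξ, ‖p ξ‖ ≤ C * ((1 + ‖tangential m ξ‖ ^ 2) ^ ((r + ρ - 1 / 2) / 2) *
      (1 + ‖ξ‖ ^ 2) ^ ((-ρ - σ) / 2))) (ψ : SobolevSpace (Rd m) r) :
    (layerPotential hp hρ hC ψ).toDist = fourierMultiplierCLM ℂ p (layer m ψ.toDist) :=
  (exists_layerPotential hp hρ hC ψ).choose_spec.1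

/-- The middle quantity is exactly 1 + (2π)²|ξ|²; this is where the constants (2π)^{|t|} of the
symbol estimates come from. -/
theorem one_add_norm_sq_le_sgnBase {ε : ℝ} (hε : ε ^ 2 = 1) (ξ : Rd (m + 1)) :
    1 + ‖ξ‖ ^ 2 ≤ ‖sgnBase m ε ξ‖ ^ 2 ∧
      ‖sgnBase m ε ξ‖ ^ 2 ≤ (2 * Real.pi) ^ 2 * (1 + ‖ξ‖ ^ 2) := by
  have h : ‖sgnBase m ε ξ‖ ^ 2 = 1 + (2 * Real.pi) ^ 2 * ‖ξ‖ ^ 2 := by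
    rw [Complex.sq_norm, Complex.normSq_apply, re_sgnBase, im_sgnBase, ← sq, kappa_sq, norm_smul,
      norm_sq_split ξ, mul_pow, Real.norm_of_nonneg (by positivity)]
    linear_combination (2 * Real.pi * normal m ξ) ^ 2 * hε
  have hpi : 1 ≤ (2 * Real.pi) ^ 2 := by nlinarith [Real.pi_gt_three]
  rw [h]
  constructor <;> nlinarith [sq_nonneg ‖ξ‖]

theorem norm_sgnSymbol {ε : ℝ} (t : ℝ) (ξ : Rd (m + 1)) :
    ‖sgnSymbol m ε t ξ‖ = (‖sgnBase m ε ξ‖ ^ 2) ^ (t / 2) := by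
  rw [sgnSymbol, Complex.norm_cpow_of_ne_zero (sgnBase_ne_zero ε ξ)]
  simp only [Complex.ofReal_re, Complex.ofReal_im, mul_zero, Real.exp_zero, div_one]
  rw [← Real.rpow_natCast, ← Real.rpow_mul (norm_nonneg _)]
  congr 1
  push_cast
  ring

theorem norm_sgnSymbol_le {ε : ℝ} (hε : ε ^ 2 = 1) (t : ℝ) (ξ : Rd (m + 1)) :
    ‖sgnSymbol m ε t ξ‖ ≤ (2 * Real.pi) ^ |t| * (1 + ‖ξ‖ ^ 2) ^ (t / 2) := by
  obtain ⟨h1, h2⟩ := one_add_norm_sq_le_sgnBase hε ξ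
  have hpi : 1 ≤ 2 * Real.pi := by nlinarith [Real.pi_gt_three]
  rw [norm_sgnSymbol]
  rcases le_total 0 t with ht | ht
  · refine (Real.rpow_le_rpow (by positivity) h2 (by positivity)).trans_eq ?_
    rw [Real.mul_rpow (by positivity) (by positivity), ← Real.rpow_natCast,
      ← Real.rpow_mul (by positivity), abs_of_nonneg ht]
    congr 2
    push_cast
    ring
  · refine (Real.rpow_le_rpow_of_nonpos (by positivity) h1 (by linarith)).trans ?_
    exact le_mul_of_one_le_left (by positivity) (Real.one_le_rpow hpi (abs_nonneg t))

theorem kappa_le (ξ : Rd m) : kappa m ξ ≤ 2 * Real.pi * (1 + ‖ξ‖ ^ 2) ^ (1 / 2 : ℝ) := by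
  have h : kappa m ξ ^ 2 ≤ (2 * Real.pi * (1 + ‖ξ‖ ^ 2) ^ (1 / 2 : ℝ)) ^ 2 := by
    rw [kappa_sq, mul_pow, ← Real.rpow_natCast (_ ^ _), ← Real.rpow_mul (by positivity), norm_smul,
      mul_pow, Real.norm_of_nonneg (by positivity)]
    norm_num
    nlinarith [Real.pi_gt_three]
  exact le_of_sq_le_sq h (by positivity)

/-- The symbol `(2⟨ξ'⟩)^M (⟨ξ'⟩ - iξ_n)^{-M} (⟨ξ'⟩ + iξ_n)^{-1}`. -/
def liftSymbol (m M : ℕ) (ξ : Rd (m + 1)) : ℂ :=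
  (2 * (kappa m (tangential m ξ) : ℂ)) ^ M * sgnSymbol m (-1) (-M) ξ * sgnSymbol m 1 (-1) ξ

theorem hasTemperateGrowth_two_kappa_pow (M : ℕ) :
    (fun ξ : Rd m => (2 * (kappa m ξ : ℂ)) ^ M).HasTemperateGrowth := by
  have h : (fun ξ : Rd m => 2 * (kappa m ξ : ℂ)).HasTemperateGrowth :=
    (Function.HasTemperateGrowth.const (2 : ℂ)).mul
      (Function.Complex.hasTemperateGrowth_ofReal.comp hasTemperateGrowth_kappa)
  induction M with
  | zero =>
    simp only [pow_zero]
    exact Function.HasTemperateGrowth.const (1 : ℂ)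
  | succ M ih =>
    simp only [pow_succ]
    exact ih.mul h

theorem hasTemperateGrowth_two_kappa_pow_tangential (M : ℕ) :
    (fun ξ : Rd (m + 1) => (2 * (kappa m (tangential m ξ) : ℂ)) ^ M).HasTemperateGrowth :=
  (hasTemperateGrowth_two_kappa_pow M).comp (tangential m).hasTemperateGrowth

theorem hasTemperateGrowth_liftSymbol (M : ℕ) : (liftSymbol m M).HasTemperateGrowth :=
  ((hasTemperateGrowth_two_kappa_pow_tangential M).mul (hasTemperateGrowth_sgnSymbol (-1) (-M))).mul
    (hasTemperateGrowth_sgnSymbol 1 (-1))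

/-- This is the hypothesis of `layerPotential` with ρ = M + 1 - σ. The exponents then reduce to M/2
for 1 + |ξ'|² and -(M+1)/2 for 1 + |ξ|², the growth of (2⟨ξ'⟩)^M and the decay of the other two
factors. -/
theorem norm_liftSymbol_le (M : ℕ) {r σ : ℝ} (hr : r = σ - 1 / 2) (ξ : Rd (m + 1)) :
    ‖liftSymbol m M ξ‖ ≤ (2 * (2 * Real.pi)) ^ M * (2 * Real.pi) ^ |(-M : ℝ)| *
      (2 * Real.pi) ^ |(-1 : ℝ)| *
      ((1 + ‖tangential m ξ‖ ^ 2) ^ ((r + (M + 1 - σ) - 1 / 2) / 2) *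
      (1 + ‖ξ‖ ^ 2) ^ ((-(M + 1 - σ) - σ) / 2)) := by
  have h1 : ‖(2 * (kappa m (tangential m ξ) : ℂ)) ^ M‖ ≤
      (2 * (2 * Real.pi)) ^ M * (1 + ‖tangential m ξ‖ ^ 2) ^ ((M : ℝ) / 2) := by
    rw [norm_pow, norm_mul, Complex.norm_real, Real.norm_of_nonneg (kappa_pos _).le,
      Complex.norm_ofNat]
    have e : (1 + ‖tangential m ξ‖ ^ 2) ^ ((M : ℝ) / 2) =
        ((1 + ‖tangential m ξ‖ ^ 2) ^ (1 / 2 : ℝ)) ^ M := by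
      rw [← Real.rpow_natCast (_ ^ _), ← Real.rpow_mul (by positivity)]
      congr 1
      ring
    rw [e, ← mul_pow, mul_assoc]
    have := kappa_pos (tangential m ξ)
    gcongr
    exact kappa_le _
  have h2 := norm_sgnSymbol_le (ε := -1) (by norm_num) (-M) ξ
  have h3 := norm_sgnSymbol_le (ε := 1) (by norm_num) (-1) ξ
  rw [liftSymbol, norm_mul, norm_mul]
  calc _ ≤ ((2 * (2 * Real.pi)) ^ M * (1 + ‖tangential m ξ‖ ^ 2) ^ ((M : ℝ) / 2)) *
        ((2 * Real.pi) ^ |(-M : ℝ)| * (1 + ‖ξ‖ ^ 2) ^ ((-M : ℝ) / 2)) *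
        ((2 * Real.pi) ^ |(-1 : ℝ)| * (1 + ‖ξ‖ ^ 2) ^ ((-1 : ℝ) / 2)) := by gcongr
    _ = (2 * (2 * Real.pi)) ^ M * (2 * Real.pi) ^ |(-M : ℝ)| * (2 * Real.pi) ^ |(-1 : ℝ)| *
      ((1 + ‖tangential m ξ‖ ^ 2) ^ ((M : ℝ) / 2) *
        ((1 + ‖ξ‖ ^ 2) ^ ((-M : ℝ) / 2) * (1 + ‖ξ‖ ^ 2) ^ ((-1 : ℝ) / 2))) := by ring
    _ = _ := by
      rw [← Real.rpow_add (by positivity), hr]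
      congr 3 <;> ring

/-- The Poisson operator `H^{σ-1/2}(ℝ^{n-1}) → H^σ(ℝⁿ)`. -/
def lift {σ r : ℝ} (hr : r = σ - 1 / 2) :
    SobolevSpace (Rd m) r →L[ℂ] SobolevSpace (Rd (m + 1)) σ :=
  layerPotential (hasTemperateGrowth_liftSymbol ⌈σ⌉₊)
    -- With M = ⌈σ⌉ the decay of order M + 1 leaves ρ = M + 1 - σ ≥ 1, which is enough for the trace
    -- estimate.
    (by have := Nat.le_ceil σ; linarith : 1 / 2 < (⌈σ⌉₊ : ℝ) + 1 - σ)
    (norm_liftSymbol_le ⌈σ⌉₊ hr)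

theorem toDist_lift {σ r : ℝ} (hr : r = σ - 1 / 2) (ψ : SobolevSpace (Rd m) r) :
    (lift hr ψ).toDist = fourierMultiplierCLM ℂ (liftSymbol m ⌈σ⌉₊) (layer m ψ.toDist) :=
  toDist_layerPotential _ _ _ ψ

/-- `2⟨ξ'⟩ = (⟨ξ'⟩ - iξ_n) + (⟨ξ'⟩ + iξ_n)`. -/
theorem two_kappa_eq (ξ : Rd (m + 1)) :
    2 * (kappa m (tangential m ξ) : ℂ) = sgnBase m (-1) ξ + sgnBase m 1 ξ := by
  simp only [sgnBase]
  push_cast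
  ring

/-- One more factor 2⟨ξ'⟩/(⟨ξ'⟩ - iξ_n) is 1 + (⟨ξ'⟩ + iξ_n)/(⟨ξ'⟩ - iξ_n), and the second summand
cancels the factor (⟨ξ'⟩ + iξ_n)⁻¹. What is added contains only powers of the symbol of Ξ₋ and
tangential factors. -/
theorem liftSymbol_succ (M : ℕ) (ξ : Rd (m + 1)) : liftSymbol m (M + 1) ξ = liftSymbol m M ξ +
    (2 * (kappa m (tangential m ξ) : ℂ)) ^ M * sgnSymbol m (-1) (-M - 1) ξ := by
  have h1 : sgnSymbol m (-1) (-M) ξ = sgnSymbol m (-1) (-M - 1) ξ * sgnBase m (-1) ξ := by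
    rw [← sgnSymbol_one_right, ← sgnSymbol_add]; congr 1; ring
  have h2 : sgnSymbol m 1 (-1) ξ * sgnBase m 1 ξ = 1 := by
    rw [← sgnSymbol_one_right, ← sgnSymbol_add, neg_add_cancel, sgnSymbol_zero]
  have e : (-((M + 1 : ℕ) : ℝ)) = -M - 1 := by push_cast; ring
  rw [liftSymbol, liftSymbol, pow_succ, e, two_kappa_eq, h1]
  linear_combination (sgnBase m (-1) ξ + sgnBase m 1 ξ) ^ M * sgnSymbol m (-1) (-M - 1) ξ * h2

theorem isVanishingOn_upper_tangential_layer (M : ℕ) (t : ℝ) (ψ : 𝓢'(Rd m, ℂ)) :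
    IsVanishingOn (fourierMultiplierCLM ℂ (fun ξ => (2 * (kappa m (tangential m ξ) : ℂ)) ^ M *
      sgnSymbol m (-1) t ξ) (layer m ψ)) (upper m) := by
  have h := isVanishingOn_upper_tangential (hasTemperateGrowth_two_kappa_pow (m := m) M)
    (isVanishingOn_upper_sgnDOp (isVanishingOn_upper_layer ψ) t)
  rw [sgnDOp, fourierMultiplierCLM_fourierMultiplierCLM_apply (hasTemperateGrowth_sgnSymbol _ _)
    (hasTemperateGrowth_two_kappa_pow_tangential M), mul_comm] at h
  exact h

theorem isVanishingOn_add {u v : 𝓢'(Rd (m + 1), ℂ)} {s : Set (Rd (m + 1))}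
    (hu : IsVanishingOn u s) (hv : IsVanishingOn v s) : IsVanishingOn (u + v) s :=
  fun g hg => by
    change u g + v g = 0
    rw [hu g hg, hv g hg, add_zero]

theorem isVanishingOn_sub {u v : 𝓢'(Rd (m + 1), ℂ)} {s : Set (Rd (m + 1))}
    (hu : IsVanishingOn u s) (hv : IsVanishingOn v s) : IsVanishingOn (u - v) s :=
  fun g hg => by
    change u g - v g = 0
    rw [hu g hg, hv g hg, sub_zero]

/-- Each increase of M adds a power of Ξ₋, with a tangential factor, applied to a layer; this is
supported in the closed lower half-space. The decay of the symbol is thus improved without any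
change on ℝⁿ₊. -/
theorem isVanishingOn_lift_sub (M : ℕ) (ψ : 𝓢'(Rd m, ℂ)) :
    IsVanishingOn (fourierMultiplierCLM ℂ (liftSymbol m M) (layer m ψ) -
      sgnDOp m 1 (-1) (layer m ψ)) (upper m) := by
  induction M with
  | zero =>
    have : liftSymbol m 0 = sgnSymbol m 1 (-1) := by
      ext ξ
      simp [liftSymbol, sgnSymbol_zero]
    rw [this, sub_self]
    exact fun g _ => rfl
  | succ M ih =>
    have h := isVanishingOn_add ih (isVanishingOn_upper_tangential_layer M (-M - 1) ψ)
    have hq : (fun ξ => (2 * (kappa m (tangential m ξ) : ℂ)) ^ M *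
        sgnSymbol m (-1) (-M - 1) ξ).HasTemperateGrowth :=
      (hasTemperateGrowth_two_kappa_pow_tangential M).mul (hasTemperateGrowth_sgnSymbol _ _)
    rw [sub_add_eq_add_sub, ← fourierMultiplier_add (hasTemperateGrowth_liftSymbol M) hq] at h
    have e : liftSymbol m (M + 1) = _ := funext (liftSymbol_succ (m := m) M)
    rw [e]
    exact h

/-- Ξ₊ cancels the only factor that is not tangential or a power of Ξ₋. -/
theorem isVanishingOn_sgnDOp_lift (M : ℕ) (ψ : 𝓢'(Rd m, ℂ)) :
    IsVanishingOn (sgnDOp m 1 1 (fourierMultiplierCLM ℂ (liftSymbol m M) (layer m ψ)))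
      (upper m) := by
  rw [sgnDOp, fourierMultiplierCLM_fourierMultiplierCLM_apply (hasTemperateGrowth_liftSymbol M)
    (hasTemperateGrowth_sgnSymbol _ _)]
  have e : liftSymbol m M * sgnSymbol m 1 1 = fun ξ =>
      (2 * (kappa m (tangential m ξ) : ℂ)) ^ M * sgnSymbol m (-1) (-M) ξ := by
    ext ξ
    rw [Pi.mul_apply, liftSymbol, mul_assoc, ← sgnSymbol_add, neg_add_cancel, sgnSymbol_zero,
      mul_one]
  rw [e]
  exact isVanishingOn_upper_tangential_layer M _ ψ

end Layer

/-! ### `L²` functions supported in the half-space -/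

section UpperL2

variable {m : ℕ}

/-- An integrable function whose distribution vanishes on an open set vanishes there. -/
theorem ae_eq_zero_of_isVanishingOn {p : ℝ≥0∞} [Fact (1 ≤ p)]
    {f : Lp ℂ p (volume : Measure (Rd (m + 1)))} {U : Set (Rd (m + 1))} (hU : IsOpen U)
    (h : IsVanishingOn (f : 𝓢'(Rd (m + 1), ℂ)) U) : ∀ᵐ x, x ∈ U → f x = 0 := by
  refine hU.ae_eq_zero_of_integral_contDiff_smul_eq_zero
    (((Lp.memLp f).locallyIntegrable Fact.out).locallyIntegrableOn U) fun g hg hc hs => ?_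
  have hg₁ : HasCompactSupport (Complex.ofRealCLM ∘ g) := hc.comp_left rfl
  have hg₂ : ContDiff ℝ (⊤ : ℕ∞) (Complex.ofRealCLM ∘ g) := by fun_prop
  have h1 := h (hg₁.toSchwartzMap hg₂)
    ((tsupport_comp_subset (map_zero Complex.ofRealCLM) g).trans hs)
  rw [Lp.toTemperedDistribution_apply] at h1
  simpa using h1

theorem ae_normal_ne_zero : ∀ᵐ x : Rd (m + 1), normal m x ≠ 0 := by
  have hms : MeasurableSet {x : Rd (m + 1) | normal m x ≠ 0} :=
    (measurableSet_singleton (0 : ℝ)).compl.preimage (normal m).measurable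
  rw [← measurePreserving_join.map_eq,
    ae_map_iff measurePreserving_join.measurable.aemeasurable hms]
  simp only [normal_join]
  have h := (Measure.quasiMeasurePreserving_fst (μ := (volume : Measure ℝ))
    (ν := (volume : Measure (Rd m)))).ae (p := fun y => y ≠ 0)
    (by simp [ae_iff, measure_singleton])
  exact h

theorem lp_eq_zero_of_isVanishingOn {f : Lp ℂ 2 (volume : Measure (Rd (m + 1)))}
    (hu : IsVanishingOn (f : 𝓢'(Rd (m + 1), ℂ)) (upper m))
    (hl : IsVanishingOn (f : 𝓢'(Rd (m + 1), ℂ)) (lower m)) : f = 0 := by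
  rw [Lp.eq_zero_iff_ae_eq_zero]
  filter_upwards [ae_eq_zero_of_isVanishingOn isOpen_upper hu,
    ae_eq_zero_of_isVanishingOn isOpen_lower hl, ae_normal_ne_zero] with x h1 h2 h3
  rcases h3.lt_or_gt with h | h
  · exact h2 h
  · exact h1 h

/-- The `L²` functions supported in the closed upper half-space. -/
def upperL2 (m : ℕ) : Submodule ℂ (Lp ℂ 2 (volume : Measure (Rd (m + 1)))) where
  carrier := {f | IsVanishingOn (f : 𝓢'(Rd (m + 1), ℂ)) (lower m)}
  add_mem' {f g} hf hg := by
    rw [Set.mem_ofPred_eq, lp_toDist_add]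
    exact isVanishingOn_add hf hg
  zero_mem' g _ := by
    change (Lp.toTemperedDistributionCLM ℂ volume 2 0) g = 0
    rw [map_zero]
    rfl
  smul_mem' c f hf g hg := by
    rw [lp_toDist_smul]
    change c • ((f : 𝓢'(Rd (m + 1), ℂ)) g) = 0
    rw [hf g hg, smul_zero]

theorem mem_upperL2 {f : Lp ℂ 2 (volume : Measure (Rd (m + 1)))} :
    f ∈ upperL2 m ↔ IsVanishingOn (f : 𝓢'(Rd (m + 1), ℂ)) (lower m) := Iff.rfl

theorem isClosed_upperL2 : IsClosed (upperL2 m : Set (Lp ℂ 2 (volume : Measure (Rd (m + 1))))) := by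
  have : (upperL2 m : Set (Lp ℂ 2 (volume : Measure (Rd (m + 1))))) =
      ⋂ (χ : 𝓢(Rd (m + 1), ℂ)) (_ : tsupport χ ⊆ lower m),
        {f : Lp ℂ 2 (volume : Measure (Rd (m + 1))) | (f : 𝓢'(Rd (m + 1), ℂ)) χ = 0} := by
    ext f
    simp only [Set.mem_iInter, SetLike.mem_coe, mem_upperL2]
    rfl
  rw [this]
  exact isClosed_iInter fun χ => isClosed_iInter fun _ =>
    isClosed_eq (continuous_lp_apply χ) continuous_const

instance : CompleteSpace (upperL2 m) := isClosed_upperL2.completeSpace_coe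

/-- The orthogonal projection onto `upperL2` does not change f on ℝⁿ₊, since the conjugate of a test
function supported there belongs to the subspace and is orthogonal to the error. -/
theorem isVanishingOn_sub_starProjection (f : Lp ℂ 2 (volume : Measure (Rd (m + 1)))) :
    IsVanishingOn ((f : 𝓢'(Rd (m + 1), ℂ)) -
      (((upperL2 m).starProjection f : Lp ℂ 2 (volume : Measure (Rd (m + 1)))) :
        𝓢'(Rd (m + 1), ℂ))) (upper m) := by
  intro χ hχ
  have hmem : star (χ.toLp 2 (volume : Measure (Rd (m + 1)))) ∈ upperL2 m := by
    rw [mem_upperL2, isVanishingOn_lower_iff]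
    intro φ hφ
    rw [Lp.toTemperedDistribution_apply]
    refine integral_eq_zero_of_ae ?_
    filter_upwards [Lp.coeFn_star (χ.toLp 2 (volume : Measure (Rd (m + 1)))), χ.coeFn_toLp 2 volume] with x h1 h2
    rw [h1, Pi.star_apply, h2, Pi.zero_apply]
    rcases le_or_gt (normal m x) 0 with h | h
    · have : χ x = 0 := by
        by_contra hne
        exact absurd (hχ (subset_tsupport _ hne) : 0 < normal m x) (not_lt.mpr h)
      rw [this, star_zero, smul_zero]
    · rw [hφ x h, zero_smul]
  have h := Submodule.starProjection_inner_eq_zero (K := upperL2 m) f _ hmem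
  have e : ((f - (upperL2 m).starProjection f : Lp ℂ 2 (volume : Measure (Rd (m + 1)))) :
      𝓢'(Rd (m + 1), ℂ)) = (f : 𝓢'(Rd (m + 1), ℂ)) -
      (((upperL2 m).starProjection f : Lp ℂ 2 (volume : Measure (Rd (m + 1)))) :
        𝓢'(Rd (m + 1), ℂ)) :=
    map_sub (Lp.toTemperedDistributionCLM ℂ volume 2) _ _
  rw [← e, Lp.toTemperedDistribution_apply]
  rw [← inner_conj_symm, map_eq_zero, L2.inner_def] at h
  rw [← h]
  refine integral_congr_ae ?_
  filter_upwards [Lp.coeFn_star (χ.toLp 2 (volume : Measure (Rd (m + 1)))), χ.coeFn_toLp 2 volume] with x h1 h2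
  rw [h1, Pi.star_apply, h2]
  simp [mul_comm]

theorem starProjection_eq_zero {f : Lp ℂ 2 (volume : Measure (Rd (m + 1)))}
    (hf : IsVanishingOn (f : 𝓢'(Rd (m + 1), ℂ)) (upper m)) :
    (upperL2 m).starProjection f = 0 := by
  refine lp_eq_zero_of_isVanishingOn ?_ ?_
  · have h := isVanishingOn_sub hf (isVanishingOn_sub_starProjection f)
    rwa [sub_sub_cancel] at h
  · exact mem_upperL2.mp (Submodule.starProjection_apply_mem _ f)

end UpperL2

/-! ### The Toeplitz operator -/

/-- If `1 - cM` is a strict contraction, the compression of `M` to a closed subspace is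
invertible. -/
theorem exists_compression_inverse {H : Type*} [NormedAddCommGroup H] [InnerProductSpace ℂ H]
    (K : Submodule ℂ H) [CompleteSpace K] (M : H →L[ℂ] H) {c : ℂ} {q : ℝ} (hq : q < 1)
    (hq0 : 0 ≤ q) (hM : ∀ x, ‖x - c • M x‖ ≤ q * ‖x‖) :
    ∃ S : H →L[ℂ] H, (∀ g, S g ∈ K) ∧
      (∀ g, K.starProjection (M (S g)) = K.starProjection g) ∧
      ∀ l ∈ K, K.starProjection (M l) = 0 → l = 0 := by
  set T : K →L[ℂ] K := K.orthogonalProjectionOnto ∘L M ∘L K.subtypeL with hT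
  -- On K the identity minus cT is the compression of 1 - cM, so it is still a strict contraction
  -- and cT is invertible by a Neumann series.
  have hX : ‖1 - c • T‖ < 1 := by
    refine lt_of_le_of_lt (ContinuousLinearMap.opNorm_le_bound _ hq0
      fun l => ?_) hq
    have h3 : (((1 - c • T) l : K) : H) = K.starProjection ((l : H) - c • M (l : H)) := by
      change (l : H) - c • K.starProjection (M l) = K.starProjection ((l : H) - c • M l)
      rw [map_sub, map_smul, (Submodule.starProjection_eq_self_iff).mpr l.2]
    rw [Submodule.coe_norm, h3]
    exact (Submodule.norm_starProjection_apply_le _ _).trans (hM l)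
  have hu : IsUnit (c • T) := by
    have := (Units.oneSub (1 - c • T) hX).isUnit
    rwa [Units.val_oneSub, sub_sub_cancel] at this
  obtain ⟨U, hU⟩ := hu
  have h1 : ∀ l : K, U.val ((U⁻¹).val l) = l := fun l =>
    congrArg (fun A : K →L[ℂ] K => A l) U.mul_inv
  have h2 : ∀ l : K, (U⁻¹).val (U.val l) = l := fun l =>
    congrArg (fun A : K →L[ℂ] K => A l) U.inv_mul
  refine ⟨K.subtypeL ∘L (c • (U⁻¹).val) ∘L K.orthogonalProjectionOnto, fun g => Subtype.prop _,
    fun g => ?_, fun l hl h => ?_⟩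
  · have h := h1 (K.orthogonalProjectionOnto g)
    rw [hU] at h
    have h' : T (c • (U⁻¹).val (K.orthogonalProjectionOnto g)) = K.orthogonalProjectionOnto g := by
      rw [map_smul]
      exact h
    exact congrArg Subtype.val h'
  · have h3 : U.val ⟨l, hl⟩ = 0 := by
      rw [hU]
      apply Subtype.ext
      change c • K.starProjection (M l) = 0
      rw [h, smul_zero]
    have h4 := h2 ⟨l, hl⟩
    rw [h3, map_zero] at h4
    exact (congrArg Subtype.val h4).symm

section Toeplitz

variable {m : ℕ} {s : ℝ}

/-- The symbol `(⟨ξ'⟩ - iξ_n)^s (⟨ξ'⟩ + iξ_n)^{-s}`, of absolute value one. -/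
def phaseSymbol (m : ℕ) (s : ℝ) (ξ : Rd (m + 1)) : ℂ :=
  sgnSymbol m (-1) s ξ * sgnSymbol m 1 (-s) ξ

theorem hasTemperateGrowth_phaseSymbol (s : ℝ) : (phaseSymbol m s).HasTemperateGrowth :=
  (hasTemperateGrowth_sgnSymbol _ _).mul (hasTemperateGrowth_sgnSymbol _ _)

/-- The bases ⟨ξ'⟩ ± iξ_n are conjugate to each other and lie off the cut of the logarithm, so
moduli cancel and arguments double. -/
theorem phaseSymbol_eq (s : ℝ) (ξ : Rd (m + 1)) : phaseSymbol m s ξ =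
    Complex.exp (((-(2 * s * (sgnBase m 1 ξ).arg) : ℝ) : ℂ) * Complex.I) := by
  have h0 : 0 < (sgnBase m 1 ξ).re := one_pos.trans_le (one_le_re_sgnBase 1 ξ)
  have hconj : sgnBase m (-1) ξ = (starRingEnd ℂ) (sgnBase m 1 ξ) := by
    apply Complex.ext
    · rw [Complex.conj_re, re_sgnBase, re_sgnBase]
    · rw [Complex.conj_im, im_sgnBase, im_sgnBase]; ring
  have harg : (sgnBase m 1 ξ).arg ≠ Real.pi := fun h => by
    have := Complex.arg_eq_pi_iff.mp h
    linarith [this.1]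
  have hlog : Complex.log (sgnBase m (-1) ξ) - Complex.log (sgnBase m 1 ξ) =
      ((-(2 * (sgnBase m 1 ξ).arg) : ℝ) : ℂ) * Complex.I := by
    rw [hconj, Complex.log_conj _ harg]
    apply Complex.ext
    · simp
    · simp [Complex.log_im]; ring
  rw [phaseSymbol, sgnSymbol, sgnSymbol, Complex.cpow_def_of_ne_zero (sgnBase_ne_zero _ _),
    Complex.cpow_def_of_ne_zero (sgnBase_ne_zero _ _), ← Complex.exp_add]
  congr 1
  have := congrArg (fun z => z * (s : ℂ)) hlog
  push_cast at this ⊢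
  linear_combination this

theorem norm_phaseSymbol (s : ℝ) (ξ : Rd (m + 1)) : ‖phaseSymbol m s ξ‖ = 1 := by
  rw [phaseSymbol_eq, Complex.norm_exp_ofReal_mul_I]

/-- The argument of ⟨ξ'⟩ + iξ_n is below π/2 in absolute value, so the phase 2s·arg stays within
|s|π < π/2. This is where the bound |s| < 1/2 matters. -/
theorem cos_le_re_phaseSymbol (hs : |s| < 1 / 2) (ξ : Rd (m + 1)) :
    Real.cos (s * Real.pi) ≤ (phaseSymbol m s ξ).re := by
  have h0 : 0 < (sgnBase m 1 ξ).re := one_pos.trans_le (one_le_re_sgnBase 1 ξ)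
  have harg : |(sgnBase m 1 ξ).arg| < Real.pi / 2 :=
    Complex.abs_arg_lt_pi_div_two_iff.mpr (Or.inl h0)
  rw [phaseSymbol_eq, Complex.exp_ofReal_mul_I_re, Real.cos_neg, ← Real.cos_abs,
    ← Real.cos_abs (2 * s * _)]
  have hpi := Real.pi_pos
  refine Real.cos_le_cos_of_nonneg_of_le_pi (abs_nonneg _) ?_ ?_
  · rw [abs_mul, abs_of_pos hpi]
    nlinarith
  · rw [abs_mul, abs_mul, abs_mul, abs_of_pos hpi, abs_two]
    nlinarith [abs_nonneg s]

theorem cos_pos_of_abs_lt (hs : |s| < 1 / 2) : 0 < Real.cos (s * Real.pi) := by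
  have hpi := Real.pi_pos
  obtain ⟨h1, h2⟩ := abs_lt.mp hs
  exact Real.cos_pos_of_mem_Ioo ⟨by nlinarith, by nlinarith⟩

/-- For unimodular p with Re p ≥ c = cos(πs) > 0, |1 - cp|² = 1 - 2c Re p + c² ≤ 1 - c². -/
theorem norm_one_sub_phaseSymbol_le (hs : |s| < 1 / 2) (ξ : Rd (m + 1)) :
    ‖1 + (-(Real.cos (s * Real.pi) : ℂ)) * phaseSymbol m s ξ‖ ≤
      Real.sqrt (1 - Real.cos (s * Real.pi) ^ 2) := by
  refine Real.le_sqrt_of_sq_le ?_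
  have h1 := cos_le_re_phaseSymbol (m := m) hs ξ
  have h2 : (phaseSymbol m s ξ).re ^ 2 + (phaseSymbol m s ξ).im ^ 2 = 1 := by
    have := norm_phaseSymbol s ξ
    rw [← Complex.normSq_add_mul_I, Complex.re_add_im, Complex.normSq_eq_norm_sq, this]
    norm_num
  have h3 := cos_pos_of_abs_lt hs
  rw [Complex.sq_norm, Complex.normSq_apply]
  simp only [Complex.add_re, Complex.one_re, Complex.mul_re, Complex.neg_re, Complex.ofReal_re,
    Complex.neg_im, Complex.ofReal_im, neg_zero, zero_mul, sub_zero, Complex.add_im,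
    Complex.one_im, Complex.mul_im, zero_add, add_zero]
  nlinarith

theorem norm_phaseSymbol_le (s : ℝ) (ξ : Rd (m + 1)) : ‖phaseSymbol m s ξ‖ ≤ 1 :=
  (norm_phaseSymbol s ξ).le

theorem hasTemperateGrowth_const_mul_phaseSymbol (c : ℂ) (s : ℝ) :
    (fun ξ : Rd (m + 1) => c * phaseSymbol m s ξ).HasTemperateGrowth :=
  (Function.HasTemperateGrowth.const c).mul (hasTemperateGrowth_phaseSymbol s)

/-- The operator in `L²` with symbol `phaseSymbol`. -/
def phaseOp (m : ℕ) (s : ℝ) :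
    Lp ℂ 2 (volume : Measure (Rd (m + 1))) →L[ℂ] Lp ℂ 2 (volume : Measure (Rd (m + 1))) :=
  l2Mult (hasTemperateGrowth_phaseSymbol s) (norm_phaseSymbol_le s)

theorem phaseOp_toDist (s : ℝ) (f : Lp ℂ 2 (volume : Measure (Rd (m + 1)))) :
    ((phaseOp m s f : Lp ℂ 2 (volume : Measure (Rd (m + 1)))) : 𝓢'(Rd (m + 1), ℂ)) =
      sgnDOp m (-1) s (sgnDOp m 1 (-s) (f : 𝓢'(Rd (m + 1), ℂ))) := by
  rw [phaseOp, l2Mult_toDist, sgnDOp, sgnDOp, fourierMultiplierCLM_fourierMultiplierCLM_apply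
    (hasTemperateGrowth_sgnSymbol _ _) (hasTemperateGrowth_sgnSymbol _ _), mul_comm]
  rfl

theorem norm_sub_phaseOp_le (hs : |s| < 1 / 2)
    (f : Lp ℂ 2 (volume : Measure (Rd (m + 1)))) :
    ‖f - (Real.cos (s * Real.pi) : ℂ) • phaseOp m s f‖ ≤
      Real.sqrt (1 - Real.cos (s * Real.pi) ^ 2) * ‖f‖ := by
  set c : ℝ := Real.cos (s * Real.pi) with hc
  have hp : (fun ξ : Rd (m + 1) => 1 + (-(c : ℂ)) * phaseSymbol m s ξ).HasTemperateGrowth :=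
    (Function.HasTemperateGrowth.const (1 : ℂ)).add (hasTemperateGrowth_const_mul_phaseSymbol _ s)
  have h1 : f - (c : ℂ) • phaseOp m s f = l2Mult hp (norm_one_sub_phaseSymbol_le hs) f := by
    apply lp_toDist_injective
    rw [l2Mult_toDist, fourierMultiplier_add (Function.HasTemperateGrowth.const (1 : ℂ))
      (hasTemperateGrowth_const_mul_phaseSymbol _ s), sub_eq_add_neg, ← neg_smul, lp_toDist_add,
      lp_toDist_smul, phaseOp, l2Mult_toDist]
    have h2 := congrArg (fun A => A (f : 𝓢'(Rd (m + 1), ℂ)))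
      (fourierMultiplierCLM_smul (F := ℂ) (hasTemperateGrowth_phaseSymbol (m := m) s) (-(c : ℂ)))
    congr 1
    · simp
    · exact h2.symm
  rw [h1]
  exact (ContinuousLinearMap.le_opNorm _ _).trans
    (mul_le_mul_of_nonneg_right (norm_l2Mult_le _ _) (norm_nonneg _))

theorem sqrt_one_sub_cos_sq_lt (hs : |s| < 1 / 2) :
    Real.sqrt (1 - Real.cos (s * Real.pi) ^ 2) < 1 := by
  rw [Real.sqrt_lt' one_pos]
  nlinarith [cos_pos_of_abs_lt hs]

end Toeplitz

/-! ### Truncation to the half-space for `-1/2 < s ≤ 0` -/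

section Truncation

variable {m : ℕ}

theorem norm_sgnSymbol_mul_le {ε : ℝ} (hε : ε ^ 2 = 1) {s s' t : ℝ} (h : s' = s - t)
    (ξ : Rd (m + 1)) :
    ‖sgnSymbol m ε t ξ‖ * (1 + ‖ξ‖ ^ 2) ^ ((s' - s) / 2) ≤ (2 * Real.pi) ^ |t| := by
  calc _ ≤ (2 * Real.pi) ^ |t| * (1 + ‖ξ‖ ^ 2) ^ (t / 2) * (1 + ‖ξ‖ ^ 2) ^ ((s' - s) / 2) := by
        gcongr; exact norm_sgnSymbol_le hε t ξ
    _ = _ := by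
        rw [mul_assoc, ← Real.rpow_add (by positivity), h]
        ring_nf
        simp

/-- `Op((⟨ξ'⟩ + iεξ_n)^t) : H^s → H^{s-t}`. -/
def sgnMap {ε : ℝ} (hε : ε ^ 2 = 1) {s s' t : ℝ} (h : s' = s - t) :
    SobolevSpace (Rd (m + 1)) s →L[ℂ] SobolevSpace (Rd (m + 1)) s' :=
  SobolevSpace.mult (hasTemperateGrowth_sgnSymbol ε t) (norm_sgnSymbol_mul_le hε h)

@[simp]
theorem toDist_sgnMap {ε : ℝ} (hε : ε ^ 2 = 1) {s s' t : ℝ} (h : s' = s - t)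
    (u : SobolevSpace (Rd (m + 1)) s) : (sgnMap hε h u).toDist = sgnDOp m ε t u.toDist :=
  SobolevSpace.toDist_mult _ _ u

theorem toDist_equivL2_zero (u : SobolevSpace (Rd (m + 1)) 0) :
    ((SobolevSpace.equivL2 0 u : Lp ℂ 2 (volume : Measure (Rd (m + 1)))) :
      𝓢'(Rd (m + 1), ℂ)) = u.toDist := by
  rw [SobolevSpace.equivL2_toDist, besselPotential_zero]
  rfl

theorem toDist_equivL2_zero_symm (f : Lp ℂ 2 (volume : Measure (Rd (m + 1)))) :
    ((SobolevSpace.equivL2 0).symm f).toDist = (f : 𝓢'(Rd (m + 1), ℂ)) := by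
  rw [SobolevSpace.toDist_equivL2_symm, neg_zero, besselPotential_zero]
  rfl

theorem exists_toeplitz_inverse {s : ℝ} (hs : |s| < 1 / 2) :
    ∃ S : Lp ℂ 2 (volume : Measure (Rd (m + 1))) →L[ℂ] Lp ℂ 2 (volume : Measure (Rd (m + 1))),
      (∀ g, S g ∈ upperL2 m) ∧
      (∀ g, (upperL2 m).starProjection (phaseOp m s (S g)) = (upperL2 m).starProjection g) ∧
      ∀ l ∈ upperL2 m, (upperL2 m).starProjection (phaseOp m s l) = 0 → l = 0 :=
  exists_compression_inverse (upperL2 m) (phaseOp m s) (sqrt_one_sub_cos_sq_lt hs)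
    (Real.sqrt_nonneg _) (norm_sub_phaseOp_le hs)

/-- An element of `H^s`, `|s| < 1/2`, supported in the hyperplane is zero. -/
theorem toDist_eq_zero_of_isVanishingOn {s : ℝ} (hs : |s| < 1 / 2)
    {F : SobolevSpace (Rd (m + 1)) s} (hl : IsVanishingOn F.toDist (lower m))
    (hu : IsVanishingOn F.toDist (upper m)) : F = 0 := by
  obtain ⟨S, -, -, hS⟩ := exists_toeplitz_inverse (m := m) hs
  obtain ⟨l, hlD⟩ : ∃ l : Lp ℂ 2 (volume : Measure (Rd (m + 1))),
      (l : 𝓢'(Rd (m + 1), ℂ)) = sgnDOp m 1 s F.toDist :=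
    ⟨SobolevSpace.equivL2 0 (sgnMap (s' := 0) (t := s) (ε := 1) (by norm_num) (by ring) F), by
      rw [toDist_equivL2_zero, toDist_sgnMap]⟩
  have hlm : l ∈ upperL2 m := by
    rw [mem_upperL2, hlD]
    exact isVanishingOn_lower_sgnDOp hl s
  have h2 : l = 0 := by
    -- Here l = Ξ₊^s F, and the phase operator turns it into Ξ₋^s F, which is supported in the
    -- closed lower half-space and hence projects to zero.
    refine hS l hlm (starProjection_eq_zero ?_)
    rw [phaseOp_toDist, hlD, sgnDOp_sgnDOp, neg_add_cancel, sgnDOp_zero]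
    exact isVanishingOn_upper_sgnDOp hu s
  have h4 : sgnDOp m 1 s F.toDist = 0 := by
    rw [← hlD, h2]
    exact map_zero (Lp.toTemperedDistributionCLM ℂ volume 2)
  apply SobolevSpace.toDist_injective
  have h5 := congrArg (sgnDOp m 1 (-s)) h4
  rw [sgnDOp_sgnDOp, neg_add_cancel, sgnDOp_zero, map_zero] at h5
  rw [h5, map_zero]

/-- The operator is Ξ₊^{-s} S Ξ₋^s with S the inverse of the Wiener–Hopf compression. Its range is
supported in the closed upper half-space because S maps into `upperL2`. With g = Ξ₋^s G, the
difference Ξ₋^s Ξ₊^{-s} S g - g vanishes on ℝⁿ₊, and Ξ₋^{-s} preserves this. -/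
theorem exists_truncation {s : ℝ} (hs : |s| < 1 / 2) :
    ∃ A : SobolevSpace (Rd (m + 1)) s →L[ℂ] SobolevSpace (Rd (m + 1)) s, ∀ G,
      IsVanishingOn (A G).toDist (lower m) ∧
        IsVanishingOn ((A G).toDist - G.toDist) (upper m) := by
  obtain ⟨S, hS1, hS2, -⟩ := exists_toeplitz_inverse (m := m) hs
  refine ⟨sgnMap (s := 0) (s' := s) (t := -s) (ε := 1) (by norm_num) (by ring) ∘L
    ((SobolevSpace.equivL2 (E := Rd (m + 1)) 0).symm.toContinuousLinearEquiv :
      Lp ℂ 2 (volume : Measure (Rd (m + 1))) →L[ℂ] _) ∘L S ∘L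
    ((SobolevSpace.equivL2 (E := Rd (m + 1)) 0).toContinuousLinearEquiv :
      SobolevSpace (Rd (m + 1)) 0 →L[ℂ] _) ∘L
    sgnMap (s := s) (s' := 0) (t := s) (ε := -1) (by norm_num) (by ring), fun G => ?_⟩
  obtain ⟨g, hgdef⟩ : ∃ g : Lp ℂ 2 (volume : Measure (Rd (m + 1))), g = SobolevSpace.equivL2 0
    (sgnMap (s := s) (s' := 0) (t := s) (ε := -1) (by norm_num) (by ring) G) := ⟨_, rfl⟩
  have hg : (g : 𝓢'(Rd (m + 1), ℂ)) = sgnDOp m (-1) s G.toDist := by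
    rw [hgdef, toDist_equivL2_zero, toDist_sgnMap]
  have hF : ∀ F : SobolevSpace (Rd (m + 1)) s, F = sgnMap (s := 0) (s' := s) (t := -s) (ε := 1)
      (by norm_num) (by ring) ((SobolevSpace.equivL2 0).symm (S g)) →
      F.toDist = sgnDOp m 1 (-s) ((S g : Lp ℂ 2 (volume : Measure (Rd (m + 1)))) :
        𝓢'(Rd (m + 1), ℂ)) := by
    intro F hF
    rw [hF, toDist_sgnMap, toDist_equivL2_zero_symm]
  generalize hFdef : (_ : SobolevSpace (Rd (m + 1)) s →L[ℂ] SobolevSpace (Rd (m + 1)) s) G = F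
  have hF' := hF F (by rw [hgdef, ← hFdef]; rfl)
  refine ⟨?_, ?_⟩
  · rw [hF']
    exact isVanishingOn_lower_sgnDOp (mem_upperL2.mp (hS1 g)) _
  · have h1 : IsVanishingOn (((phaseOp m s (S g) : Lp ℂ 2 (volume : Measure (Rd (m + 1)))) :
        𝓢'(Rd (m + 1), ℂ)) - (g : 𝓢'(Rd (m + 1), ℂ))) (upper m) := by
      have h2 := isVanishingOn_sub (isVanishingOn_sub_starProjection (phaseOp m s (S g)))
        (isVanishingOn_sub_starProjection g)
      rwa [hS2, sub_sub_sub_cancel_right] at h2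
    rw [phaseOp_toDist, ← hF', hg, ← map_sub] at h1
    have h4 := isVanishingOn_upper_sgnDOp h1 (-s)
    rwa [sgnDOp_sgnDOp, neg_add_cancel, sgnDOp_zero] at h4

open Classical in
/-- For `|s| < 1/2`, the map that sends `G ∈ H^s` to the element of `H^s` supported in the closed
half-space which agrees with `G` on the open one. -/
def truncation (m : ℕ) (s : ℝ) :
    SobolevSpace (Rd (m + 1)) s →L[ℂ] SobolevSpace (Rd (m + 1)) s :=
  if hs : |s| < 1 / 2 then (exists_truncation hs).choose else 0

theorem isVanishingOn_lower_truncation {s : ℝ} (hs : |s| < 1 / 2)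
    (G : SobolevSpace (Rd (m + 1)) s) : IsVanishingOn (truncation m s G).toDist (lower m) := by
  rw [truncation, dif_pos hs]
  exact ((exists_truncation hs).choose_spec G).1

theorem isVanishingOn_upper_truncation_sub {s : ℝ} (hs : |s| < 1 / 2)
    (G : SobolevSpace (Rd (m + 1)) s) :
    IsVanishingOn ((truncation m s G).toDist - G.toDist) (upper m) := by
  rw [truncation, dif_pos hs]
  exact ((exists_truncation hs).choose_spec G).2

theorem eq_truncation {s : ℝ} (hs : |s| < 1 / 2) {F G : SobolevSpace (Rd (m + 1)) s}
    (hl : IsVanishingOn F.toDist (lower m))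
    (hu : IsVanishingOn (F.toDist - G.toDist) (upper m)) : F = truncation m s G := by
  rw [← sub_eq_zero]
  refine toDist_eq_zero_of_isVanishingOn hs ?_ ?_
  · rw [map_sub]
    exact isVanishingOn_sub hl (isVanishingOn_lower_truncation hs G)
  · have h := isVanishingOn_sub hu (isVanishingOn_upper_truncation_sub hs G)
    rwa [sub_sub_sub_cancel_right, ← map_sub] at h

theorem truncation_eq_zero {s : ℝ} (hs : |s| < 1 / 2) {G : SobolevSpace (Rd (m + 1)) s}
    (hu : IsVanishingOn G.toDist (upper m)) : truncation m s G = 0 := by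
  refine (eq_truncation hs ?_ ?_).symm
  · rw [map_zero]; exact fun _ _ => rfl
  · rw [map_zero, zero_sub]
    intro g hg
    change -(G.toDist g) = 0
    rw [hu g hg, neg_zero]

end Truncation

/-! ### Integrals over the fibres of the normal coordinate -/

section Fiber

variable {m : ℕ}

/-- `∫ Φ(x', y) dx'`. -/
def fiberInt (Φ : 𝓢(Rd (m + 1), ℂ)) (y : ℝ) : ℂ := ∫ x : Rd m, Φ (join x y)

theorem integrable_tangential_decay : Integrable fun x : Rd m => ((1 + ‖x‖) ^ (m + 1))⁻¹ := by
  have h := integrable_one_add_norm (E := Rd m) (μ := volume) (r := (m + 1 : ℕ)) (by simp)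
  refine h.congr (Eventually.of_forall fun x => ?_)
  simp only
  rw [Real.rpow_neg (by positivity), Real.rpow_natCast]

theorem integrable_slice (Φ : 𝓢(Rd (m + 1), ℂ)) (y : ℝ) :
    Integrable fun x : Rd m => Φ (join x y) := by
  have h := (slice y Φ).integrable (μ := (volume : Measure (Rd m)))
  exact h.congr (Eventually.of_forall fun x => slice_apply y Φ x)

theorem fiberInt_add (Φ Ψ : 𝓢(Rd (m + 1), ℂ)) (y : ℝ) :
    fiberInt (Φ + Ψ) y = fiberInt Φ y + fiberInt Ψ y :=
  integral_add (integrable_slice Φ y) (integrable_slice Ψ y)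

theorem fiberInt_sub (Φ Ψ : 𝓢(Rd (m + 1), ℂ)) (y : ℝ) :
    fiberInt (Φ - Ψ) y = fiberInt Φ y - fiberInt Ψ y :=
  integral_sub (integrable_slice Φ y) (integrable_slice Ψ y)

theorem exists_fiberInt_decay (Φ : 𝓢(Rd (m + 1), ℂ)) (l : ℕ) : ∃ C, 0 ≤ C ∧ ∀ y,
    ∫ x : Rd m, ‖Φ (join x y)‖ ≤ C * ((1 + |y|) ^ l)⁻¹ := by
  obtain ⟨C, hC0, hC⟩ := exists_decay Φ (m + 1) l
  refine ⟨C * ∫ x : Rd m, ((1 + ‖x‖) ^ (m + 1))⁻¹,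
    mul_nonneg hC0 (integral_nonneg fun x => by positivity), fun y => ?_⟩
  rw [mul_right_comm, ← integral_const_mul]
  refine integral_mono (integrable_slice Φ y).norm (integrable_tangential_decay.const_mul _)
    fun x => ?_
  refine (hC (join x y)).trans_eq ?_
  rw [tangential_join, normal_join]
  ring

theorem norm_fiberInt_le (Φ : 𝓢(Rd (m + 1), ℂ)) (y : ℝ) :
    ‖fiberInt Φ y‖ ≤ ∫ x : Rd m, ‖Φ (join x y)‖ := norm_integral_le_integral_norm _

open LineDeriv in
theorem hasDerivAt_fiberInt (Φ : 𝓢(Rd (m + 1), ℂ)) (y : ℝ) :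
    HasDerivAt (fiberInt Φ) (fiberInt (∂_{normalVec m} Φ) y) y := by
  obtain ⟨C, hC0, hC⟩ := exists_decay (∂_{normalVec m} Φ) (m + 1) 0
  refine (hasDerivAt_integral_of_dominated_loc_of_deriv_le (μ := (volume : Measure (Rd m)))
    (F := fun y x => Φ (join x y)) (F' := fun y x => (∂_{normalVec m} Φ) (join x y))
    (s := Set.univ) (bound := fun x => C * ((1 + ‖x‖) ^ (m + 1))⁻¹) univ_mem
    (Eventually.of_forall fun z => (integrable_slice Φ z).1) (integrable_slice Φ y)
    (integrable_slice _ y).1 (Eventually.of_forall fun x z _ => ?_)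
    (integrable_tangential_decay.const_mul C) (Eventually.of_forall fun x z _ => ?_)).2
  · simpa using hC (join x z)
  · rw [SchwartzMap.lineDerivOp_apply_eq_fderiv]
    have h1 : HasFDerivAt Φ (fderiv ℝ Φ (join x z)) (join x z) :=
      (Φ.differentiable _).hasFDerivAt
    have h2 : HasDerivAt (fun z : ℝ => join x z) (normalVec m) z := by
      have h3 := ((hasDerivAt_id' z).smul_const (normalVec m)).const_add (boundary m x)
      rwa [one_smul] at h3
    exact h1.comp_hasDerivAt z h2

theorem continuous_fiberInt (Φ : 𝓢(Rd (m + 1), ℂ)) : Continuous (fiberInt Φ) :=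
  continuous_iff_continuousAt.mpr fun y => (hasDerivAt_fiberInt Φ y).continuousAt

theorem integrableOn_rpow_mul_decay {b : ℝ} (hb : -1 < b) {l : ℕ} (hl : b + 1 < l) :
    IntegrableOn (fun y : ℝ => y ^ b * ((1 + |y|) ^ l)⁻¹) (Set.Ioi 0) := by
  have hm : Measurable fun y : ℝ => y ^ b * ((1 + |y|) ^ l)⁻¹ := by fun_prop
  rw [← Set.Ioc_union_Ioi_eq_Ioi (zero_le_one' ℝ)]
  refine IntegrableOn.union ?_ ?_
  · have h := (intervalIntegral.intervalIntegrable_rpow' (a := 0) (b := 1) hb).1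
    refine h.mono' hm.aestronglyMeasurable ?_
    filter_upwards [ae_restrict_mem measurableSet_Ioc] with y hy
    have hy0 : 0 < y := hy.1
    rw [Real.norm_of_nonneg (by positivity)]
    refine mul_le_of_le_one_right (by positivity) (inv_le_one_of_one_le₀ ?_)
    exact one_le_pow₀ (by linarith [abs_nonneg y])
  · have h := integrableOn_Ioi_rpow_of_lt (a := b - l) (c := 1) (by linarith) one_pos
    refine h.mono' hm.aestronglyMeasurable ?_
    filter_upwards [ae_restrict_mem measurableSet_Ioi] with y hy
    have hy0 : 0 < y := one_pos.trans hy
    rw [Real.norm_of_nonneg (by positivity), Real.rpow_sub hy0, Real.rpow_natCast, div_eq_mul_inv]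
    gcongr
    rw [abs_of_pos hy0]
    linarith

theorem integrableOn_rpow_mul_fiberInt {b : ℝ} (hb : -1 < b) (Φ : 𝓢(Rd (m + 1), ℂ)) :
    IntegrableOn (fun y : ℝ => ((y ^ b : ℝ) : ℂ) * fiberInt Φ y) (Set.Ioi 0) := by
  obtain ⟨l, hl⟩ := exists_nat_gt (b + 1)
  obtain ⟨C, hC0, hC⟩ := exists_fiberInt_decay Φ l
  refine ((integrableOn_rpow_mul_decay hb hl).const_mul C).mono' ?_ ?_
  · have := (continuous_fiberInt Φ).measurable
    exact Measurable.aestronglyMeasurable (by fun_prop)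
  · filter_upwards [ae_restrict_mem measurableSet_Ioi] with y hy
    have hy0 : 0 < y := hy
    rw [norm_mul, Complex.norm_real, Real.norm_of_nonneg (by positivity), mul_left_comm]
    gcongr
    exact (norm_fiberInt_le Φ y).trans (hC y)

theorem integrableOn_rpow_mul {b : ℝ} (hb : -1 < b) (φ : 𝓢(Rd (m + 1), ℂ)) :
    IntegrableOn (fun x => ((normal m x ^ b : ℝ) : ℂ) * φ x) (upper m) := by
  obtain ⟨l, hl⟩ := exists_nat_gt (b + 1)
  obtain ⟨C, hC0, hC⟩ := exists_decay φ (m + 1) l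
  have hms : MeasurableSet (upper m) := isOpen_upper.measurableSet
  rw [← integrable_indicator_iff hms, ← integrable_join_iff]
  have h1 := ((integrable_indicator_iff measurableSet_Ioi).mpr
    (integrableOn_rpow_mul_decay hb hl)).mul_prod (integrable_tangential_decay (m := m))
  refine (h1.const_mul C).mono' ?_ (Eventually.of_forall fun p => ?_)
  · have hmeas : Measurable fun x => ((normal m x ^ b : ℝ) : ℂ) * φ x := by
      have := φ.continuous.measurable
      have := (normal m).measurable
      fun_prop
    exact ((hmeas.indicator hms).comp measurePreserving_join.measurable).aestronglyMeasurable
  · have hp : join p.2 p.1 ∈ upper m ↔ p.1 ∈ Set.Ioi (0 : ℝ) := by simp [upper]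
    by_cases h : p.1 ∈ Set.Ioi (0 : ℝ)
    · have h0 : 0 < p.1 := h
      rw [Set.indicator_of_mem (hp.mpr h), Set.indicator_of_mem h, norm_mul, Complex.norm_real,
        normal_join, Real.norm_of_nonneg (by positivity)]
      have h2 := hC (join p.2 p.1)
      rw [tangential_join, normal_join] at h2
      calc _ ≤ p.1 ^ b * (C * (((1 + ‖p.2‖) ^ (m + 1))⁻¹ * ((1 + |p.1|) ^ l)⁻¹)) := by gcongr
        _ = _ := by ring
    · rw [Set.indicator_of_notMem (fun h' => h (hp.mp h')), norm_zero, Set.indicator_of_notMem h]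
      simp

end Fiber

/-! ### Products and transposes -/

section Product

variable {m : ℕ}

/-- The product of two Schwartz functions. -/
def prodS {E : Type} [NormedAddCommGroup E] [NormedSpace ℝ E] (φ χ : 𝓢(E, ℂ)) : 𝓢(E, ℂ) :=
  SchwartzMap.smulLeftCLM ℂ φ χ

theorem prodS_apply {E : Type} [NormedAddCommGroup E] [NormedSpace ℝ E] (φ χ : 𝓢(E, ℂ)) (x : E) :
    prodS φ χ x = φ x * χ x := by
  rw [prodS, SchwartzMap.smulLeftCLM_apply_apply φ.hasTemperateGrowth, smul_eq_mul]

theorem fiberInt_prodS (φ χ : 𝓢(Rd (m + 1), ℂ)) (y : ℝ) :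
    fiberInt (prodS φ χ) y = ∫ x : Rd m, slice y φ x * slice y χ x := by
  simp only [fiberInt, prodS_apply, slice_apply]

open LineDeriv in
theorem lineDeriv_prodS (v : Rd (m + 1)) (φ χ : 𝓢(Rd (m + 1), ℂ)) :
    ∂_{v} (prodS φ χ) = prodS (∂_{v} φ) χ + prodS φ (∂_{v} χ) := by
  ext x
  have h1 : (prodS φ χ : Rd (m + 1) → ℂ) = fun x => φ x * χ x := funext (prodS_apply φ χ)
  rw [add_apply, prodS_apply, prodS_apply, SchwartzMap.lineDerivOp_apply_eq_fderiv,
    SchwartzMap.lineDerivOp_apply_eq_fderiv, SchwartzMap.lineDerivOp_apply_eq_fderiv, h1,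
    fderiv_fun_mul (φ.differentiable x) (χ.differentiable x)]
  simp only [add_apply, smul_apply, smul_eq_mul]
  ring

theorem integral_multiplier_mul {E : Type} [NormedAddCommGroup E] [InnerProductSpace ℝ E]
    [FiniteDimensional ℝ E] [MeasurableSpace E] [BorelSpace E] {q : E → ℂ}
    (hq : q.HasTemperateGrowth) (f g : 𝓢(E, ℂ)) :
    ∫ x, SchwartzMap.fourierMultiplierCLM ℂ q f x * g x =
      ∫ x, f x * SchwartzMap.fourierMultiplierCLM ℂ (fun ξ => q (-ξ)) g x := by
  have h := fourierMultiplier_apply hq (f : 𝓢'(E, ℂ)) g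
  rw [fourierMultiplierCLM_toTemperedDistributionCLM_eq hq] at h
  simpa [mul_comm] using h

theorem fiberInt_prodS_tangential {q : Rd m → ℂ} (hq : q.HasTemperateGrowth)
    (hq' : ∀ ξ, q (-ξ) = q ξ) (φ χ : 𝓢(Rd (m + 1), ℂ)) (y : ℝ) :
    fiberInt (prodS (SchwartzMap.fourierMultiplierCLM ℂ (fun ξ => q (tangential m ξ)) φ) χ) y =
      fiberInt (prodS φ
        (SchwartzMap.fourierMultiplierCLM ℂ (fun ξ => q (tangential m ξ)) χ)) y := by
  rw [fiberInt_prodS, fiberInt_prodS, slice_tangentialMult hq, slice_tangentialMult hq,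
    integral_multiplier_mul hq]
  simp only [hq']

open LineDeriv in
/-- Integration by parts in the fibres. -/
theorem fiberInt_prodS_sgnOp (φ χ : 𝓢(Rd (m + 1), ℂ)) (y : ℝ) :
    fiberInt (prodS φ (sgnOp m (-1) 1 χ)) y =
      fiberInt (prodS (sgnOp m 1 1 φ) χ) y - fiberInt (∂_{normalVec m} (prodS φ χ)) y := by
  have hadd : ∀ f g h : 𝓢(Rd (m + 1), ℂ), prodS f (g + h) = prodS f g + prodS f h := fun f g h => by
    ext x; simp only [prodS_apply, add_apply]; ring
  have hadd' : ∀ f g h : 𝓢(Rd (m + 1), ℂ), prodS (f + g) h = prodS f h + prodS g h :=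
    fun f g h => by ext x; simp only [prodS_apply, add_apply]; ring
  have hneg : prodS φ ((-1 : ℝ) • ∂_{normalVec m} χ) =
      prodS (∂_{normalVec m} φ) χ - ∂_{normalVec m} (prodS φ χ) := by
    rw [lineDeriv_prodS]
    ext x
    simp only [prodS_apply, smul_apply, sub_apply, add_apply, Complex.real_smul]
    push_cast
    ring
  have hk : (fun ξ : Rd m => (kappa m ξ : ℂ)).HasTemperateGrowth :=
    Function.Complex.hasTemperateGrowth_ofReal.comp hasTemperateGrowth_kappa
  rw [sgnOp_one, sgnOp_one, hadd, hneg, hadd', fiberInt_add, fiberInt_add, fiberInt_sub, one_smul,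
    fiberInt_prodS_tangential hk (fun ξ => by rw [kappa_neg])]
  ring

end Product

/-! ### The distributions `x_n^b φ` on the half-space -/

section PowDist

variable {m : ℕ}

theorem exists_isPowerTimes {b : ℝ} (hb : -1 < b) (φ : 𝓢(Rd (m + 1), ℂ)) :
    ∃ u, IsPowerTimes b φ u := by
  have h : Integrable ((upper m).indicator fun x => ((normal m x ^ b : ℝ) : ℂ) * φ x) :=
    (integrable_indicator_iff isOpen_upper.measurableSet).mpr (integrableOn_rpow_mul hb φ)
  exact ⟨_, h.toL1, h.coeFn_toL1, rfl⟩

theorem isPowerTimes_apply {b : ℝ} {φ : 𝓢(Rd (m + 1), ℂ)} {u : 𝓢'(Rd (m + 1), ℂ)}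
    (hu : IsPowerTimes b φ u) (χ : 𝓢(Rd (m + 1), ℂ)) :
    u χ = ∫ x in upper m, ((normal m x ^ b : ℝ) : ℂ) * prodS φ χ x := by
  obtain ⟨f, hf, rfl⟩ := hu
  rw [Lp.toTemperedDistribution_apply, ← integral_indicator isOpen_upper.measurableSet]
  refine integral_congr_ae ?_
  filter_upwards [hf] with x hx
  rw [hx, smul_eq_mul]
  by_cases h : x ∈ upper m
  · rw [Set.indicator_of_mem h, Set.indicator_of_mem h, prodS_apply]
    ring
  · rw [Set.indicator_of_notMem h, Set.indicator_of_notMem h, mul_zero]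

open Classical in
/-- The distribution `e⁺(x_n^b φ)`, for `b > -1`. -/
def powDist (m : ℕ) (b : ℝ) (φ : 𝓢(Rd (m + 1), ℂ)) : 𝓢'(Rd (m + 1), ℂ) :=
  if hb : -1 < b then (exists_isPowerTimes hb φ).choose else 0

theorem isPowerTimes_powDist {b : ℝ} (hb : -1 < b) (φ : 𝓢(Rd (m + 1), ℂ)) :
    IsPowerTimes b φ (powDist m b φ) := by
  rw [powDist, dif_pos hb]
  exact (exists_isPowerTimes hb φ).choose_spec

theorem IsPowerTimes.eq_powDist {b : ℝ} (hb : -1 < b) {φ : 𝓢(Rd (m + 1), ℂ)}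
    {u : 𝓢'(Rd (m + 1), ℂ)} (hu : IsPowerTimes b φ u) : u = powDist m b φ := by
  ext χ
  rw [isPowerTimes_apply hu, isPowerTimes_apply (isPowerTimes_powDist hb φ)]

theorem powDist_apply' {b : ℝ} (hb : -1 < b) (φ χ : 𝓢(Rd (m + 1), ℂ)) :
    powDist m b φ χ = ∫ x in upper m, ((normal m x ^ b : ℝ) : ℂ) * prodS φ χ x :=
  isPowerTimes_apply (isPowerTimes_powDist hb φ) χ

theorem powDist_apply {b : ℝ} (hb : -1 < b) (φ χ : 𝓢(Rd (m + 1), ℂ)) :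
    powDist m b φ χ = ∫ y in Set.Ioi (0 : ℝ), ((y ^ b : ℝ) : ℂ) * fiberInt (prodS φ χ) y := by
  rw [powDist_apply' hb, setIntegral_upper (integrableOn_rpow_mul hb _)]
  refine setIntegral_congr_fun measurableSet_Ioi fun y _ => ?_
  simp only [normal_join, fiberInt, integral_const_mul]

theorem isVanishingOn_lower_powDist {b : ℝ} (hb : -1 < b) (φ : 𝓢(Rd (m + 1), ℂ)) :
    IsVanishingOn (powDist m b φ) (lower m) := by
  rw [isVanishingOn_lower_iff]
  intro χ hχ
  rw [powDist_apply' hb]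
  have h : ∀ x ∈ upper m, ((normal m x ^ b : ℝ) : ℂ) * prodS φ χ x = 0 := fun x hx => by
    rw [prodS_apply, hχ x hx, mul_zero, mul_zero]
  rw [setIntegral_congr_fun isOpen_upper.measurableSet h, integral_zero]

theorem tendsto_rpow_mul_fiberInt (b : ℝ) (Φ : 𝓢(Rd (m + 1), ℂ)) :
    Tendsto (fun y : ℝ => ((y ^ b : ℝ) : ℂ) * fiberInt Φ y) atTop (nhds 0) := by
  obtain ⟨l, hl⟩ := exists_nat_gt b
  obtain ⟨C, hC0, hC⟩ := exists_fiberInt_decay Φ l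
  have h1 : Tendsto (fun y : ℝ => C * y ^ (-(l - b))) atTop (nhds 0) := by
    simpa using (tendsto_rpow_neg_atTop (sub_pos.mpr hl)).const_mul C
  refine squeeze_zero_norm' ?_ h1
  filter_upwards [eventually_gt_atTop 0] with y hy
  rw [norm_mul, Complex.norm_real, Real.norm_of_nonneg (by positivity), neg_sub,
    Real.rpow_sub hy, Real.rpow_natCast, div_eq_mul_inv]
  calc _ ≤ y ^ b * (C * ((1 + |y|) ^ l)⁻¹) := by
        gcongr; exact (norm_fiberInt_le Φ y).trans (hC y)
    _ ≤ y ^ b * (C * (y ^ l)⁻¹) := by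
        gcongr; rw [abs_of_pos hy]; linarith
    _ = _ := by ring

open LineDeriv in
theorem integral_fiberInt_lineDeriv (Φ : 𝓢(Rd (m + 1), ℂ)) :
    ∫ y in Set.Ioi (0 : ℝ), ((y ^ (0 : ℝ) : ℝ) : ℂ) * fiberInt (∂_{normalVec m} Φ) y =
      -fiberInt Φ 0 := by
  have h0 := integrableOn_rpow_mul_fiberInt (by norm_num : (-1 : ℝ) < 0) (∂_{normalVec m} Φ)
  have ht := tendsto_rpow_mul_fiberInt 0 Φ
  simp only [Real.rpow_zero, Complex.ofReal_one, one_mul] at h0 ht ⊢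
  rw [integral_Ioi_of_hasDerivAt_of_tendsto' (fun y _ => hasDerivAt_fiberInt Φ y) h0 ht, zero_sub]

open LineDeriv in
-- Integration by parts on the half-line. For b > 0 the factor y^b removes the boundary term, in
-- contrast to the case b = 0, which produces the layer.
theorem integral_rpow_mul_fiberInt_lineDeriv {b : ℝ} (hb : 0 < b) (Φ : 𝓢(Rd (m + 1), ℂ)) :
    ∫ y in Set.Ioi (0 : ℝ), ((y ^ b : ℝ) : ℂ) * fiberInt (∂_{normalVec m} Φ) y =
      -(b * ∫ y in Set.Ioi (0 : ℝ), ((y ^ (b - 1) : ℝ) : ℂ) * fiberInt Φ y) := by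
  have h0 := integrableOn_rpow_mul_fiberInt (by linarith : (-1 : ℝ) < b) (∂_{normalVec m} Φ)
  have h1 := (integrableOn_rpow_mul_fiberInt (by linarith : (-1 : ℝ) < b - 1) Φ).const_mul (b : ℂ)
  have h := integral_Ioi_of_hasDerivAt_of_tendsto
    (f := fun y : ℝ => ((y ^ b : ℝ) : ℂ) * fiberInt Φ y)
    (f' := fun y : ℝ => (b : ℂ) * (((y ^ (b - 1) : ℝ) : ℂ) * fiberInt Φ y) +
      ((y ^ b : ℝ) : ℂ) * fiberInt (∂_{normalVec m} Φ) y) (a := 0) (m := 0) ?_ ?_ (h1.add h0)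
      (tendsto_rpow_mul_fiberInt b Φ)
  · rw [integral_add h1 h0, integral_const_mul, Real.zero_rpow hb.ne', Complex.ofReal_zero,
      zero_mul, sub_zero] at h
    linear_combination h
  · refine ContinuousAt.continuousWithinAt ?_
    have h2 : ContinuousAt (fun y : ℝ => y ^ b) 0 :=
      Real.continuousAt_rpow_const 0 b (Or.inr hb.le)
    exact (Complex.continuous_ofReal.continuousAt.comp h2).mul
      (continuous_fiberInt Φ).continuousAt
  · intro y hy
    have hy0 : 0 < y := hy
    have h2 := (Real.hasDerivAt_rpow_const (p := b) (Or.inl hy0.ne')).ofReal_comp.mul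
      (hasDerivAt_fiberInt Φ y)
    refine h2.congr_deriv ?_
    rw [Complex.ofReal_mul, mul_assoc]

/-- The jump formula: `Ξ₊^1` applied to a function cut off at the boundary. -/
theorem sgnDOp_one_powDist_zero (φ : 𝓢(Rd (m + 1), ℂ)) :
    sgnDOp m 1 1 (powDist m 0 φ) =
      powDist m 0 (sgnOp m 1 1 φ) + layer m (schwartzTrace m φ : 𝓢'(Rd m, ℂ)) := by
  ext χ
  have h : (-1 : ℝ) < 0 := by norm_num
  rw [sgnDOp_apply]
  change _ = powDist m 0 (sgnOp m 1 1 φ) χ + layer m (schwartzTrace m φ : 𝓢'(Rd m, ℂ)) χ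
  rw [powDist_apply h, powDist_apply h, layer_apply]
  simp only [fiberInt_prodS_sgnOp, mul_sub]
  rw [integral_sub (integrableOn_rpow_mul_fiberInt h _) (integrableOn_rpow_mul_fiberInt h _),
    integral_fiberInt_lineDeriv, sub_neg_eq_add]
  congr 1
  rw [fiberInt_prodS, slice_zero]
  simp [mul_comm]

/-- Multiplication by `x_n`. -/
def normalMul (m : ℕ) : 𝓢(Rd (m + 1), ℂ) →L[ℂ] 𝓢(Rd (m + 1), ℂ) :=
  SchwartzMap.smulLeftCLM ℂ fun x => ((normal m x : ℝ) : ℂ)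

theorem normalMul_apply (φ : 𝓢(Rd (m + 1), ℂ)) (x : Rd (m + 1)) :
    normalMul m φ x = (normal m x : ℂ) * φ x := by
  have h : (fun x : Rd (m + 1) => ((normal m x : ℝ) : ℂ)).HasTemperateGrowth :=
    Function.Complex.hasTemperateGrowth_ofReal.comp (normal m).hasTemperateGrowth
  rw [normalMul, SchwartzMap.smulLeftCLM_apply_apply h, smul_eq_mul]

/-- The Leibniz rule for ⟨D'⟩ + ∂_n on x_n^b φ, read after pairing with a test function. The second
summand carries a factor x_n, so only bφ contributes to the trace of the new coefficient. -/
theorem sgnDOp_one_powDist {b : ℝ} (hb : 0 < b) (φ : 𝓢(Rd (m + 1), ℂ)) :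
    sgnDOp m 1 1 (powDist m b φ) =
      powDist m (b - 1) ((b : ℂ) • φ + normalMul m (sgnOp m 1 1 φ)) := by
  ext χ
  have h : -1 < b := by linarith
  have h' : -1 < b - 1 := by linarith
  have e : prodS ((b : ℂ) • φ + normalMul m (sgnOp m 1 1 φ)) χ =
      (b : ℂ) • prodS φ χ + normalMul m (prodS (sgnOp m 1 1 φ) χ) := by
    ext x
    simp only [prodS_apply, add_apply, smul_apply, normalMul_apply, smul_eq_mul]
    ring
  have hn : ∀ (Φ : 𝓢(Rd (m + 1), ℂ)) (y : ℝ), fiberInt (normalMul m Φ) y = y * fiberInt Φ y := by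
    intro Φ y
    simp only [fiberInt, normalMul_apply, normal_join, integral_const_mul]
  have hs : ∀ (Φ : 𝓢(Rd (m + 1), ℂ)) (y : ℝ), fiberInt ((b : ℂ) • Φ) y = b * fiberInt Φ y := by
    intro Φ y
    simp only [fiberInt, smul_apply, smul_eq_mul, integral_const_mul]
  rw [sgnDOp_apply, powDist_apply h, powDist_apply h', e]
  simp only [fiberInt_prodS_sgnOp, mul_sub]
  rw [integral_sub (integrableOn_rpow_mul_fiberInt h _) (integrableOn_rpow_mul_fiberInt h _),
    integral_rpow_mul_fiberInt_lineDeriv hb, sub_neg_eq_add, add_comm, ← integral_const_mul,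
    ← integral_add ((integrableOn_rpow_mul_fiberInt h' _).const_mul _)
      (integrableOn_rpow_mul_fiberInt h _)]
  refine setIntegral_congr_fun measurableSet_Ioi fun y hy => ?_
  have hy0 : 0 < y := hy
  simp only [fiberInt_add, hn, hs]
  have hp : y ^ b = y ^ (b - 1) * y := by
    rw [← Real.rpow_add_one hy0.ne', sub_add_cancel]
  rw [hp]
  push_cast
  ring

end PowDist

/-! ### Truncation of Schwartz functions and the Green formula -/

section Green

variable {m : ℕ}

theorem memSobolev_powDist_zero (φ : 𝓢(Rd (m + 1), ℂ)) : MemSobolev 0 2 (powDist m 0 φ) := by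
  have h : MemLp ((upper m).indicator φ) 2 (volume : Measure (Rd (m + 1))) :=
    (φ.memLp 2 volume).indicator isOpen_upper.measurableSet
  have e : powDist m 0 φ = ((h.toLp _ : Lp ℂ 2 (volume : Measure (Rd (m + 1)))) :
      𝓢'(Rd (m + 1), ℂ)) := by
    ext χ
    rw [powDist_apply' (by norm_num), Lp.toTemperedDistribution_apply,
      ← integral_indicator isOpen_upper.measurableSet]
    refine integral_congr_ae ?_
    filter_upwards [h.coeFn_toLp] with x hx
    rw [hx, smul_eq_mul]
    by_cases h : x ∈ upper m
    · rw [Set.indicator_of_mem h, Set.indicator_of_mem h, prodS_apply]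
      simp [mul_comm]
    · rw [Set.indicator_of_notMem h, Set.indicator_of_notMem h, mul_zero]
  rw [e, ← toDist_equivL2_zero_symm]
  exact SobolevSpace.memSobolev _

theorem isVanishingOn_upper_powDist_sub (φ : 𝓢(Rd (m + 1), ℂ)) :
    IsVanishingOn (powDist m 0 φ - (φ : 𝓢'(Rd (m + 1), ℂ))) (upper m) := by
  intro χ hχ
  change powDist m 0 φ χ - (φ : 𝓢'(Rd (m + 1), ℂ)) χ = 0
  rw [powDist_apply' (by norm_num), sub_eq_zero]
  simp only [Real.rpow_zero, Complex.ofReal_one, one_mul]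
  rw [setIntegral_eq_integral_of_forall_compl_eq_zero]
  · simp [prodS_apply, mul_comm]
  · intro x hx
    rw [prodS_apply]
    have : χ x = 0 := by
      by_contra hne
      exact hx (hχ (subset_tsupport _ hne))
    rw [this, mul_zero]

/-- For s ≤ 0 the literal cut-off function, being in L², belongs to H^s, and uniqueness of the
truncation identifies the two. -/
theorem toDist_truncation_ofSchwartz {s : ℝ} (hs : |s| < 1 / 2) (hs0 : s ≤ 0)
    (φ : 𝓢(Rd (m + 1), ℂ)) :
    (truncation m s (SobolevSpace.ofSchwartz s φ)).toDist = powDist m 0 φ := by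
  set F : SobolevSpace (Rd (m + 1)) s :=
    SobolevSpace.incl hs0 (SobolevSpace.mk _ (memSobolev_powDist_zero φ)) with hF
  have hFd : F.toDist = powDist m 0 φ := by rw [hF, SobolevSpace.toDist_incl,
    SobolevSpace.toDist_mk]
  rw [← eq_truncation hs (F := F), hFd]
  · rw [hFd]; exact isVanishingOn_lower_powDist (by norm_num) φ
  · rw [hFd]; exact isVanishingOn_upper_powDist_sub φ

/-- `Ξ₊^1` of the truncation of `g ∈ H^σ`, `σ > 1/2`, is the truncation of `Ξ₊^1 g` plus the layer
with density the trace of `g`. -/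
theorem sgnDOp_one_truncation {σ s r : ℝ} (hσ : 1 / 2 < σ) (hs : |s| < 1 / 2) (hs0 : s ≤ 0)
    (hsσ : s ≤ σ - 1) (hr : r = σ - 1 / 2) (g : SobolevSpace (Rd (m + 1)) σ) :
    sgnDOp m 1 1 (truncation m 0 (SobolevSpace.incl (by linarith) g)).toDist =
      (truncation m s (SobolevSpace.incl hsσ
        (sgnMap (s' := σ - 1) (t := 1) (ε := 1) (by norm_num) rfl g))).toDist +
        layer m (traceMap m σ r g).toDist := by
  ext χ
  change _ = (truncation m s (SobolevSpace.incl hsσ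
    (sgnMap (s' := σ - 1) (t := 1) (ε := 1) (by norm_num) rfl g))).toDist χ +
      layer m (traceMap m σ r g).toDist χ
  rw [sgnDOp_apply, layer_apply]
  -- Against a fixed test function both sides are continuous in g for the norm of H^σ, so the
  -- formula for Schwartz functions suffices.
  refine (SobolevSpace.denseRange_ofSchwartz σ).induction_on g (isClosed_eq ?_ ?_) fun φ => ?_
  · exact (SobolevSpace.continuous_apply _).comp (by fun_prop)
  · exact ((SobolevSpace.continuous_apply _).comp (by fun_prop)).add
      ((SobolevSpace.continuous_apply _).comp (by fun_prop))
  · have e1 : SobolevSpace.incl (by linarith : (0 : ℝ) ≤ σ) (SobolevSpace.ofSchwartz σ φ) =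
        SobolevSpace.ofSchwartz 0 φ := SobolevSpace.toDist_injective (by simp)
    have e2 : SobolevSpace.incl hsσ (sgnMap (s' := σ - 1) (t := 1) (ε := 1) (by norm_num) rfl
        (SobolevSpace.ofSchwartz σ φ)) = SobolevSpace.ofSchwartz s (sgnOp m 1 1 φ) := by
      apply SobolevSpace.toDist_injective
      rw [SobolevSpace.toDist_incl, toDist_sgnMap, SobolevSpace.toDist_ofSchwartz,
        SobolevSpace.toDist_ofSchwartz,
        fourierMultiplierCLM_toTemperedDistributionCLM_eq (hasTemperateGrowth_sgnSymbol _ _)]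
    rw [e1, e2, toDist_truncation_ofSchwartz (by norm_num) le_rfl, toDist_truncation_ofSchwartz hs
      hs0, traceMap_ofSchwartz hσ hr]
    have h := congrArg (fun u => u χ) (sgnDOp_one_powDist_zero φ)
    simp only [sgnDOp_apply] at h
    exact h

end Green

/-! ### Tensor products of Schwartz functions and the Poisson extension in an extra variable -/

section Tensor

variable {m : ℕ}

theorem norm_tangentialCLM_le : ‖tangential m‖ ≤ 1 :=
  ContinuousLinearMap.opNorm_le_bound _ zero_le_one fun x => by
    rw [one_mul]; exact norm_tangential_le x

theorem norm_normalCLM_le : ‖normal m‖ ≤ 1 :=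
  ContinuousLinearMap.opNorm_le_bound _ zero_le_one fun x => by
    rw [one_mul, Real.norm_eq_abs]; exact abs_normal_le x

theorem exists_iteratedFDeriv_comp_decay {E G : Type} [NormedAddCommGroup E] [NormedSpace ℝ E]
    [NormedAddCommGroup G] [NormedSpace ℝ G] (f : 𝓢(E, ℂ)) {L : G →L[ℝ] E} (hL : ‖L‖ ≤ 1)
    (k n : ℕ) : ∃ C, 0 ≤ C ∧ ∀ i ≤ n, ∀ x,
      (1 + ‖L x‖) ^ k * ‖iteratedFDeriv ℝ i (fun x => f (L x)) x‖ ≤ C := by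
  refine ⟨2 ^ k * ((Finset.Iic (k, n)).sup fun p => SchwartzMap.seminorm ℝ p.1 p.2) f,
    mul_nonneg (by positivity) (apply_nonneg _ _), fun i hi x => ?_⟩
  refine le_trans ?_ (SchwartzMap.one_add_le_sup_seminorm_apply (𝕜 := ℝ) (m := (k, n)) le_rfl hi
    f (L x))
  gcongr
  have h := L.iteratedFDeriv_comp_right (f.smooth ⊤) x (i := i) (by exact_mod_cast le_top)
  change ‖iteratedFDeriv ℝ i (f ∘ L) x‖ ≤ _
  rw [h]
  refine (ContinuousMultilinearMap.norm_compContinuousLinearMap_le _ _).trans ?_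
  refine mul_le_of_le_one_right (norm_nonneg _) ?_
  rw [Finset.prod_const]
  exact pow_le_one₀ (norm_nonneg _) hL

/-- The function `(x', y) ↦ f(x') g(y)`. -/
def tensorS (f : 𝓢(Rd m, ℂ)) (g : 𝓢(ℝ, ℂ)) : 𝓢(Rd (m + 1), ℂ) where
  toFun x := f (tangential m x) * g (normal m x)
  smooth' := ((f.smooth ⊤).comp (tangential m).contDiff).mul
    ((g.smooth ⊤).comp (normal m).contDiff)
  decay' k n := by
    obtain ⟨A, hA0, hA⟩ := exists_iteratedFDeriv_comp_decay f (norm_tangentialCLM_le (m := m)) k n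
    obtain ⟨B, hB0, hB⟩ := exists_iteratedFDeriv_comp_decay g (norm_normalCLM_le (m := m)) k n
    refine ⟨∑ i ∈ Finset.range (n + 1), (n.choose i : ℝ) * A * B, fun x => ?_⟩
    have h := norm_iteratedFDeriv_mul_le ((f.smooth ⊤).comp (tangential m).contDiff)
      ((g.smooth ⊤).comp (normal m).contDiff) x (n := n) (by exact_mod_cast le_top)
    refine (mul_le_mul_of_nonneg_left h (by positivity)).trans ?_
    rw [Finset.mul_sum]
    refine Finset.sum_le_sum fun i hi => ?_
    have hi' : i ≤ n := Nat.lt_succ_iff.mp (Finset.mem_range.mp hi)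
    have hx : ‖x‖ ^ k ≤ (1 + ‖tangential m x‖) ^ k * (1 + ‖normal m x‖) ^ k := by
      rw [← mul_pow]
      gcongr
      refine (norm_le_split x).trans ?_
      rw [Real.norm_eq_abs]
      nlinarith [norm_nonneg (tangential m x), abs_nonneg (normal m x)]
    have h1 := hA i hi' x
    have h2 := hB (n - i) (Nat.sub_le _ _) x
    calc _ ≤ ((1 + ‖tangential m x‖) ^ k * (1 + ‖normal m x‖) ^ k) *
          ((n.choose i : ℝ) * ‖iteratedFDeriv ℝ i (fun x => f (tangential m x)) x‖ *
            ‖iteratedFDeriv ℝ (n - i) (fun x => g (normal m x)) x‖) := by gcongr <;> rfl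
      _ = (n.choose i : ℝ) *
          ((1 + ‖tangential m x‖) ^ k * ‖iteratedFDeriv ℝ i (fun x => f (tangential m x)) x‖) *
          ((1 + ‖normal m x‖) ^ k * ‖iteratedFDeriv ℝ (n - i) (fun x => g (normal m x)) x‖) := by
        ring
      _ ≤ _ := by gcongr

theorem tensorS_apply (f : 𝓢(Rd m, ℂ)) (g : 𝓢(ℝ, ℂ)) (x : Rd (m + 1)) :
    tensorS f g x = f (tangential m x) * g (normal m x) := rfl

theorem schwartzTrace_surjective : Function.Surjective (schwartzTrace m) := fun ψ => by
  refine ⟨tensorS ψ expCutoff, ?_⟩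
  ext x
  rw [schwartzTrace_apply, tensorS_apply, tangential_join, normal_join, expCutoff_apply le_rfl]
  simp

/-- The scaling `η ↦ η/κ` of the extra frequency variable. -/
def scaleFreq (m : ℕ) (ζ : Rd (m + 1 + 1)) : Rd (m + 1 + 1) :=
  join (tangential (m + 1) ζ)
    (normal (m + 1) ζ * (kappa m (tangential m (tangential (m + 1) ζ)))⁻¹)

theorem hasTemperateGrowth_inv_kappa :
    (fun ζ : Rd (m + 1) => (kappa m (tangential m ζ))⁻¹).HasTemperateGrowth := by
  have h := (Function.hasTemperateGrowth_one_add_norm_sq_rpow (Rd m) (-(1 / 2))).comp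
    (((2 * Real.pi) • tangential m).hasTemperateGrowth)
  have e : (fun ζ : Rd (m + 1) => (kappa m (tangential m ζ))⁻¹) =
      (fun x => (1 + ‖x‖ ^ 2) ^ (-(1 / 2 : ℝ))) ∘ ((2 * Real.pi) • tangential m) := by
    ext ζ
    rw [kappa, Function.comp_apply, Real.rpow_neg (by positivity)]
    rfl
  rw [e]
  exact h

theorem hasTemperateGrowth_scaleFreq : (scaleFreq m).HasTemperateGrowth := by
  have h1 : (fun ζ : Rd (m + 1 + 1) =>
      normal (m + 1) ζ * (kappa m (tangential m (tangential (m + 1) ζ)))⁻¹).HasTemperateGrowth :=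
    (normal (m + 1)).hasTemperateGrowth.mul
      (hasTemperateGrowth_inv_kappa.comp (tangential (m + 1)).hasTemperateGrowth)
  have h2 := h1.smul (Function.HasTemperateGrowth.const (normalVec (m + 1)))
  exact ((boundary (m + 1) ∘L tangential (m + 1)).hasTemperateGrowth).add h2

/-- Composition preserves Schwartz decay if the old variable is bounded by a polynomial in the new
one. Undoing the scaling multiplies η by ⟨ξ'⟩, which is itself at most linear in the norm: this is
the square on the right. -/
theorem norm_le_scaleFreq (ζ : Rd (m + 1 + 1)) :
    ‖ζ‖ ≤ (1 + 2 * Real.pi) * (1 + ‖scaleFreq m ζ‖) ^ 2 := by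
  have h1 := norm_tangential_le (scaleFreq m ζ)
  have h2 := abs_normal_le (scaleFreq m ζ)
  have h3 := norm_le_split ζ
  have h4 := norm_tangential_le (tangential (m + 1) ζ)
  rw [scaleFreq, tangential_join, ← scaleFreq] at h1
  rw [scaleFreq, normal_join, ← scaleFreq] at h2
  set N := ‖scaleFreq m ζ‖
  set κ := kappa m (tangential m (tangential (m + 1) ζ)) with hκ
  have hκ0 : 0 < κ := kappa_pos _
  have hN : 0 ≤ N := norm_nonneg _
  have h5 : |normal (m + 1) ζ| ≤ κ * N := by
    rw [abs_mul, abs_of_pos (inv_pos.mpr hκ0), ← div_eq_mul_inv, div_le_iff₀ hκ0] at h2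
    linarith
  have h6 : κ ≤ 1 + 2 * Real.pi * N := by
    have h7 : ‖(2 * Real.pi) • tangential m (tangential (m + 1) ζ)‖ ≤ 2 * Real.pi * N := by
      rw [norm_smul, Real.norm_of_nonneg (by positivity)]
      gcongr
      exact h4.trans h1
    refine le_of_sq_le_sq ?_ (by positivity)
    rw [hκ, kappa_sq]
    have h8 := norm_nonneg ((2 * Real.pi) • tangential m (tangential (m + 1) ζ))
    nlinarith [Real.pi_pos]
  have h9 : κ * N ≤ (1 + 2 * Real.pi * N) * N := by gcongr
  nlinarith [Real.pi_pos, mul_nonneg Real.pi_pos.le hN, mul_nonneg hN hN]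

/-- The Fourier transform of `poissonExt`. -/
def poissonExtFourier (φ : 𝓢(Rd (m + 1), ℂ)) : 𝓢(Rd (m + 1 + 1), ℂ) :=
  SchwartzMap.smulLeftCLM ℂ
    (fun ζ => (((kappa m (tangential m (tangential (m + 1) ζ)))⁻¹ : ℝ) : ℂ))
    (SchwartzMap.compCLM ℂ hasTemperateGrowth_scaleFreq ⟨2, _, norm_le_scaleFreq⟩
      (tensorS (𝓕 φ) (𝓕 expCutoff)))

theorem poissonExtFourier_join (φ : 𝓢(Rd (m + 1), ℂ)) (ξ : Rd (m + 1)) (η : ℝ) :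
    poissonExtFourier φ (join ξ η) = ((kappa m (tangential m ξ) : ℝ) : ℂ)⁻¹ *
      (𝓕 φ ξ * 𝓕 expCutoff (η / kappa m (tangential m ξ))) := by
  have h : (fun ζ : Rd (m + 1 + 1) =>
      (((kappa m (tangential m (tangential (m + 1) ζ)))⁻¹ : ℝ) : ℂ)).HasTemperateGrowth :=
    Function.Complex.hasTemperateGrowth_ofReal.comp
      (hasTemperateGrowth_inv_kappa.comp (tangential (m + 1)).hasTemperateGrowth)
  rw [poissonExtFourier, SchwartzMap.smulLeftCLM_apply_apply h, SchwartzMap.compCLM_apply,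
    Function.comp_apply, tensorS_apply, scaleFreq, smul_eq_mul]
  simp only [tangential_join, normal_join, Complex.ofReal_inv, div_eq_mul_inv]

/-- The function `(x, r) ↦ (e^{-r⟨D'⟩}φ)(x)`, which is a Schwartz function of all variables. -/
def poissonExt (φ : 𝓢(Rd (m + 1), ℂ)) : 𝓢(Rd (m + 1 + 1), ℂ) := 𝓕⁻ (poissonExtFourier φ)

/-- With κ = ⟨ξ'⟩, inverting κ⁻¹·𝓕χ(η/κ) in η gives χ(rκ), where χ is `expCutoff`. Thus e^{-r⟨D'⟩}φ,
modified for r < 0, is jointly Schwartz in (x, r); negative r occur because `powShift` is defined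
for x_n < 0 as well. -/
theorem slice_poissonExt (r : ℝ) (φ : 𝓢(Rd (m + 1), ℂ)) :
    slice r (poissonExt φ) = tPoisson m r φ := by
  have h : 𝓕 (slice r (poissonExt φ)) = 𝓕 (tPoisson m r φ) := by
    ext ξ
    have hκ : 0 < kappa m (tangential m ξ) := kappa_pos _
    rw [fourier_slice, poissonExt, FourierTransform.fourier_fourierInv_eq, tPoisson,
      SchwartzMap.fourierMultiplierCLM_apply, FourierTransform.fourier_fourierInv_eq,
      SchwartzMap.smulLeftCLM_apply_apply (tPoisson_symbol r)]
    simp only [poissonExtFourier_join]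
    set κ := kappa m (tangential m ξ)
    have e : ∀ τ : ℝ, Complex.exp ((2 * Real.pi * (r * τ) : ℝ) * Complex.I) *
        ((κ : ℂ)⁻¹ * (𝓕 φ ξ * 𝓕 expCutoff (τ / κ))) = (κ : ℂ)⁻¹ * 𝓕 φ ξ *
        (fun s : ℝ => Complex.exp ((2 * Real.pi * (r * κ * s) : ℝ) * Complex.I) *
          𝓕 expCutoff s) (τ / κ) := fun τ => by
      have : r * κ * (τ / κ) = r * τ := by field_simp
      simp only [this]
      ring
    simp only [e]
    rw [integral_const_mul, Measure.integral_comp_div (fun s : ℝ =>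
      Complex.exp ((2 * Real.pi * (r * κ * s) : ℝ) * Complex.I) * 𝓕 expCutoff s), abs_of_pos hκ,
      poissonSymbol, smul_eq_mul]
    have hinv : expCutoff (r * κ) = ∫ s : ℝ,
        Complex.exp ((2 * Real.pi * (r * κ * s) : ℝ) * Complex.I) * 𝓕 expCutoff s := by
      have h0 : expCutoff = 𝓕⁻ (𝓕 expCutoff : 𝓢(ℝ, ℂ)) :=
        (FourierTransform.fourierInv_fourier_eq _).symm
      conv_lhs => rw [h0]
      rw [SchwartzMap.fourierInv_coe, Real.fourierInv_eq']
      refine integral_congr_ae (Eventually.of_forall fun s => ?_)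
      simp only [smul_eq_mul]
      congr 3
    rw [hinv, Complex.real_smul]
    have hκ' : (κ : ℂ) ≠ 0 := by exact_mod_cast hκ.ne'
    generalize (∫ s : ℝ, Complex.exp ((2 * Real.pi * (r * κ * s) : ℝ) * Complex.I) *
      𝓕 expCutoff s) = J
    field_simp
  have h2 := congrArg 𝓕⁻ h
  rwa [FourierTransform.fourierInv_fourier_eq, FourierTransform.fourierInv_fourier_eq] at h2

theorem poissonExt_join (φ : 𝓢(Rd (m + 1), ℂ)) (x : Rd (m + 1)) (r : ℝ) :
    poissonExt φ (join x r) = tPoisson m r φ x := by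
  rw [← slice_poissonExt, slice_apply]

end Tensor

/-! ### Averages of a Schwartz function along a pencil of linear maps -/

section Average

variable {E E' : Type} [NormedAddCommGroup E] [NormedSpace ℝ E] [NormedAddCommGroup E']
  [NormedSpace ℝ E']

/-- `x ↦ ∫₀¹ w(θ) U(B₀x + θB₁x) dθ`. -/
def pencilAvg {F : Type} [NormedAddCommGroup F] [NormedSpace ℝ F] (B₀ B₁ : E →L[ℝ] E')
    (w : ℝ → ℝ) (U : 𝓢(E', F)) (x : E) : F :=
  ∫ θ in Set.Ioo (0 : ℝ) 1, w θ • U (B₀ x + θ • B₁ x)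

variable {B₀ B₁ : E →L[ℝ] E'} {c : ℝ}

theorem integrable_pencil {F : Type} [NormedAddCommGroup F] [NormedSpace ℝ F] {w : ℝ → ℝ}
    (hw : IntegrableOn w (Set.Ioo 0 1)) (U : 𝓢(E', F)) (x : E) :
    IntegrableOn (fun θ => w θ • U (B₀ x + θ • B₁ x)) (Set.Ioo 0 1) := by
  obtain ⟨C, hC⟩ := U.decay 0 0
  simp only [pow_zero, one_mul, norm_iteratedFDeriv_zero] at hC
  refine Integrable.smul_bdd (C := C) hw (Continuous.aestronglyMeasurable ?_)
    (Eventually.of_forall fun θ => hC.2 _)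
  have := U.continuous
  fun_prop

theorem norm_pencilAvg_le {F : Type} [NormedAddCommGroup F] [NormedSpace ℝ F] {w : ℝ → ℝ}
    (hw : IntegrableOn w (Set.Ioo 0 1))
    (hc : ∀ θ ∈ Set.Ioo (0 : ℝ) 1, ∀ x, ‖x‖ ≤ c * ‖B₀ x + θ • B₁ x‖) (U : 𝓢(E', F)) (k : ℕ) : ∃ C, ∀ x, ‖x‖ ^ k * ‖pencilAvg B₀ B₁ w U x‖ ≤ C := by
  obtain ⟨C, hC0, hC⟩ := U.decay k 0
  simp only [norm_iteratedFDeriv_zero] at hC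
  refine ⟨∫ θ in Set.Ioo (0 : ℝ) 1, |w θ| * (|c| ^ k * C), fun x => ?_⟩
  rw [← Real.norm_of_nonneg (pow_nonneg (norm_nonneg x) k), ← norm_smul, pencilAvg, ← integral_smul]
  refine norm_integral_le_of_norm_le (hw.abs.mul_const _) ?_
  filter_upwards [ae_restrict_mem measurableSet_Ioo] with θ hθ
  rw [norm_smul, norm_smul, Real.norm_of_nonneg (pow_nonneg (norm_nonneg x) k), Real.norm_eq_abs,
    mul_left_comm]
  refine mul_le_mul_of_nonneg_left ?_ (abs_nonneg _)
  have h1 : ‖x‖ ≤ |c| * ‖B₀ x + θ • B₁ x‖ :=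
    (hc θ hθ x).trans (by gcongr; exact le_abs_self c)
  calc _ ≤ (|c| * ‖B₀ x + θ • B₁ x‖) ^ k * ‖U (B₀ x + θ • B₁ x)‖ := by gcongr
    _ = |c| ^ k * (‖B₀ x + θ • B₁ x‖ ^ k * ‖U (B₀ x + θ • B₁ x)‖) := by ring
    _ ≤ _ := by gcongr; exact hC _

/-- The chain rule produces the derivative of U composed with B₀ + θB₁. The two terms are averages
of the same kind, with weights w and θw, so differentiation can be iterated. -/
theorem hasFDerivAt_pencilAvg {F : Type} [NormedAddCommGroup F] [NormedSpace ℝ F] {w : ℝ → ℝ}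
    (hw : IntegrableOn w (Set.Ioo 0 1)) (U : 𝓢(E', F)) (x : E) :
    HasFDerivAt (pencilAvg B₀ B₁ w U)
      (pencilAvg B₀ B₁ w (SchwartzMap.postcompCLM (𝕜 := ℝ)
          ((ContinuousLinearMap.compL ℝ E E' F).flip B₀) (SchwartzMap.fderivCLM ℝ E' F U)) x +
        pencilAvg B₀ B₁ (fun θ => θ * w θ) (SchwartzMap.postcompCLM (𝕜 := ℝ)
          ((ContinuousLinearMap.compL ℝ E E' F).flip B₁) (SchwartzMap.fderivCLM ℝ E' F U)) x) x := by
  have hw' : IntegrableOn (fun θ => θ * w θ) (Set.Ioo 0 1) := by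
    refine Integrable.bdd_mul (c := 1) hw (by fun_prop) ?_
    filter_upwards [ae_restrict_mem measurableSet_Ioo] with θ hθ
    rw [Real.norm_of_nonneg hθ.1.le]
    exact hθ.2.le
  rw [pencilAvg, pencilAvg, ← integral_add (integrable_pencil hw _ x) (integrable_pencil hw' _ x)]
  obtain ⟨C, hC⟩ := (SchwartzMap.fderivCLM ℝ E' F U).decay 0 0
  simp only [pow_zero, one_mul, norm_iteratedFDeriv_zero] at hC
  have key : ∀ (θ : ℝ) (y : E), w θ • (SchwartzMap.postcompCLM (𝕜 := ℝ)
          ((ContinuousLinearMap.compL ℝ E E' F).flip B₀) (SchwartzMap.fderivCLM ℝ E' F U))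
            (B₀ y + θ • B₁ y) + (θ * w θ) • (SchwartzMap.postcompCLM (𝕜 := ℝ)
          ((ContinuousLinearMap.compL ℝ E E' F).flip B₁) (SchwartzMap.fderivCLM ℝ E' F U))
            (B₀ y + θ • B₁ y) =
      w θ • (fderiv ℝ U (B₀ y + θ • B₁ y)).comp (B₀ + θ • B₁) := by
    intro θ y
    ext v
    simp [SchwartzMap.postcompCLM_apply, SchwartzMap.fderivCLM_apply]
    module
  have hbase := hasFDerivAt_integral_of_dominated_of_fderiv_le
    (μ := volume.restrict (Set.Ioo (0 : ℝ) 1)) (𝕜 := ℝ)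
    (F := fun y θ => w θ • U (B₀ y + θ • B₁ y))
    (F' := fun y θ => w θ • (fderiv ℝ U (B₀ y + θ • B₁ y)).comp (B₀ + θ • B₁))
    (x₀ := x) (s := Set.univ) (bound := fun θ => |w θ| * (C * (‖B₀‖ + ‖B₁‖))) univ_mem
    (Eventually.of_forall fun y => (integrable_pencil hw U y).1) (integrable_pencil hw U x)
    ?_ ?_ ?_ ?_
  · simp only [key]
    exact hbase
  · have h := (integrable_pencil (B₀ := B₀) (B₁ := B₁) hw (SchwartzMap.postcompCLM (𝕜 := ℝ)
          ((ContinuousLinearMap.compL ℝ E E' F).flip B₀) (SchwartzMap.fderivCLM ℝ E' F U)) x).add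
      (integrable_pencil (B₀ := B₀) (B₁ := B₁) hw' (SchwartzMap.postcompCLM (𝕜 := ℝ)
          ((ContinuousLinearMap.compL ℝ E E' F).flip B₁) (SchwartzMap.fderivCLM ℝ E' F U)) x)
    refine h.1.congr (Eventually.of_forall fun θ => ?_)
    exact key θ x
  · filter_upwards [ae_restrict_mem measurableSet_Ioo] with θ hθ y _
    rw [norm_smul, Real.norm_eq_abs]
    gcongr
    refine (ContinuousLinearMap.opNorm_comp_le _ _).trans ?_
    gcongr
    · exact hC.1.le
    · exact hC.2 _
    · refine (norm_add_le _ _).trans ?_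
      gcongr
      rw [norm_smul, Real.norm_of_nonneg hθ.1.le]
      exact mul_le_of_le_one_left (norm_nonneg _) hθ.2.le
  · exact hw.abs.mul_const _
  · refine Eventually.of_forall fun θ y _ => ?_
    have h1 : HasFDerivAt (fun y => B₀ y + θ • B₁ y) (B₀ + θ • B₁) y :=
      (B₀ + θ • B₁).hasFDerivAt
    exact ((U.differentiable _).hasFDerivAt.comp y h1).const_smul (w θ)

/-- The target space, the weight and the function are quantified inside the induction, since each
derivative changes all three. The hypothesis transfers the decay of U to x uniformly in θ. -/
theorem pencilAvg_smooth_decay (n : ℕ)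
    (hc : ∀ θ ∈ Set.Ioo (0 : ℝ) 1, ∀ x, ‖x‖ ≤ c * ‖B₀ x + θ • B₁ x‖) :
    ∀ {F : Type} [NormedAddCommGroup F] [NormedSpace ℝ F] {w : ℝ → ℝ}
      (_ : IntegrableOn w (Set.Ioo 0 1)) (U : 𝓢(E', F)),
      ContDiff ℝ n (pencilAvg B₀ B₁ w U) ∧
        ∀ k, ∃ C, ∀ x, ‖x‖ ^ k * ‖iteratedFDeriv ℝ n (pencilAvg B₀ B₁ w U) x‖ ≤ C := by
  induction n with
  | zero =>
    intro F _ _ w hw U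
    refine ⟨contDiff_zero.mpr ?_, fun k => ?_⟩
    · exact continuous_iff_continuousAt.mpr fun x => (hasFDerivAt_pencilAvg hw U x).continuousAt
    · simp only [norm_iteratedFDeriv_zero]
      exact norm_pencilAvg_le hw hc U k
  | succ n ih =>
    intro F _ _ w hw U
    have hw' : IntegrableOn (fun θ => θ * w θ) (Set.Ioo 0 1) := by
      refine Integrable.bdd_mul (c := 1) hw (by fun_prop) ?_
      filter_upwards [ae_restrict_mem measurableSet_Ioo] with θ hθ
      rw [Real.norm_of_nonneg hθ.1.le]
      exact hθ.2.le
    have hd := hasFDerivAt_pencilAvg (B₀ := B₀) (B₁ := B₁) hw U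
    have hf := funext fun x => (hd x).fderiv
    obtain ⟨s0, d0⟩ := ih hw (SchwartzMap.postcompCLM (𝕜 := ℝ)
      ((ContinuousLinearMap.compL ℝ E E' F).flip B₀) (SchwartzMap.fderivCLM ℝ E' F U))
    obtain ⟨s1, d1⟩ := ih hw' (SchwartzMap.postcompCLM (𝕜 := ℝ)
      ((ContinuousLinearMap.compL ℝ E E' F).flip B₁) (SchwartzMap.fderivCLM ℝ E' F U))
    refine ⟨?_, fun k => ?_⟩
    · have := (contDiff_succ_iff_fderiv (𝕜 := ℝ) (n := n) (f := pencilAvg B₀ B₁ w U)).mpr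
        ⟨fun x => (hd x).differentiableAt, fun h => by simp at h, by rw [hf]; exact s0.add s1⟩
      exact_mod_cast this
    · obtain ⟨C, hC⟩ := d0 k
      obtain ⟨D, hD⟩ := d1 k
      refine ⟨C + D, fun x => ?_⟩
      rw [← norm_iteratedFDeriv_fderiv, hf]
      refine (mul_le_mul_of_nonneg_left (congrArg norm
        (iteratedFDeriv_add_apply s0.contDiffAt s1.contDiffAt)).le (by positivity)).trans ?_
      refine (mul_le_mul_of_nonneg_left (norm_add_le _ _) (by positivity)).trans ?_
      rw [mul_add]
      exact add_le_add (hC x) (hD x)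

/-- `pencilAvg` as a Schwartz function. -/
def pencilAvgS {F : Type} [NormedAddCommGroup F] [NormedSpace ℝ F] {w : ℝ → ℝ}
    (hc : ∀ θ ∈ Set.Ioo (0 : ℝ) 1, ∀ x, ‖x‖ ≤ c * ‖B₀ x + θ • B₁ x‖)
    (hw : IntegrableOn w (Set.Ioo 0 1)) (U : 𝓢(E', F)) : 𝓢(E, F) where
  toFun := pencilAvg B₀ B₁ w U
  smooth' := contDiff_infty.mpr fun n => (pencilAvg_smooth_decay n hc hw U).1
  decay' k n := (pencilAvg_smooth_decay n hc hw U).2 k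

end Average

/-! ### Negative powers of `Ξ₊` on `e⁺(x_n^b φ)` -/

section BetaWeight

theorem ofReal_betaWeight {b c : ℝ} {θ : ℝ} (hθ : θ ∈ Set.Ioo (0 : ℝ) 1) :
    (θ : ℂ) ^ (((b + 1 : ℝ) : ℂ) - 1) * (1 - (θ : ℂ)) ^ ((c : ℂ) - 1) =
      ((θ ^ b * (1 - θ) ^ (c - 1) : ℝ) : ℂ) := by
  rw [Complex.ofReal_mul, Complex.ofReal_cpow hθ.1.le, Complex.ofReal_cpow (by linarith [hθ.2])]
  push_cast
  congr 2
  ring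

theorem integrableOn_betaWeight {b c : ℝ} (hb : -1 < b) (hc : 0 < c) :
    IntegrableOn (fun θ : ℝ => θ ^ b * (1 - θ) ^ (c - 1)) (Set.Ioo 0 1) := by
  have h := Complex.betaIntegral_convergent (u := ((b + 1 : ℝ) : ℂ)) (v := (c : ℂ))
    (by rw [Complex.ofReal_re]; linarith) (by simpa using hc)
  rw [intervalIntegrable_iff_integrableOn_Ioo_of_le zero_le_one] at h
  have h2 : IntegrableOn (fun θ : ℝ => ((θ ^ b * (1 - θ) ^ (c - 1) : ℝ) : ℂ)) (Set.Ioo 0 1) :=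
    h.congr_fun (fun θ hθ => ofReal_betaWeight hθ) measurableSet_Ioo
  have h3 := h2.re
  simp only [RCLike.re_to_complex, Complex.ofReal_re] at h3
  exact h3

theorem integral_betaWeight {b c : ℝ} (hb : -1 < b) (hc : 0 < c) :
    ∫ θ in Set.Ioo (0 : ℝ) 1, θ ^ b * (1 - θ) ^ (c - 1) =
      Real.Gamma (b + 1) * Real.Gamma c / Real.Gamma (b + c + 1) := by
  have h := Complex.Gamma_mul_Gamma_eq_betaIntegral (s := ((b + 1 : ℝ) : ℂ)) (t := (c : ℂ))
    (by rw [Complex.ofReal_re]; linarith) (by simpa using hc)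
  rw [Complex.betaIntegral, intervalIntegral.integral_of_le zero_le_one,
    integral_Ioc_eq_integral_Ioo, setIntegral_congr_fun measurableSet_Ioo
      (fun θ hθ => ofReal_betaWeight hθ), integral_complex_ofReal, ← Complex.ofReal_add,
    Complex.Gamma_ofReal, Complex.Gamma_ofReal, Complex.Gamma_ofReal] at h
  have h2 : Real.Gamma (b + 1) * Real.Gamma c = Real.Gamma (b + 1 + c) *
      ∫ θ in Set.Ioo (0 : ℝ) 1, θ ^ b * (1 - θ) ^ (c - 1) := by exact_mod_cast h
  have h3 : Real.Gamma (b + c + 1) ≠ 0 := (Real.Gamma_pos_of_pos (by linarith)).ne'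
  rw [show b + 1 + c = b + c + 1 by ring] at h2
  rw [h2]
  field_simp

end BetaWeight

/-! ### A change of variables on the quadrant. -/

section ChangeOfVariables

/-- Polar-type coordinates `(y, r) = (θz, (1-θ)z)` on the quadrant. -/
theorem integral_quadrant {F : ℝ → ℝ → ℂ}
    (hF : IntegrableOn (fun p : ℝ × ℝ => F p.1 p.2) (Set.Ioi 0 ×ˢ Set.Ioi 0)
      (volume.prod volume)) :
    ∫ y in Set.Ioi (0 : ℝ), ∫ r in Set.Ioi (0 : ℝ), F y r =
      ∫ z in Set.Ioi (0 : ℝ), (z : ℂ) *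
        ∫ θ in Set.Ioo (0 : ℝ) 1, F (z * θ) (z * (1 - θ)) := by
  set G : ℝ × ℝ → ℂ := (Set.Ioi (0 : ℝ) ×ˢ Set.Ioi (0 : ℝ)).indicator fun p => F p.1 p.2 with hG
  have hms : MeasurableSet (Set.Ioi (0 : ℝ) ×ˢ Set.Ioi (0 : ℝ)) :=
    measurableSet_Ioi.prod measurableSet_Ioi
  have hGi : Integrable G (volume.prod volume) := (integrable_indicator_iff hms).mpr hF
  -- The shear z = y + r preserves measure. After Fubini, y runs over (0, z), and y = zθ supplies
  -- the Jacobian z.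
  have hGs : Integrable (Function.uncurry fun y z : ℝ => G (y, -y + z)) (volume.prod volume) :=
    (measurePreserving_prod_neg_add (volume : Measure ℝ) (volume : Measure ℝ)
      ).integrable_comp_of_integrable hGi
  have e1 : ∫ y in Set.Ioi (0 : ℝ), ∫ r in Set.Ioi (0 : ℝ), F y r = ∫ y, ∫ r, G (y, r) := by
    rw [← integral_indicator measurableSet_Ioi]
    refine integral_congr_ae (Eventually.of_forall fun y => ?_)
    by_cases hy : y ∈ Set.Ioi (0 : ℝ)
    · simp only [Set.indicator_of_mem hy]
      rw [← integral_indicator measurableSet_Ioi]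
      refine integral_congr_ae (Eventually.of_forall fun r => ?_)
      by_cases hr : r ∈ Set.Ioi (0 : ℝ)
      · simp only [Set.indicator_of_mem hr]
        rw [hG, Set.indicator_of_mem (Set.mk_mem_prod hy hr)]
      · simp only [Set.indicator_of_notMem hr]
        rw [hG, Set.indicator_of_notMem fun h => hr h.2]
    · simp only [Set.indicator_of_notMem hy]
      rw [eq_comm]
      refine integral_eq_zero_of_ae (Eventually.of_forall fun r => ?_)
      simp only [hG]
      rw [Set.indicator_of_notMem fun h => hy h.1, Pi.zero_apply]
  have e2 : ∀ y, ∫ r, G (y, r) = ∫ z, G (y, -y + z) := fun y =>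
    (integral_add_left_eq_self (fun r => G (y, r)) (-y)).symm
  rw [e1]
  simp only [e2]
  rw [integral_integral_swap hGs, ← integral_indicator measurableSet_Ioi]
  refine integral_congr_ae (Eventually.of_forall fun z => ?_)
  have e3 : ∀ y, G (y, -y + z) = (Set.Ioo 0 z).indicator (fun y => F y (z - y)) y := fun y => by
    by_cases h : y ∈ Set.Ioo 0 z
    · rw [Set.indicator_of_mem h, hG, Set.indicator_of_mem]
      · ring_nf
      · exact Set.mk_mem_prod h.1 (by simpa using h.2)
    · rw [Set.indicator_of_notMem h, hG, Set.indicator_of_notMem]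
      rintro ⟨h1, h2⟩
      refine h ⟨h1, ?_⟩
      simp only [Set.mem_Ioi] at h2
      linarith
  simp only [e3]
  by_cases hz : z ∈ Set.Ioi (0 : ℝ)
  · have hz0 : 0 < z := hz
    simp only [Set.indicator_of_mem hz]
    have h := Measure.integral_comp_mul_left ((Set.Ioo 0 z).indicator (fun y => F y (z - y))) z
    rw [abs_of_pos (inv_pos.mpr hz0)] at h
    have e4 : ∫ θ in Set.Ioo (0 : ℝ) 1, F (z * θ) (z * (1 - θ)) =
        ∫ θ, (Set.Ioo 0 z).indicator (fun y => F y (z - y)) (z * θ) := by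
      rw [← integral_indicator measurableSet_Ioo]
      refine integral_congr_ae (Eventually.of_forall fun θ => ?_)
      have hiff : z * θ ∈ Set.Ioo 0 z ↔ θ ∈ Set.Ioo (0 : ℝ) 1 := by
        simp only [Set.mem_Ioo]
        constructor
        · rintro ⟨h1, h2⟩
          exact ⟨pos_of_mul_pos_right h1 hz0.le, by nlinarith⟩
        · rintro ⟨h1, h2⟩
          exact ⟨by positivity, by nlinarith⟩
      by_cases hθ : θ ∈ Set.Ioo (0 : ℝ) 1
      · simp only [Set.indicator_of_mem hθ, Set.indicator_of_mem (hiff.mpr hθ)]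
        ring_nf
      · rw [Set.indicator_of_notMem hθ]
        exact (Set.indicator_of_notMem (fun h => hθ (hiff.mp h)) _).symm
    rw [e4, h, Complex.real_smul, ← mul_assoc, ← Complex.ofReal_mul, mul_inv_cancel₀ hz0.ne',
      Complex.ofReal_one, one_mul]
  · have hz0 : z ≤ 0 := not_lt.mp hz
    rw [Set.indicator_of_notMem hz, Set.Ioo_eq_empty (by simpa using hz0)]
    simp

end ChangeOfVariables

/-! ### The Schwartz coefficient produced by a negative power of Ξ₊. -/

section Pencil

variable {m : ℕ}

/-- `x ↦ (x', 0, x_n)`. -/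
def pencilStart (m : ℕ) : Rd (m + 1) →L[ℝ] Rd (m + 1 + 1) :=
  boundary (m + 1) ∘L boundary m ∘L tangential m + (normal m).smulRight (normalVec (m + 1))

/-- `x ↦ (0, x_n, -x_n)`. -/
def pencilStep (m : ℕ) : Rd (m + 1) →L[ℝ] Rd (m + 1 + 1) :=
  (normal m).smulRight (boundary (m + 1) (normalVec m) - normalVec (m + 1))

theorem pencil_apply (x : Rd (m + 1)) (θ : ℝ) :
    pencilStart m x + θ • pencilStep m x =
      join (join (tangential m x) (normal m x * θ)) (normal m x * (1 - θ)) := by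
  simp only [pencilStart, pencilStep, join, add_apply, ContinuousLinearMap.smulRight_apply,
    ContinuousLinearMap.comp_apply, map_add, map_smul]
  module

/-- The normal coordinate is split into x_nθ and x_n(1-θ), and θ² + (1-θ)² ≥ 1/2. -/
theorem norm_le_pencil (θ : ℝ) (x : Rd (m + 1)) :
    ‖x‖ ≤ 2 * ‖pencilStart m x + θ • pencilStep m x‖ := by
  refine le_of_sq_le_sq ?_ (by positivity)
  rw [mul_pow, pencil_apply, norm_sq_split (join _ _), tangential_join, normal_join,
    norm_sq_split (join _ _), tangential_join, normal_join, norm_sq_split x]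
  nlinarith [sq_nonneg (‖tangential m x‖), sq_nonneg (normal m x),
    sq_nonneg (normal m x * (2 * θ - 1))]

/-- The function `φ'` with `Ξ₊^{-c} e⁺(x_n^b φ) = e⁺(x_n^{b+c} φ')`. -/
def powShift {b c : ℝ} (hb : -1 < b) (hc : 0 < c) (φ : 𝓢(Rd (m + 1), ℂ)) : 𝓢(Rd (m + 1), ℂ) :=
  ((Real.Gamma c : ℝ) : ℂ)⁻¹ • pencilAvgS (fun θ _ x => norm_le_pencil θ x)
    (integrableOn_betaWeight hb hc) (poissonExt φ)

theorem powShift_apply {b c : ℝ} (hb : -1 < b) (hc : 0 < c) (φ : 𝓢(Rd (m + 1), ℂ)) (x : Rd m)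
    (z : ℝ) : powShift hb hc φ (join x z) = ((Real.Gamma c : ℝ) : ℂ)⁻¹ *
      ∫ θ in Set.Ioo (0 : ℝ) 1, ((θ ^ b * (1 - θ) ^ (c - 1) : ℝ) : ℂ) *
        tPoisson m (z * (1 - θ)) φ (join x (z * θ)) := by
  rw [powShift, smul_apply, smul_eq_mul]
  congr 1
  change pencilAvg _ _ _ _ _ = _
  simp only [pencilAvg, pencil_apply, tangential_join, normal_join, poissonExt_join,
    Complex.real_smul]

theorem tPoisson_zero (φ : 𝓢(Rd (m + 1), ℂ)) : tPoisson m 0 φ = φ := by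
  have h : (fun ξ : Rd (m + 1) => poissonSymbol m 0 (tangential m ξ)) = fun _ => 1 := by
    ext ξ
    rw [poissonSymbol_apply le_rfl]
    simp
  rw [tPoisson, h]
  simp

/-- At x_n = 0 the damping operator is the identity and only the beta integral B(b+1, c) remains,
divided by Γ(c). -/
theorem schwartzTrace_powShift {b c : ℝ} (hb : -1 < b) (hc : 0 < c) (φ : 𝓢(Rd (m + 1), ℂ)) :
    schwartzTrace m (powShift hb hc φ) =
      ((Real.Gamma (b + 1) / Real.Gamma (b + c + 1) : ℝ) : ℂ) • schwartzTrace m φ := by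
  ext x
  rw [smul_apply, schwartzTrace_apply, schwartzTrace_apply, powShift_apply]
  simp only [zero_mul, tPoisson_zero]
  rw [integral_mul_const, integral_complex_ofReal, integral_betaWeight hb hc, smul_eq_mul,
    ← mul_assoc, ← Complex.ofReal_inv, ← Complex.ofReal_mul]
  congr 2
  have h := (Real.Gamma_pos_of_pos hc).ne'
  field_simp

end Pencil

/-! ### Negative powers of Ξ₊ tested against Schwartz functions. -/

section StripIntegral

variable {m : ℕ}

/-- `∫ φ(x', y) (e^{-r⟨D'⟩}χ)(x', y + r) dx'`. -/
def stripInt (φ χ : 𝓢(Rd (m + 1), ℂ)) (y r : ℝ) : ℂ :=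
  ∫ x : Rd m, φ (join x y) * tPoisson m r χ (join x (y + r))

/-- e^{-r⟨D'⟩} equals its own transpose, its symbol being even, so it can be moved from the test
function to φ, where `powShift` needs it. -/
theorem stripInt_comm (φ χ : 𝓢(Rd (m + 1), ℂ)) (y r : ℝ) :
    stripInt φ χ y r = ∫ x : Rd m, tPoisson m r φ (join x y) * χ (join x (y + r)) := by
  simp only [stripInt, ← slice_apply, slice_tPoisson]
  rw [poisson, integral_multiplier_mul (hasTemperateGrowth_poissonSymbol r)]
  simp only [poissonSymbol, kappa_neg]
  rfl

theorem norm_stripInt_le (φ χ : 𝓢(Rd (m + 1), ℂ)) (y : ℝ) {r : ℝ} (hr : 0 ≤ r) :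
    ‖stripInt φ χ y r‖ ≤ (∫ x : Rd m, ‖φ (join x y)‖) * (Real.exp (-r) * ∫ ξ, ‖𝓕 χ ξ‖) := by
  rw [stripInt, ← integral_mul_const]
  refine norm_integral_le_of_norm_le ((integrable_slice φ y).norm.mul_const _)
    (Eventually.of_forall fun x => ?_)
  rw [norm_mul]
  gcongr
  exact norm_tPoisson_le hr χ _

theorem stronglyMeasurable_stripInt (φ χ : 𝓢(Rd (m + 1), ℂ)) :
    StronglyMeasurable fun p : ℝ × ℝ => stripInt φ χ p.1 p.2 := by
  simp only [stripInt, ← poissonExt_join]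
  refine StronglyMeasurable.integral_prod_right
    (f := fun (p : ℝ × ℝ) (x : Rd m) => φ (join x p.1) *
      poissonExt χ (join (join x (p.1 + p.2)) p.2)) (Continuous.stronglyMeasurable ?_)
  have h1 := φ.continuous
  have h2 := (poissonExt χ).continuous
  unfold Function.uncurry
  fun_prop

theorem integrableOn_stripInt {b c : ℝ} (hb : -1 < b) (hc : 0 < c) (φ χ : 𝓢(Rd (m + 1), ℂ)) :
    IntegrableOn (fun p : ℝ × ℝ => ((p.1 ^ b * p.2 ^ (c - 1) : ℝ) : ℂ) * stripInt φ χ p.1 p.2)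
      (Set.Ioi 0 ×ˢ Set.Ioi 0) (volume.prod volume) := by
  obtain ⟨l, hl⟩ := exists_nat_gt (b + 1)
  obtain ⟨C, hC0, hC⟩ := exists_fiberInt_decay φ l
  have h := (integrableOn_rpow_mul_decay hb hl).mul_prod (integrableOn_rpow_mul_exp hc)
  rw [Measure.prod_restrict] at h
  refine (h.mul_const (C * ∫ ξ, ‖𝓕 χ ξ‖)).mono' ?_ ?_
  · have := (stronglyMeasurable_stripInt φ χ).measurable
    exact Measurable.aestronglyMeasurable (by fun_prop)
  · filter_upwards [ae_restrict_mem (measurableSet_Ioi.prod measurableSet_Ioi)] with p hp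
    have h1 : 0 < p.1 := hp.1
    have h2 : 0 < p.2 := hp.2
    rw [norm_mul, Complex.norm_real, Real.norm_of_nonneg (by positivity)]
    calc _ ≤ p.1 ^ b * p.2 ^ (c - 1) * ((C * ((1 + |p.1|) ^ l)⁻¹) *
          (Real.exp (-p.2) * ∫ ξ, ‖𝓕 χ ξ‖)) := by
          gcongr
          refine (norm_stripInt_le φ χ p.1 h2.le).trans ?_
          gcongr
          exact hC p.1
      _ = _ := by ring

theorem fiberInt_prodS_sgnOp_neg {c : ℝ} (hc : 0 < c) (φ χ : 𝓢(Rd (m + 1), ℂ)) (y : ℝ) :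
    fiberInt (prodS φ (sgnOp m (-1) (-c) χ)) y = ((Real.Gamma c : ℝ) : ℂ)⁻¹ *
      ∫ r in Set.Ioi (0 : ℝ), ((r ^ (c - 1) : ℝ) : ℂ) * stripInt φ χ y r := by
  have e : ∀ (x : Rd m) (r : ℝ), join x y - ((-1 : ℝ) * r) • normalVec m = join x (y + r) :=
    fun x r => by simp only [join]; module
  have hint : Integrable (Function.uncurry fun (x : Rd m) (r : ℝ) =>
      ((r ^ (c - 1) : ℝ) : ℂ) * (φ (join x y) * tPoisson m r χ (join x (y + r))))
      (volume.prod (volume.restrict (Set.Ioi 0))) := by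
    have h := (integrable_slice φ y).norm.mul_prod (integrableOn_rpow_mul_exp hc)
    refine (h.mul_const (∫ ξ, ‖𝓕 χ ξ‖)).mono' ?_ ?_
    · simp only [← poissonExt_join]
      have h1 := φ.continuous
      have h2 := (poissonExt χ).continuous
      have h3 : Continuous fun p : Rd m × ℝ =>
          φ (join p.1 y) * poissonExt χ (join (join p.1 (y + p.2)) p.2) := by fun_prop
      have h4 := h3.measurable
      refine Measurable.aestronglyMeasurable ?_
      unfold Function.uncurry
      fun_prop
    · have hae : ∀ᵐ p : Rd m × ℝ ∂(volume.prod (volume.restrict (Set.Ioi 0))),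
          p.2 ∈ Set.Ioi (0 : ℝ) :=
        Measure.quasiMeasurePreserving_snd.ae (ae_restrict_mem measurableSet_Ioi)
      filter_upwards [hae] with p hp
      have hp0 : 0 < p.2 := hp
      simp only [Function.uncurry]
      rw [norm_mul, norm_mul, Complex.norm_real, Real.norm_of_nonneg (by positivity)]
      calc _ ≤ p.2 ^ (c - 1) * (‖φ (join p.1 y)‖ * (Real.exp (-p.2) * ∫ ξ, ‖𝓕 χ ξ‖)) := by
            gcongr
            exact norm_tPoisson_le hp0.le χ _
        _ = _ := by ring
  have h := integral_integral_swap hint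
  simp only [integral_const_mul] at h
  simp only [stripInt]
  rw [← h, ← integral_const_mul]
  refine integral_congr_ae (Eventually.of_forall fun x => ?_)
  simp only
  rw [prodS_apply, sgnOp_neg_apply (-1) hc, mul_left_comm, ← integral_const_mul]
  congr 1
  refine integral_congr_ae (Eventually.of_forall fun r => ?_)
  simp only [e]
  ring

theorem fiberInt_prodS_powShift {b c : ℝ} (hb : -1 < b) (hc : 0 < c) (φ χ : 𝓢(Rd (m + 1), ℂ))
    (z : ℝ) : fiberInt (prodS (powShift hb hc φ) χ) z = ((Real.Gamma c : ℝ) : ℂ)⁻¹ *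
      ∫ θ in Set.Ioo (0 : ℝ) 1, ((θ ^ b * (1 - θ) ^ (c - 1) : ℝ) : ℂ) *
        stripInt φ χ (z * θ) (z * (1 - θ)) := by
  have e : ∀ θ : ℝ, z * θ + z * (1 - θ) = z := fun θ => by ring
  have hint : Integrable (Function.uncurry fun (x : Rd m) (θ : ℝ) =>
      ((θ ^ b * (1 - θ) ^ (c - 1) : ℝ) : ℂ) *
        (tPoisson m (z * (1 - θ)) φ (join x (z * θ)) * χ (join x z)))
      (volume.prod (volume.restrict (Set.Ioo 0 1))) := by
    obtain ⟨C, hC0, hC⟩ := (poissonExt φ).decay 0 0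
    simp only [pow_zero, one_mul, norm_iteratedFDeriv_zero] at hC
    have hw : IntegrableOn (fun θ : ℝ => ((θ ^ b * (1 - θ) ^ (c - 1) : ℝ) : ℂ)) (Set.Ioo 0 1) :=
      (integrableOn_betaWeight hb hc).ofReal
    have h := (integrable_slice χ z).mul_prod hw
    have h2 := h.mul_bdd (c := C)
      (g := fun p : Rd m × ℝ => poissonExt φ (join (join p.1 (z * p.2)) (z * (1 - p.2)))) ?_
      (Eventually.of_forall fun p => hC _)
    · refine h2.congr (Eventually.of_forall fun p => ?_)
      simp only [Function.uncurry, poissonExt_join]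
      push_cast
      ring
    · have h1 := (poissonExt φ).continuous
      exact Continuous.aestronglyMeasurable (by fun_prop)
  have h := integral_integral_swap hint
  simp only [integral_const_mul] at h
  simp only [stripInt_comm, e]
  rw [← h, ← integral_const_mul]
  refine integral_congr_ae (Eventually.of_forall fun x => ?_)
  simp only
  rw [prodS_apply, powShift_apply, mul_assoc, ← integral_mul_const]
  congr 1
  refine integral_congr_ae (Eventually.of_forall fun θ => ?_)
  simp only
  ring

/-- Negative powers of `Ξ₊` raise the order of vanishing at the boundary. -/
theorem sgnDOp_neg_powDist {b c : ℝ} (hb : -1 < b) (hc : 0 < c) (φ : 𝓢(Rd (m + 1), ℂ)) :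
    sgnDOp m 1 (-c) (powDist m b φ) = powDist m (b + c) (powShift hb hc φ) := by
  ext χ
  rw [sgnDOp_apply, powDist_apply hb, powDist_apply (by linarith)]
  simp only [fiberInt_prodS_sgnOp_neg hc, fiberInt_prodS_powShift, mul_left_comm _ (_ : ℂ)⁻¹]
  rw [integral_const_mul, integral_const_mul]
  congr 1
  -- The two sides are integrals of the same `stripInt`, in coordinates (y, r) and (θ, z) with y =
  -- zθ, r = z(1-θ). The powers combine as z·(zθ)^b (z(1-θ))^{c-1} = z^{b+c} θ^b (1-θ)^{c-1}.
  have h := integral_quadrant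
    (F := fun y r => ((y ^ b * r ^ (c - 1) : ℝ) : ℂ) * stripInt φ χ y r)
    (integrableOn_stripInt hb hc φ χ)
  have e1 : ∀ y : ℝ, ((y ^ b : ℝ) : ℂ) *
      ∫ r in Set.Ioi (0 : ℝ), ((r ^ (c - 1) : ℝ) : ℂ) * stripInt φ χ y r =
      ∫ r in Set.Ioi (0 : ℝ), ((y ^ b * r ^ (c - 1) : ℝ) : ℂ) * stripInt φ χ y r := fun y => by
    rw [← integral_const_mul]
    refine integral_congr_ae (Eventually.of_forall fun r => ?_)
    simp only
    push_cast
    ring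
  simp only [e1]
  rw [h]
  refine setIntegral_congr_fun measurableSet_Ioi fun z hz => ?_
  have hz0 : 0 < z := hz
  rw [← integral_const_mul, ← integral_const_mul]
  refine setIntegral_congr_fun measurableSet_Ioo fun θ hθ => ?_
  rw [← mul_assoc, ← mul_assoc, ← Complex.ofReal_mul, ← Complex.ofReal_mul]
  congr 2
  have h1 : 0 ≤ 1 - θ := by linarith [hθ.2]
  rw [Real.mul_rpow hz0.le hθ.1.le, Real.mul_rpow hz0.le h1, Real.rpow_add hz0,
    Real.rpow_sub_one hz0.ne' c]
  field_simp

end StripIntegral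

/-! ### Real powers of `Ξ₊` on `e⁺(x_n^b φ)` -/

section Powers

variable {m : ℕ}

/-- Each application of Ξ₊ lowers the exponent by one and multiplies the trace by the exponent lost,
so the factors telescope to a quotient of Gamma values. -/
theorem exists_sgnDOp_nat_powDist (k : ℕ) {b : ℝ} (hb : -1 < b) (φ : 𝓢(Rd (m + 1), ℂ)) :
    ∃ φ' : 𝓢(Rd (m + 1), ℂ), sgnDOp m 1 k (powDist m (b + k) φ) = powDist m b φ' ∧
      schwartzTrace m φ' =
        ((Real.Gamma (b + k + 1) / Real.Gamma (b + 1) : ℝ) : ℂ) • schwartzTrace m φ := by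
  induction k generalizing φ with
  | zero =>
    have h : Real.Gamma (b + 1) ≠ 0 := (Real.Gamma_pos_of_pos (by linarith)).ne'
    refine ⟨φ, by simp [sgnDOp_zero], ?_⟩
    simp [h]
  | succ k ih =>
    have hk : 0 < b + (k + 1 : ℕ) := by
      push_cast
      linarith [(Nat.cast_nonneg k : (0 : ℝ) ≤ k)]
    obtain ⟨φ', h1, h2⟩ := ih (((b + (k + 1 : ℕ) : ℝ) : ℂ) • φ + normalMul m (sgnOp m 1 1 φ))
    refine ⟨φ', ?_, ?_⟩
    · rw [Nat.cast_succ, ← sgnDOp_sgnDOp, ← h1, ← Nat.cast_succ, sgnDOp_one_powDist hk]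
      congr 2
      push_cast
      ring
    · have h3 : schwartzTrace m (((b + (k + 1 : ℕ) : ℝ) : ℂ) • φ + normalMul m (sgnOp m 1 1 φ)) =
          ((b + (k + 1 : ℕ) : ℝ) : ℂ) • schwartzTrace m φ := by
        ext x
        simp [schwartzTrace_apply, normalMul_apply]
      rw [h2, h3, smul_smul, ← Complex.ofReal_mul]
      congr 2
      have h4 : b + (k + 1 : ℕ) = b + k + 1 := by push_cast; ring
      rw [h4] at hk ⊢
      rw [Real.Gamma_add_one hk.ne']
      ring

/-- Write s = k - c with an integer k > s: the exponent is first raised by c and then lowered k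
times. This order never leaves the exponents above -1, and Γ(b+c+1) cancels from the trace factor.
-/
theorem exists_sgnDOp_powDist {b s : ℝ} (hb : -1 < b) (hbs : -1 < b - s)
    (φ : 𝓢(Rd (m + 1), ℂ)) :
    ∃ φ' : 𝓢(Rd (m + 1), ℂ), sgnDOp m 1 s (powDist m b φ) = powDist m (b - s) φ' ∧
      schwartzTrace m φ' =
        ((Real.Gamma (b + 1) / Real.Gamma (b - s + 1) : ℝ) : ℂ) • schwartzTrace m φ := by
  obtain ⟨k, hk⟩ := exists_nat_gt s
  have hc : 0 < k - s := sub_pos.mpr hk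
  obtain ⟨φ', h1, h2⟩ := exists_sgnDOp_nat_powDist k hbs (powShift hb hc φ)
  refine ⟨φ', ?_, ?_⟩
  · rw [← h1, show b - s + k = b + (k - s) by ring, ← sgnDOp_neg_powDist, sgnDOp_sgnDOp]
    congr 2
    ring
  · have h3 : Real.Gamma (b + (k - s) + 1) ≠ 0 := (Real.Gamma_pos_of_pos (by linarith)).ne'
    rw [h2, schwartzTrace_powShift, smul_smul, ← Complex.ofReal_mul,
      show b - s + k + 1 = b + (k - s) + 1 by ring]
    congr 2
    field_simp

end Powers

/-! ### The trace on the restricted space and the Green formula -/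

section Trace

variable {m : ℕ} {σ r : ℝ}

theorem layer_injective : Function.Injective (layer m) := fun ψ ψ' h => by
  ext χ
  obtain ⟨φ, rfl⟩ := schwartzTrace_surjective χ
  rw [← layer_apply, ← layer_apply, h]

/-- If g vanishes on ℝⁿ₊, so does Ξ₊g, and both truncations in the jump formula are zero; what is
left is a zero layer whose density is the trace. -/
theorem traceMap_eq_zero (hσ : 1 / 2 < σ) (hr : r = σ - 1 / 2)
    {g : SobolevSpace (Rd (m + 1)) σ} (hg : IsVanishingOn g.toDist (upper m)) :
    traceMap m σ r g = 0 := by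
  obtain ⟨s, h1, h2, h3⟩ : ∃ s : ℝ, |s| < 1 / 2 ∧ s ≤ 0 ∧ s ≤ σ - 1 := by
    refine ⟨min (σ - 1) 0, abs_lt.mpr ⟨?_, ?_⟩, min_le_right _ _, min_le_left _ _⟩
    · exact lt_min (by linarith) (by norm_num)
    · exact (min_le_right _ _).trans_lt (by norm_num)
  have h := sgnDOp_one_truncation hσ h1 h2 h3 hr g
  rw [truncation_eq_zero (by norm_num) (by rwa [SobolevSpace.toDist_incl]),
    truncation_eq_zero h1 (by
      rw [SobolevSpace.toDist_incl, toDist_sgnMap]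
      exact isVanishingOn_upper_sgnDOp_one hg 1), map_zero, map_zero, map_zero, zero_add] at h
  refine SobolevSpace.toDist_injective (layer_injective ?_)
  rw [← h, map_zero, map_zero]

/-- For φ with γ₀φ = ψ, Ξ₊⁻¹ applied to the jump formula gives e⁺φ - Ξ₊⁻¹e⁺Ξ₊φ, a difference of L²
functions. -/
theorem memSobolev_sgnDOp_neg_layer (ψ : 𝓢(Rd m, ℂ)) :
    MemSobolev 0 2 (sgnDOp m 1 (-1) (layer m (ψ : 𝓢'(Rd m, ℂ)))) := by
  obtain ⟨φ, rfl⟩ := schwartzTrace_surjective ψ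
  have h := sgnDOp_one_powDist_zero φ
  have h1 : sgnDOp m 1 (-1) (layer m (schwartzTrace m φ : 𝓢'(Rd m, ℂ))) =
      powDist m 0 φ - sgnDOp m 1 (-1) (powDist m 0 (sgnOp m 1 1 φ)) := by
    rw [eq_sub_iff_add_eq, ← map_add, add_comm (layer m _), ← h, sgnDOp_sgnDOp, neg_add_cancel, sgnDOp_zero]
  rw [h1]
  have h2 := (SobolevSpace.incl (zero_le_one' ℝ) (sgnMap (ε := 1) (one_pow 2)
    (by ring : (1 : ℝ) = 0 - (-1)) (SobolevSpace.mk _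
      (memSobolev_powDist_zero (sgnOp m 1 1 φ))))).memSobolev
  rw [SobolevSpace.toDist_incl, toDist_sgnMap, SobolevSpace.toDist_mk] at h2
  exact (memSobolev_powDist_zero φ).sub h2

/-- For Schwartz ψ, Ξ₊⁻¹(ψ ⊗ δ) is in L², is supported above, and agrees with the lift on ℝⁿ₊, so it
is the truncation of the lift. Since Ξ₊ of the lift vanishes on ℝⁿ₊, the jump formula reads ψ ⊗ δ =
γ₀(lift ψ) ⊗ δ. -/
theorem traceMap_lift (hσ : 1 / 2 < σ) (hr : r = σ - 1 / 2) (ψ : SobolevSpace (Rd m) r) :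
    traceMap m σ r (lift hr ψ) = ψ := by
  have hcont : (fun ψ => traceMap m σ r (lift hr ψ)) = id := by
    refine (SobolevSpace.denseRange_ofSchwartz r).equalizer (by fun_prop) continuous_id ?_
    ext1 φ
    simp only [Function.comp_apply, id]
    obtain ⟨s, h1, h2, h3⟩ : ∃ s : ℝ, |s| < 1 / 2 ∧ s ≤ 0 ∧ s ≤ σ - 1 := by
      refine ⟨min (σ - 1) 0, abs_lt.mpr ⟨?_, ?_⟩, min_le_right _ _, min_le_left _ _⟩
      · exact lt_min (by linarith) (by norm_num)
      · exact (min_le_right _ _).trans_lt (by norm_num)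
    have h := sgnDOp_one_truncation hσ h1 h2 h3 hr (lift hr (SobolevSpace.ofSchwartz r φ))
    have h4 := eq_truncation (m := m) (s := 0) (by norm_num)
      (F := SobolevSpace.mk _ (memSobolev_sgnDOp_neg_layer φ))
      (G := SobolevSpace.incl (by linarith : 0 ≤ σ) (lift hr (SobolevSpace.ofSchwartz r φ))) (by
        rw [SobolevSpace.toDist_mk]
        exact isVanishingOn_lower_sgnDOp (isVanishingOn_lower_layer _) _) (by
        rw [SobolevSpace.toDist_mk, SobolevSpace.toDist_incl, toDist_lift,
          SobolevSpace.toDist_ofSchwartz, ← neg_sub]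
        intro χ hχ
        have h5 := isVanishingOn_lift_sub ⌈σ⌉₊ (φ : 𝓢'(Rd m, ℂ)) χ hχ
        change -((_ : 𝓢'(Rd (m + 1), ℂ)) χ) = 0
        rw [h5, neg_zero])
    rw [← h4, SobolevSpace.toDist_mk, sgnDOp_sgnDOp, add_neg_cancel, sgnDOp_zero,
      truncation_eq_zero h1 (by
        rw [SobolevSpace.toDist_incl, toDist_sgnMap, toDist_lift]
        exact isVanishingOn_sgnDOp_lift _ _), map_zero, zero_add] at h
    refine SobolevSpace.toDist_injective ?_
    rw [← layer_injective h, SobolevSpace.toDist_ofSchwartz]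
  exact congrFun hcont ψ

end Trace

/-! ### Transmission spaces as quotients of Sobolev spaces -/

section Transmission

variable {m : ℕ} {μ t : ℝ}

theorem restrict_eq_mk {s : ℝ} (F : zeroExtensions m s) (G : SobolevSpace (Rd (m + 1)) s)
    (h : IsVanishingOn ((F : 𝓢'(Rd (m + 1), ℂ)) - G.toDist) (upper m)) :
    restrict m s F = Submodule.Quotient.mk G := by
  change Submodule.Quotient.mk F.2.2.2.choose = _
  rw [Submodule.Quotient.eq]
  change IsVanishingOn (SobolevSpace.toDist (F.2.2.2.choose - G)) (upper m)
  have h2 := isVanishingOn_sub h F.2.2.2.choose_spec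
  rwa [sub_sub_sub_cancel_left, ← map_sub] at h2

theorem abs_min_lt (hμ : μ - 1 / 2 < t) : |min (t - μ) 0| < 1 / 2 := by
  refine abs_lt.mpr ⟨lt_min (by linarith) (by norm_num), ?_⟩
  exact (min_le_right _ _).trans_lt (by norm_num)

/-- `e⁺r⁺G` as an element of `H^{min(s,0)}`. -/
def zeroExtend (m : ℕ) (s : ℝ) :
    SobolevSpace (Rd (m + 1)) s →L[ℂ] SobolevSpace (Rd (m + 1)) (min s 0) :=
  truncation m (min s 0) ∘L SobolevSpace.incl (min_le_left s 0)

theorem zeroExtend_apply {s : ℝ} (G : SobolevSpace (Rd (m + 1)) s) :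
    zeroExtend m s G = truncation m (min s 0) (SobolevSpace.incl (min_le_left s 0) G) := rfl

theorem zeroExtend_eq_zero (hμ : μ - 1 / 2 < t) {G : SobolevSpace (Rd (m + 1)) (t - μ)}
    (hG : IsVanishingOn G.toDist (upper m)) : zeroExtend m (t - μ) G = 0 := by
  rw [zeroExtend_apply]
  exact truncation_eq_zero (abs_min_lt hμ) (by rwa [SobolevSpace.toDist_incl])

theorem zeroExtend_mem (hμ : μ - 1 / 2 < t) (G : SobolevSpace (Rd (m + 1)) (t - μ)) :
    (zeroExtend m (t - μ) G).toDist ∈ zeroExtensions m (t - μ) := by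
  refine ⟨isVanishingOn_lower_truncation (abs_min_lt hμ) _, SobolevSpace.memSobolev _, G, ?_⟩
  have h := isVanishingOn_upper_truncation_sub (abs_min_lt hμ)
    (SobolevSpace.incl (min_le_left (t - μ) 0) G)
  rwa [SobolevSpace.toDist_incl] at h

theorem exists_eq_zeroExtend (hμ : μ - 1 / 2 < t) {F : 𝓢'(Rd (m + 1), ℂ)}
    (hF : F ∈ zeroExtensions m (t - μ)) :
    ∃ G : SobolevSpace (Rd (m + 1)) (t - μ), F = (zeroExtend m (t - μ) G).toDist := by
  obtain ⟨h1, h2, G, h3⟩ := hF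
  refine ⟨G, ?_⟩
  have h := eq_truncation (abs_min_lt hμ) (F := SobolevSpace.mk F h2)
    (G := SobolevSpace.incl (min_le_left (t - μ) 0) G) (by rwa [SobolevSpace.toDist_mk])
    (by rwa [SobolevSpace.toDist_mk, SobolevSpace.toDist_incl])
  rw [zeroExtend_apply, ← h, SobolevSpace.toDist_mk]

/-- `G ↦ Ξ₊^{-μ}e⁺r⁺G`. -/
def ofSobolev (hμ : μ - 1 / 2 < t) (G : SobolevSpace (Rd (m + 1)) (t - μ)) :
    TransmissionSpace m μ t :=
  (⟨Xi m (-μ) (zeroExtend m (t - μ) G).toDist, _, zeroExtend_mem hμ G, rfl⟩ :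
    transmissionSubmodule m μ t)

theorem toDist_ofSobolev (hμ : μ - 1 / 2 < t) (G : SobolevSpace (Rd (m + 1)) (t - μ)) :
    (ofSobolev hμ G).toDist = sgnDOp m 1 (-μ) (zeroExtend m (t - μ) G).toDist := by
  rw [← Xi_eq_sgnDOp]
  rfl

theorem TransmissionSpace.toDist_injective :
    Function.Injective (TransmissionSpace.toDist : TransmissionSpace m μ t →ₗ[ℂ] _) :=
  Subtype.val_injective

theorem ofSobolev_surjective (hμ : μ - 1 / 2 < t) :
    Function.Surjective (ofSobolev hμ : _ → TransmissionSpace m μ t) := fun u => by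
  obtain ⟨G, hG⟩ := exists_eq_zeroExtend hμ (Xi_mem_zeroExtensions u)
  refine ⟨G, TransmissionSpace.toDist_injective ?_⟩
  rw [toDist_ofSobolev, ← hG, Xi_eq_sgnDOp, sgnDOp_sgnDOp, neg_add_cancel, sgnDOp_zero]

/-- This identifies H^{μ(t)} with its norm as the quotient of H^{t-μ}, which is what makes
`ofSobolevCLM` and `descend` continuous. -/
theorem toRestricted_ofSobolev (hμ : μ - 1 / 2 < t) (G : SobolevSpace (Rd (m + 1)) (t - μ)) :
    (ofSobolev hμ G).toRestricted = Submodule.Quotient.mk G := by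
  refine restrict_eq_mk _ G ?_
  change IsVanishingOn (Xi m μ (ofSobolev hμ G).toDist - G.toDist) (upper m)
  rw [toDist_ofSobolev, Xi_eq_sgnDOp, sgnDOp_sgnDOp, add_neg_cancel, sgnDOp_zero]
  have h := isVanishingOn_upper_truncation_sub (abs_min_lt hμ)
    (SobolevSpace.incl (min_le_left (t - μ) 0) G)
  rwa [SobolevSpace.toDist_incl] at h

theorem ofSobolev_eq_of_sub_mem (hμ : μ - 1 / 2 < t) {G G' : SobolevSpace (Rd (m + 1)) (t - μ)}
    (h : G - G' ∈ restrictionKer m (t - μ)) : ofSobolev hμ G = ofSobolev hμ G' := by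
  refine TransmissionSpace.toDist_injective ?_
  have h2 : zeroExtend m (t - μ) (G - G') = 0 := zeroExtend_eq_zero hμ h
  rw [map_sub, sub_eq_zero] at h2
  rw [toDist_ofSobolev, toDist_ofSobolev, h2]

/-- `ofSobolev` as a continuous linear map. -/
def ofSobolevCLM (hμ : μ - 1 / 2 < t) :
    SobolevSpace (Rd (m + 1)) (t - μ) →L[ℂ] TransmissionSpace m μ t :=
  LinearMap.mkContinuous
    { toFun := ofSobolev hμ
      map_add' := fun G G' => TransmissionSpace.toDist_injective (by
        simp only [map_add, toDist_ofSobolev])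
      map_smul' := fun c G => TransmissionSpace.toDist_injective (by
        simp only [map_smul, toDist_ofSobolev, RingHom.id_apply]) } 1 fun G => by
    rw [one_mul]
    change ‖(ofSobolev hμ G).toRestricted‖ ≤ _
    rw [toRestricted_ofSobolev]
    exact Submodule.Quotient.norm_mk_le _ _

/-- `r⁺Ξ₊^μ` as a continuous linear map. -/
def toRestrictedCLM (m : ℕ) (μ t : ℝ) : TransmissionSpace m μ t →L[ℂ] RestrictedSpace m (t - μ) :=
  LinearMap.mkContinuous TransmissionSpace.toRestricted 1 fun u => (one_mul ‖u‖).ge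

/-- The map `Ξ₊^{-μ}e⁺r⁺G ↦ AG`, if `AG` depends only on `r⁺G`. -/
def descend {X : Type} [SeminormedAddCommGroup X] [NormedSpace ℂ X]
    (A : SobolevSpace (Rd (m + 1)) (t - μ) →L[ℂ] X)
    (hA : ∀ G : SobolevSpace (Rd (m + 1)) (t - μ), IsVanishingOn G.toDist (upper m) → A G = 0) :
    TransmissionSpace m μ t →L[ℂ] X :=
  (restrictionKer m (t - μ)).liftQL A (fun G hG => hA G hG) ∘L toRestrictedCLM m μ t

theorem descend_ofSobolev {X : Type} [SeminormedAddCommGroup X] [NormedSpace ℂ X] (hμ : μ - 1 / 2 < t)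
    (A : SobolevSpace (Rd (m + 1)) (t - μ) →L[ℂ] X)
    (hA : ∀ G : SobolevSpace (Rd (m + 1)) (t - μ), IsVanishingOn G.toDist (upper m) → A G = 0)
    (G : SobolevSpace (Rd (m + 1)) (t - μ)) : descend A hA (ofSobolev hμ G) = A G := by
  change (restrictionKer m (t - μ)).liftQL A (fun G hG => hA G hG) (ofSobolev hμ G).toRestricted = A G
  rw [toRestricted_ofSobolev]
  rfl

end Transmission

/-! ### Comparison of `H^{a(t)}` and `H^{(a-1)(t)}` -/

section Comparison

variable {m : ℕ} {a t r : ℝ}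

/-- `Ξ₊^1` from `H^{t-(a-1)}` to `H^{t-a}`. -/
def xiOne (m : ℕ) (a t : ℝ) :
    SobolevSpace (Rd (m + 1)) (t - (a - 1)) →L[ℂ] SobolevSpace (Rd (m + 1)) (t - a) :=
  sgnMap (ε := 1) (t := 1) (one_pow 2) (by ring)

theorem toDist_xiOne (g : SobolevSpace (Rd (m + 1)) (t - (a - 1))) :
    (xiOne m a t g).toDist = sgnDOp m 1 1 g.toDist := toDist_sgnMap _ _ g

/-- `Ξ₊^{-1}` from `H^{t-a}` to `H^{t-(a-1)}`. -/
def xiInv (m : ℕ) (a t : ℝ) :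
    SobolevSpace (Rd (m + 1)) (t - a) →L[ℂ] SobolevSpace (Rd (m + 1)) (t - (a - 1)) :=
  sgnMap (ε := 1) (t := -1) (one_pow 2) (by ring)

theorem toDist_xiInv (G : SobolevSpace (Rd (m + 1)) (t - a)) :
    (xiInv m a t G).toDist = sgnDOp m 1 (-1) G.toDist := toDist_sgnMap _ _ G

theorem xiOne_xiInv (G : SobolevSpace (Rd (m + 1)) (t - a)) :
    xiOne m a t (xiInv m a t G) = G := SobolevSpace.toDist_injective (by
  rw [toDist_xiOne, toDist_xiInv, sgnDOp_sgnDOp, add_neg_cancel, sgnDOp_zero])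

theorem toDist_zeroExtend_of_nonneg {s : ℝ} (hs : 0 ≤ s) (g : SobolevSpace (Rd (m + 1)) s) :
    (zeroExtend m s g).toDist = (truncation m 0 (SobolevSpace.incl hs g)).toDist := by
  -- The order `min s 0` sits in the type, so it is generalised before being replaced by 0.
  have key : ∀ {p : ℝ} (hp : p ≤ s) (_ : p = 0),
      (truncation m p (SobolevSpace.incl hp g)).toDist =
        (truncation m 0 (SobolevSpace.incl hs g)).toDist := by
    rintro p hp rfl
    rfl
  exact key _ (min_eq_right hs)

theorem toDist_zeroExtend_ofSchwartz {s : ℝ} (hs : 0 ≤ s) (φ : 𝓢(Rd (m + 1), ℂ)) :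
    (zeroExtend m s (SobolevSpace.ofSchwartz s φ)).toDist = powDist m 0 φ := by
  have h : SobolevSpace.incl hs (SobolevSpace.ofSchwartz s φ) = SobolevSpace.ofSchwartz 0 φ :=
    SobolevSpace.toDist_injective (by
      rw [SobolevSpace.toDist_incl, SobolevSpace.toDist_ofSchwartz,
        SobolevSpace.toDist_ofSchwartz])
  rw [toDist_zeroExtend_of_nonneg hs, h, toDist_truncation_ofSchwartz (by norm_num) le_rfl]

theorem sgnDOp_one_zeroExtend (ht : a - 1 / 2 < t) (hr : r = t - (a - 1) - 1 / 2)
    (g : SobolevSpace (Rd (m + 1)) (t - (a - 1))) :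
    sgnDOp m 1 1 (zeroExtend m (t - (a - 1)) g).toDist =
      (zeroExtend m (t - a) (xiOne m a t g)).toDist +
        layer m (traceMap m (t - (a - 1)) r g).toDist := by
  have hle : min (t - a) 0 ≤ t - (a - 1) - 1 := by
    have := min_le_left (t - a) 0
    linarith
  have h := sgnDOp_one_truncation (by linarith) (abs_min_lt ht) (min_le_right _ _) hle hr g
  have e : ∀ (hε : (1 : ℝ) ^ 2 = 1) (h' : t - (a - 1) - 1 = t - (a - 1) - 1),
      SobolevSpace.incl hle (sgnMap hε h' g) =
        SobolevSpace.incl (min_le_left (t - a) 0) (xiOne m a t g) := fun hε h' =>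
    SobolevSpace.toDist_injective (by
      rw [SobolevSpace.toDist_incl, SobolevSpace.toDist_incl, toDist_sgnMap, toDist_xiOne])
  rw [e] at h
  rw [toDist_zeroExtend_of_nonneg (by linarith), zeroExtend_apply]
  exact h

/-- Without a layer the jump formula says that Ξ₊ commutes with e⁺r⁺ on g; applying Ξ₊^{-a} gives
the equality. -/
theorem toDist_ofSobolev_of_traceMap_eq_zero (ht : a - 1 / 2 < t) (ht' : a - 1 - 1 / 2 < t)
    (hr : r = t - (a - 1) - 1 / 2) {g : SobolevSpace (Rd (m + 1)) (t - (a - 1))}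
    (hg : traceMap m (t - (a - 1)) r g = 0) :
    (ofSobolev ht' g).toDist = (ofSobolev ht (xiOne m a t g)).toDist := by
  have h := sgnDOp_one_zeroExtend ht hr g
  rw [hg, map_zero, map_zero, add_zero] at h
  rw [toDist_ofSobolev, toDist_ofSobolev, ← h, sgnDOp_sgnDOp]
  congr 2
  ring

/-- The element of `H^{t-(a-1)}` with vanishing trace that `Ξ₊^1` maps to `G` on `ℝⁿ₊`. -/
def xiInvTraceless (m : ℕ) (a t : ℝ) (hr : r = t - (a - 1) - 1 / 2) :
    SobolevSpace (Rd (m + 1)) (t - a) →L[ℂ] SobolevSpace (Rd (m + 1)) (t - (a - 1)) :=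
  xiInv m a t - lift hr ∘L traceMap m (t - (a - 1)) r ∘L xiInv m a t

theorem xiInvTraceless_apply (hr : r = t - (a - 1) - 1 / 2)
    (G : SobolevSpace (Rd (m + 1)) (t - a)) : xiInvTraceless m a t hr G =
      xiInv m a t G - lift hr (traceMap m (t - (a - 1)) r (xiInv m a t G)) := rfl

theorem traceMap_xiInvTraceless (ht : a - 1 / 2 < t) (hr : r = t - (a - 1) - 1 / 2)
    (G : SobolevSpace (Rd (m + 1)) (t - a)) :
    traceMap m (t - (a - 1)) r (xiInvTraceless m a t hr G) = 0 := by
  rw [xiInvTraceless_apply, map_sub, traceMap_lift (by linarith), sub_self]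

/-- Removing the trace of Ξ₊⁻¹G costs only a lift, and Ξ₊ annihilates lifts on ℝⁿ₊. -/
theorem xiOne_xiInvTraceless_sub_mem (hr : r = t - (a - 1) - 1 / 2)
    (G : SobolevSpace (Rd (m + 1)) (t - a)) :
    xiOne m a t (xiInvTraceless m a t hr G) - G ∈ restrictionKer m (t - a) := by
  rw [xiInvTraceless_apply, map_sub, xiOne_xiInv, sub_sub_cancel_left]
  refine neg_mem ?_
  change IsVanishingOn _ _
  rw [toDist_xiOne, toDist_lift]
  exact isVanishingOn_sgnDOp_lift _ _

theorem toDist_ofSobolev_xiInvTraceless (ht : a - 1 / 2 < t) (ht' : a - 1 - 1 / 2 < t)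
    (hr : r = t - (a - 1) - 1 / 2) (G : SobolevSpace (Rd (m + 1)) (t - a)) :
    (ofSobolev ht' (xiInvTraceless m a t hr G)).toDist = (ofSobolev ht G).toDist := by
  rw [toDist_ofSobolev_of_traceMap_eq_zero ht ht' hr (traceMap_xiInvTraceless ht hr G),
    ofSobolev_eq_of_sub_mem ht (xiOne_xiInvTraceless_sub_mem hr G)]

/-- The inclusion of `H^{a(t)}` into `H^{(a-1)(t)}`. -/
theorem exists_inclusion (ht : a - 1 / 2 < t) (hr : r = t - (a - 1) - 1 / 2) :
    ∃ j : TransmissionSpace m a t →L[ℂ] TransmissionSpace m (a - 1) t,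
      (∀ v, (j v).toDist = v.toDist) ∧ Topology.IsEmbedding j := by
  have ht' : a - 1 - 1 / 2 < t := by linarith
  have hA : ∀ G : SobolevSpace (Rd (m + 1)) (t - a), IsVanishingOn G.toDist (upper m) →
      (ofSobolevCLM ht' ∘L xiInvTraceless m a t hr) G = 0 := fun G hG => by
    refine TransmissionSpace.toDist_injective ?_
    change (ofSobolev ht' (xiInvTraceless m a t hr G)).toDist = _
    rw [toDist_ofSobolev_xiInvTraceless ht ht', toDist_ofSobolev, zeroExtend_eq_zero ht hG]
    simp only [map_zero]
  have hB : ∀ g : SobolevSpace (Rd (m + 1)) (t - (a - 1)), IsVanishingOn g.toDist (upper m) →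
      (ofSobolevCLM ht ∘L xiOne m a t) g = 0 := fun g hg => by
    have h : IsVanishingOn (xiOne m a t g).toDist (upper m) := by
      rw [toDist_xiOne]
      exact isVanishingOn_upper_sgnDOp_one hg 1
    refine TransmissionSpace.toDist_injective ?_
    change (ofSobolev ht (xiOne m a t g)).toDist = _
    rw [toDist_ofSobolev, zeroExtend_eq_zero ht h]
    simp only [map_zero]
  have hj : ∀ G, descend _ hA (ofSobolev ht G) = ofSobolev ht' (xiInvTraceless m a t hr G) :=
    fun G => descend_ofSobolev ht _ hA G
  refine ⟨descend _ hA, fun v => ?_,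
    -- The continuous left inverse sends Ξ₊^{1-a}e⁺r⁺g to Ξ₊^{-a}e⁺r⁺Ξ₊g for every g, of zero trace
    -- or not.
    Function.LeftInverse.isEmbedding (f := descend _ hB) (fun v => ?_)
      (ContinuousLinearMap.continuous _) (ContinuousLinearMap.continuous _)⟩
  · obtain ⟨G, rfl⟩ := ofSobolev_surjective ht v
    rw [hj, toDist_ofSobolev_xiInvTraceless ht ht']
  · obtain ⟨G, rfl⟩ := ofSobolev_surjective ht v
    rw [hj, descend_ofSobolev ht' _ hB]
    exact ofSobolev_eq_of_sub_mem ht (xiOne_xiInvTraceless_sub_mem hr G)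

/-- Ξ₊^{a-1} brings the exponent a-1 down to 0, and the trace factor is Γ(a)/Γ(1). -/
theorem exists_isPowerTimes_ofSobolev (ha : 0 < a) (ht : a - 1 / 2 < t) (ht' : a - 1 - 1 / 2 < t)
    (φ : 𝓢(Rd (m + 1), ℂ)) : ∃ φ' : 𝓢(Rd (m + 1), ℂ),
      (ofSobolev ht' (SobolevSpace.ofSchwartz _ φ')).toDist = powDist m (a - 1) φ ∧
        schwartzTrace m φ' = ((Real.Gamma a : ℝ) : ℂ) • schwartzTrace m φ := by
  obtain ⟨φ', h1, h2⟩ := exists_sgnDOp_powDist (b := a - 1) (s := a - 1) (by linarith)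
    (by linarith) φ
  refine ⟨φ', ?_, ?_⟩
  · rw [toDist_ofSobolev, toDist_zeroExtend_ofSchwartz (by linarith), ← sub_self (a - 1), ← h1,
      sgnDOp_sgnDOp, neg_add_cancel, sgnDOp_zero]
  · rw [h2]
    simp

theorem isPowerTimes_ofSobolev_ofSchwartz (ha : 0 < a) (ht : a - 1 / 2 < t)
    (ht' : a - 1 - 1 / 2 < t) (φ : 𝓢(Rd (m + 1), ℂ)) : ∃ φ' : 𝓢(Rd (m + 1), ℂ),
      IsPowerTimes (a - 1) φ' (ofSobolev ht' (SobolevSpace.ofSchwartz _ φ)).toDist := by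
  obtain ⟨φ', h, -⟩ := exists_sgnDOp_powDist (b := 0) (s := -(a - 1)) (by norm_num)
    (by linarith) φ
  refine ⟨φ', ?_⟩
  rw [toDist_ofSobolev, toDist_zeroExtend_ofSchwartz (by linarith), h, zero_sub, neg_neg]
  exact isPowerTimes_powDist (by linarith) φ'

end Comparison

end HalfSpace

end

/-! ### The theorem. -/

open HalfSpace in
theorem theorem2p1 (m : ℕ) (a t : ℝ) (ha : 0 < a) (ht : a - 1 / 2 < t) :
    -- the space `x_n^{a-1} 𝒮` (extended by zero) lies densely in `H^{(a-1)(t)}`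
    (∀ φ : 𝓢(Rd (m + 1), ℂ), ∃ u : TransmissionSpace m (a - 1) t,
      IsPowerTimes (a - 1) φ u.toDist) ∧
    Dense {u : TransmissionSpace m (a - 1) t |
      ∃ φ : 𝓢(Rd (m + 1), ℂ), IsPowerTimes (a - 1) φ u.toDist} ∧
    -- the weighted trace extends to a continuous linear surjection
    ∃ γ : TransmissionSpace m (a - 1) t →L[ℂ] SobolevSpace (Rd m) (t - a + 1 / 2),
      (∀ (φ : 𝓢(Rd (m + 1), ℂ)) (u : TransmissionSpace m (a - 1) t),
        IsPowerTimes (a - 1) φ u.toDist →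
          (γ u).toDist = (schwartzTrace m φ : 𝓢'(Rd m, ℂ))) ∧
      Function.Surjective γ ∧
      -- `H^{a(t)}` is a closed subspace of `H^{(a-1)(t)}`, equal to the kernel
      ∃ j : TransmissionSpace m a t →L[ℂ] TransmissionSpace m (a - 1) t,
        (∀ v, (j v).toDist = v.toDist) ∧
        Topology.IsClosedEmbedding j ∧
        Set.range j = {u | γ u = 0} := by
  have ht' : a - 1 - 1 / 2 < t := by linarith
  have hσ : 1 / 2 < t - (a - 1) := by linarith
  have hr : t - a + 1 / 2 = t - (a - 1) - 1 / 2 := by ring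
  have hΓ : ((Real.Gamma a : ℝ) : ℂ) ≠ 0 := by exact_mod_cast (Real.Gamma_pos_of_pos ha).ne'
  refine ⟨fun φ => ?_, ?_, ?_⟩
  · obtain ⟨φ', h, -⟩ := exists_isPowerTimes_ofSobolev ha ht ht' φ
    refine ⟨ofSobolev ht' (SobolevSpace.ofSchwartz _ φ'), ?_⟩
    rw [h]
    exact isPowerTimes_powDist (by linarith) φ
  · have h : DenseRange (ofSobolevCLM ht' ∘ SobolevSpace.ofSchwartz (E := Rd (m + 1)) _) :=
      (ofSobolev_surjective ht').denseRange.comp (SobolevSpace.denseRange_ofSchwartz _)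
        (ofSobolevCLM ht').continuous
    refine h.mono ?_
    rintro _ ⟨φ, rfl⟩
    exact isPowerTimes_ofSobolev_ofSchwartz ha ht ht' φ
  · have hA : ∀ G : SobolevSpace (Rd (m + 1)) (t - (a - 1)), IsVanishingOn G.toDist (upper m) →
        traceMap m (t - (a - 1)) (t - a + 1 / 2) G = 0 := fun G hG => traceMap_eq_zero hσ hr hG
    -- The map γ is Γ(a)⁻¹ times the ordinary trace of G, since the coefficient φ of x_n^{a-1}
    -- corresponds to a G whose trace is Γ(a)γ₀φ.
    have hγ : ∀ G, (((Real.Gamma a : ℝ) : ℂ)⁻¹ • descend _ hA) (ofSobolev ht' G) =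
        ((Real.Gamma a : ℝ) : ℂ)⁻¹ • traceMap m (t - (a - 1)) (t - a + 1 / 2) G := fun G => by
      rw [smul_apply, descend_ofSobolev]
    obtain ⟨j, hj, hemb⟩ := exists_inclusion (m := m) ht hr
    have hrange : Set.range j =
        {u | (((Real.Gamma a : ℝ) : ℂ)⁻¹ • descend _ hA) u = 0} := by
      ext u
      constructor
      · rintro ⟨v, rfl⟩
        obtain ⟨G, rfl⟩ := ofSobolev_surjective ht v
        have h : j (ofSobolev ht G) = ofSobolev ht' (xiInvTraceless m a t hr G) :=
          TransmissionSpace.toDist_injective (by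
            rw [hj, toDist_ofSobolev_xiInvTraceless ht ht'])
        rw [Set.mem_ofPred_eq, h, hγ, traceMap_xiInvTraceless ht, smul_zero]
      · intro hu
        obtain ⟨G, rfl⟩ := ofSobolev_surjective ht' u
        rw [Set.mem_ofPred_eq, hγ, smul_eq_zero, or_iff_right (inv_ne_zero hΓ)] at hu
        refine ⟨ofSobolev ht (xiOne m a t G), TransmissionSpace.toDist_injective ?_⟩
        rw [hj, toDist_ofSobolev_of_traceMap_eq_zero ht ht' hr hu]
    refine ⟨((Real.Gamma a : ℝ) : ℂ)⁻¹ • descend _ hA, fun φ u hu => ?_, fun ψ => ?_, j, hj,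
      ⟨hemb, ?_⟩, hrange⟩
    · obtain ⟨φ', h, h2⟩ := exists_isPowerTimes_ofSobolev ha ht ht' φ
      have e : u = ofSobolev ht' (SobolevSpace.ofSchwartz _ φ') :=
        TransmissionSpace.toDist_injective (by
          rw [h]
          exact hu.eq_powDist (by linarith))
      rw [e, hγ, traceMap_ofSchwartz hσ hr, map_smul, SobolevSpace.toDist_ofSchwartz, h2, map_smul,
        inv_smul_smul₀ hΓ]
    · refine ⟨ofSobolev ht' (lift hr (((Real.Gamma a : ℝ) : ℂ) • ψ)), ?_⟩
      rw [hγ, traceMap_lift hσ, inv_smul_smul₀ hΓ]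
    -- The range is closed because it is the kernel of the continuous map γ.
    · rw [hrange]
      exact isClosed_eq (ContinuousLinearMap.continuous _) continuous_const
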